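/- Let $J$ be a finite-dimensional real vector space with a cubic norm structure: a base point $1_J$, a cubic form $N$ with symmetric trilinear polarisation $(\cdot,\cdot,\cdot)$ normalised by $(x,x,x)=6N(x)$, a quadratic map $\#:J\to J$ and a symmetric bilinear trace form $(\cdot,\cdot)$ such that, with $x\times y=(x+y)^\#-x^\#-y^\#$, one has $N(1_J)=1$, $1_J^\#=1_J$, $1_J\times x=(1_J,x)1_J-x$, $(x^\#)^\#=N(x)x$, $(x,y)=\tfrac14(1_J,1_J,x)(1_J,1_J,y)-(1_J,x,y)$ and $N(x+y)=N(x)+(x^\#,y)+(x,y^\#)+N(y)$. Assume that the trace form is positive definite (so $J$ is one of $\mathbb R$, $\mathbb R\oplus\Gamma_{n-1,1}$, $\mathrm{Herm}_3(\mathbb K)$ with $\mathbb K=\mathbb R,\mathbb C,\mathbb H,\mathbb O$). Let $n=\dim J$, fix a basis of $J$, and identify $J^\vee$ with $J$ by the trace form. Let $V=\mathbb R\oplus J\oplus J^\vee\oplus\mathbb R$, with elements $\gamma=(p^0,p,q,q_0)$, symplectic form $\langle\gamma,\gamma'\rangle=q_0p'^0+(q,p')-p^0q_0'-(p,q')$ and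 quartic form $$I_4(\gamma)=4p^0N(q)-4q_0N(p)+4(q^\#,p^\#)-(p^0q_0+(p,q))^2 .$$ Let $G$ be the group of $g\in GL(V)$ for which there is $\nu\in\mathbb R^\times$ with $\langle gv,gw\rangle=\nu\langle v,w\rangle$ and $I_4(gv)=\nu^2I_4(v)$ for all $v,w\in V$, and let $\mathrm{Stab}_\pm(\gamma)=\{g\in G: g\gamma=\pm\gamma\}$. Let $J_+$ be the connected component of $1_J$ in $\{N>0\}$ and let $\mathcal M=J+iJ_+\subset J_{\mathbb C}$ be the hermitian symmetric tube domain, embedded in $\mathbb P(V_{\mathbb C})$ by $t\mapsto[\Omega(t)]$, $\Omega(t)=(1,t,-t^\#,N(t))$. Through this embedding $G$ acts (partially) on $\mathcal M$: $g$ takes $t$ to $t'$ if $g[\Omega(t)]=[\Omega(t')]$. Define $K$ by $e^{-K}=i\langle\Omega,\overline\Omega\rangle$, the Kähler metric $g_{i\bar\jmath}=\partial_i\partial_{\bar\jmath}K$ on $\mathcal M$, $Z=\langle\gamma,\Omega\rangle$, $D_iZ=\partial_iZ+(\partial_iK)Z$ and $$V_{\mathrm{eff}}=e^{K}\bigl[g^{i\bar\jmath}(D_iZ)(\overline{D_jZ})+|Z|^2\bigr].$$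 Theorem. (1) Let $\gamma\in V$ be a non-BPS charge vector, i.e. $I_4(\gamma)<0$. Then the set $\mathcal N$ of critical points of $V_{\mathrm{eff}}$ in $\mathcal M$ is a sub-symmetric space of $\mathcal M$ of real dimension $n-1$: it is nonempty, connected, closed in $\mathcal M$, an embedded smooth submanifold of dimension $n-1$, and for every $p\in\mathcal N$ there is a geodesic symmetry of $\mathcal M$ at $p$ (an involutive isometry of $\mathcal M$ fixing $p$ with differential $-1$ at $p$) that maps $\mathcal N$ into itself. Moreover $\mathcal N$ is an orbit of $\mathrm{Stab}_\pm(\gamma)$: for every $t_0\in\mathcal N$, $\mathcal N$ is the set of $t\in\mathcal M$ to which $t_0$ is taken by some element of $\mathrm{Stab}_\pm(\gamma)$, and also the set of those to which it is taken by some element of $\mathrm{Stab}_\pm(\gamma)$ that maps $\mathcal M$ onto itself. (2) If $\gamma=(p^0,0,0,q_0)$ (that is, $p=0$ and $q=0$) with $p^0q_0\neq0$, then $I_4(\gamma)<0$ and $$\mathcal N=\{x+iy\in\mathcal M:\ x=0,\ N(y)=|q_0/p^0|\}.$$ -/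

import Mathlib

open scoped ContDiff

/-- A cubic norm structure on a real vector space `J`: a base point `1_J`, a cubic form `norm`
(with its symmetric trilinear polarisation `tri`, normalised by `(x,x,x) = 6 N(x)`), a quadratic
map `sharp : J → J` and a symmetric bilinear trace form `trace`.  Here `QuadraticMap.polar sharp x y`
is `x × y = (x + y)^# - x^# - y^#`. -/
structure CubicNormStructure (J : Type*) [AddCommGroup J] [Module ℝ J] where
  one : J
  norm : J → ℝ
  tri : J →ₗ[ℝ] J →ₗ[ℝ] J →ₗ[ℝ] ℝ
  sharp : QuadraticMap ℝ J J
  trace : J →ₗ[ℝ] J →ₗ[ℝ] ℝ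
  tri_swap_left : ∀ x y z, tri x y z = tri y x z
  tri_swap_right : ∀ x y z, tri x y z = tri x z y
  tri_self : ∀ x, tri x x x = 6 * norm x
  trace_symm : ∀ x y, trace x y = trace y x
  norm_one : norm one = 1
  sharp_one : sharp one = one
  one_cross : ∀ x, QuadraticMap.polar sharp one x = trace one x • one - x
  sharp_sharp : ∀ x, sharp (sharp x) = norm x • x
  trace_eq : ∀ x y, trace x y = (1 / 4) * tri one one x * tri one one y - tri one x y
  norm_add : ∀ x y, norm (x + y) = norm x + trace (sharp x) y + trace x (sharp y) + norm y

/-- The space of charge vectors `V_J = ℝ ⊕ J ⊕ J^∨ ⊕ ℝ`, with components `(p⁰, p, q, q₀)` in this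
order.  The dual `J^∨` is identified with `J` through the trace form, which is nondegenerate in all
cases considered; the canonical pairing of `J` with `J^∨` thereby becomes the trace form. -/
abbrev ChargeSpace (J : Type*) : Type _ := ℝ × J × J × ℝ

namespace CubicNormStructure

section Algebra

variable {J : Type*} [AddCommGroup J] [Module ℝ J] (C : CubicNormStructure J)

/-- The trace form is positive definite, i.e. the associated Jordan algebra is Euclidean.  The
Euclidean ones are exactly the real cubic Jordan algebras `ℝ`, `ℝ ⊕ Γ_{n-1,1}` and `Herm₃(𝕂)`, for
`𝕂` the real numbers, complex numbers, quaternions or octonions. -/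
def IsEuclidean : Prop := ∀ x : J, x ≠ 0 → 0 < C.trace x x

/-- The symplectic form on `V_J`, in a basis with `⟨γ^I, γ_J⟩ = δ^I_J` and `v = p^I γ_I + q_I γ^I`. -/
def symp (v w : ChargeSpace J) : ℝ :=
  v.2.2.2 * w.1 + C.trace v.2.2.1 w.2.1 - v.1 * w.2.2.2 - C.trace v.2.1 w.2.2.1

/-- The quartic form
`I₄ = 4 p⁰ N(q) - 4 q₀ N(p) + 4 (q^#, p^#) - (p⁰ q₀ + (p, q))²`. -/
def quartic (v : ChargeSpace J) : ℝ :=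
  4 * v.1 * C.norm v.2.2.1 - 4 * v.2.2.2 * C.norm v.2.1
    + 4 * C.trace (C.sharp v.2.2.1) (C.sharp v.2.1)
    - (v.1 * v.2.2.2 + C.trace v.2.1 v.2.2.1) ^ 2

/-- The real points of the group `G_J` of similitudes of the symplectic form and the quartic form. -/
def group : Subgroup (ChargeSpace J ≃ₗ[ℝ] ChargeSpace J) where
  carrier := {g | ∃ ν : ℝ, ν ≠ 0 ∧ (∀ v w, C.symp (g v) (g w) = ν * C.symp v w) ∧
    ∀ v, C.quartic (g v) = ν ^ 2 * C.quartic v}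
  one_mem' := ⟨1, one_ne_zero, fun v w => by simp, fun v => by simp⟩
  mul_mem' := by
    rintro a b ⟨ν, hν, h1, h2⟩ ⟨μ, hμ, h3, h4⟩
    refine ⟨ν * μ, mul_ne_zero hν hμ, fun v w => ?_, fun v => ?_⟩
    · rw [LinearEquiv.mul_apply, LinearEquiv.mul_apply, h1, h3]; ring
    · rw [LinearEquiv.mul_apply, h2, h4]; ring
  inv_mem' := by
    rintro a ⟨ν, hν, h1, h2⟩
    have ha : ∀ v, a (a⁻¹ v) = v := fun v => a.apply_symm_apply v
    refine ⟨ν⁻¹, inv_ne_zero hν, fun v w => ?_, fun v => ?_⟩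
    · have h := h1 (a⁻¹ v) (a⁻¹ w)
      rw [ha, ha] at h
      rw [h]; field_simp
    · have h := h2 (a⁻¹ v)
      rw [ha] at h
      rw [h]; field_simp

/-- `Stab_±(γ) = {g ∈ G_J | g γ = ± γ}`. -/
def stabPM (γ : ChargeSpace J) : Subgroup (ChargeSpace J ≃ₗ[ℝ] ChargeSpace J) where
  carrier := {g | g ∈ C.group ∧ (g γ = γ ∨ g γ = -γ)}
  one_mem' := ⟨C.group.one_mem, Or.inl rfl⟩
  mul_mem' := by
    rintro a b ⟨ha, ha'⟩ ⟨hb, hb'⟩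
    refine ⟨C.group.mul_mem ha hb, ?_⟩
    rw [LinearEquiv.mul_apply]
    rcases ha' with ha' | ha' <;> rcases hb' with hb' | hb' <;> simp [ha', hb']
  inv_mem' := by
    rintro a ⟨ha, ha'⟩
    refine ⟨C.group.inv_mem ha, ?_⟩
    have h : a⁻¹ (a γ) = γ := a.symm_apply_apply γ
    rcases ha' with ha' | ha' <;> rw [ha'] at h
    · exact Or.inl h
    · rw [map_neg] at h
      exact Or.inr (neg_eq_iff_eq_neg.mp h)

/-! A pair `z = (x, y) : J × J` stands for the element `t = x + i y` of the complexification `J_ℂ`;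
likewise a pair in `ChargeSpace J × ChargeSpace J` stands for (real part) + `i` (imaginary part) in
`V_ℂ`. -/

/-- The cubic norm on `J_ℂ`:
`N(x + i y) = N(x) - (x, y^#) + i ((x^#, y) - N(y))`. -/
noncomputable def normC (z : J × J) : ℂ :=
  ⟨C.norm z.1 - C.trace z.1 (C.sharp z.2), C.trace (C.sharp z.1) z.2 - C.norm z.2⟩

/-- The sharp map on `J_ℂ`: `(x + i y)^# = x^# - y^# + i (x × y)`. -/
def sharpC (z : J × J) : J × J :=
  (C.sharp z.1 - C.sharp z.2, QuadraticMap.polar C.sharp z.1 z.2)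

/-- The trivialisation `Ω(t) = (1, t, -t^#, N(t))` of `H^{3,0}`: the vector `(X^I, F_I)` for the
prepotential `F = -N(X)/X⁰` at `X⁰ = 1`.  It is the translate of `(1, 0, 0, 0)` by the unipotent
element of `G_J(ℂ)` attached to `t`, so it lies on the `G_J(ℂ)`-orbit of `(1, 0, 0, 0)`. -/
noncomputable def period (z : J × J) : ChargeSpace J × ChargeSpace J :=
  ((1, z.1, -(C.sharpC z).1, (C.normC z).re), (0, z.2, -(C.sharpC z).2, (C.normC z).im))

/-- The complex bilinear extension of the symplectic form to `V_ℂ`. -/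
noncomputable def sympC (u v : ChargeSpace J × ChargeSpace J) : ℂ :=
  ⟨C.symp u.1 v.1 - C.symp u.2 v.2, C.symp u.1 v.2 + C.symp u.2 v.1⟩

/-- The Kähler potential `K`, defined by `e^{-K} = i ⟨Ω, Ω̄⟩`. -/
noncomputable def kahlerPotential (z : J × J) : ℝ :=
  -Real.log (Complex.I * C.sympC (C.period z) ((C.period z).1, -(C.period z).2)).re

/-- The central charge `Z = ⟨γ, Ω⟩`. -/
noncomputable def centralCharge (γ : ChargeSpace J) (z : J × J) : ℂ :=
  C.sympC (γ, 0) (C.period z)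

/-- `g` takes the point `[Ω(z)]` of `ℙ(V_ℂ)` to the point `[Ω(w)]`:
`g Ω(z) = c Ω(w)` for some complex number `c ≠ 0`. -/
def Moves (g : ChargeSpace J ≃ₗ[ℝ] ChargeSpace J) (z w : J × J) : Prop :=
  ∃ c : ℂ, c ≠ 0 ∧
    g (C.period z).1 = c.re • (C.period w).1 - c.im • (C.period w).2 ∧
    g (C.period z).2 = c.re • (C.period w).2 + c.im • (C.period w).1

end Algebra

section Domain

variable {J : Type*} [NormedAddCommGroup J] [NormedSpace ℝ J] (C : CubicNormStructure J)

/-- The positive cone `J_+`: the connected component of `1_J` in `{y | N(y) > 0}`. -/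
def cone : Set J := connectedComponentIn {y | 0 < C.norm y} C.one

/-- The hermitian symmetric tube domain `𝓜 = J + i J_+`. -/
def domain : Set (J × J) := {z | z.2 ∈ C.cone}

/-- `g` maps the domain `𝓜` (viewed in `ℙ(V_ℂ)`) onto itself. -/
def PreservesDomain (g : ChargeSpace J ≃ₗ[ℝ] ChargeSpace J) : Prop :=
  (∀ z ∈ C.domain, ∃ w ∈ C.domain, C.Moves g z w) ∧
    ∀ w ∈ C.domain, ∃ z ∈ C.domain, C.Moves g z w

/-- The derivative `∂/∂t` in the direction `v`: `½ (∂_x - i ∂_y)`. -/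
noncomputable def dHol (f : J × J → ℂ) (v : J) (z : J × J) : ℂ :=
  (1 / 2) * (fderiv ℝ f z (v, 0) - Complex.I * fderiv ℝ f z (0, v))

/-- The derivative `∂/∂t̄` in the direction `v`: `½ (∂_x + i ∂_y)`. -/
noncomputable def dAnti (f : J × J → ℂ) (v : J) (z : J × J) : ℂ :=
  (1 / 2) * (fderiv ℝ f z (v, 0) + Complex.I * fderiv ℝ f z (0, v))

variable {ι : Type*} [Fintype ι] [DecidableEq ι] (b : Module.Basis ι ℝ J)

/-- The Kähler metric `g_{i j̄} = ∂_i ∂_{j̄} K` in the coordinates given by a basis of `J`. -/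
noncomputable def metric (z : J × J) : Matrix ι ι ℂ :=
  Matrix.of fun i j => dHol (dAnti (fun w => (C.kahlerPotential w : ℂ)) (b j)) (b i) z

/-- The square length `∑ g_{i j̄} c^i c̄^j` of the tangent vector `w` at `z`, where `c^i` are the
complex coordinates of `w`. -/
noncomputable def lengthSq (z w : J × J) : ℝ :=
  (∑ i, ∑ j, C.metric b z i j * (⟨b.repr w.1 i, b.repr w.2 i⟩ : ℂ) *
    (starRingEnd ℂ) ⟨b.repr w.1 j, b.repr w.2 j⟩).re

/-- The covariant derivative `D_i Z = ∂_i Z + (∂_i K) Z` of the central charge. -/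
noncomputable def covDeriv (γ : ChargeSpace J) (z : J × J) (i : ι) : ℂ :=
  dHol (C.centralCharge γ) (b i) z
    + dHol (fun w => (C.kahlerPotential w : ℂ)) (b i) z * C.centralCharge γ z

/-- The effective (black hole) potential
`V_eff = e^K (g^{i j̄} (D_i Z) (D̄_{j̄} Z̄) + |Z|²)`. -/
noncomputable def effectivePotential (γ : ChargeSpace J) (z : J × J) : ℝ :=
  Real.exp (C.kahlerPotential z) *
    ((∑ i, ∑ j, (C.metric b z)⁻¹ j i * C.covDeriv b γ z i *
        (starRingEnd ℂ) (C.covDeriv b γ z j)).re + ‖C.centralCharge γ z‖ ^ 2)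

/-- The critical locus of `V_eff` in the domain `𝓜`. -/
def criticalLocus (γ : ChargeSpace J) : Set (J × J) :=
  {z | z ∈ C.domain ∧ HasFDerivAt (C.effectivePotential b γ) (0 : J × J →L[ℝ] ℝ) z}

/-- `σ` is the geodesic symmetry of `𝓜` at `p`: an involutive isometry of `𝓜` (for the Kähler
metric) fixing `p`, with differential `-1` there. -/
structure IsGeodesicSymmetry (p : J × J) (σ : J × J → J × J) : Prop where
  mapsTo : Set.MapsTo σ C.domain C.domain
  smooth : ContDiffOn ℝ ∞ σ C.domain
  involutive : ∀ z ∈ C.domain, σ (σ z) = z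
  isometry : ∀ z ∈ C.domain, ∀ w, C.lengthSq b (σ z) (fderiv ℝ σ z w) = C.lengthSq b z w
  fixed : σ p = p
  fderiv_eq : fderiv ℝ σ p = -ContinuousLinearMap.id ℝ (J × J)

end Domain

end CubicNormStructure

/-- `S` is an embedded smooth submanifold of dimension `d` of the normed space `E`: around each of
its points there is a smooth chart of `E` in which `S` becomes a linear subspace of dimension `d`. -/
def IsEmbeddedSubmanifold {E : Type*} [NormedAddCommGroup E] [NormedSpace ℝ E] (d : ℕ)
    (S : Set E) : Prop :=
  ∀ p ∈ S, ∃ (φ : OpenPartialHomeomorph E E) (W : Submodule ℝ E),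
    p ∈ φ.source ∧ Module.finrank ℝ W = d ∧
    ContDiffOn ℝ ∞ φ φ.source ∧ ContDiffOn ℝ ∞ φ.symm φ.target ∧
    ∀ z ∈ φ.source, z ∈ S ↔ φ z ∈ W

/-- `S` is a sub-symmetric space of dimension `d` of the hermitian symmetric domain `𝓜`: a
connected (in particular nonempty) embedded submanifold, closed in `𝓜`, and stable under the
geodesic symmetry of `𝓜` at each of its points. -/
structure CubicNormStructure.IsSymmetricSubspace {J : Type*} [NormedAddCommGroup J]
    [NormedSpace ℝ J] (C : CubicNormStructure J) {ι : Type*} [Fintype ι] [DecidableEq ι]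
    (b : Module.Basis ι ℝ J) (d : ℕ) (S : Set (J × J)) : Prop where
  subset : S ⊆ C.domain
  closed : ∃ T : Set (J × J), IsClosed T ∧ S = T ∩ C.domain
  connected : IsConnected S
  submanifold : IsEmbeddedSubmanifold d S
  symmetric : ∀ p ∈ S, ∃ σ : J × J → J × J, C.IsGeodesicSymmetry b p σ ∧ Set.MapsTo σ S S

/-! The effective potential has a form that is covariant under the similitude group. Expand I₄(γ +
sw) in s, take the s²-coefficients at w = Re Ω and w = Im Ω, subtract their sum from 3|⟨γ, Ω⟩|² and
divide by 8 N(Im t): the result is V_eff (`effectivePotential_eq`). If g Ω(t) = c Ω(t') and g has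
multiplier ν, the factors |c|² cancel and V_eff(gγ, t') = ν V_eff(γ, t) (`potential_equivariant`).

Translations t ↦ t + x, the inversion t ↦ -t⁻¹ and the maps t ↦ U_w t preserve the domain, and
together they carry a charge with I₄ < 0 to the axis (p⁰, 0, 0, q₀) (`exists_normal_form`). Positive
definiteness of the trace form makes the cone consist of squares U_w 1 (`exists_uop_one_eq`), so a
point of the domain can also be moved to x + i·1, at the cost of replacing q₀ by q₀ / N(w)².

There V_eff = ((q₀ - p⁰N)² + p⁰²(1 + A + B))/2 with A = (x, x), B = (x^#, x^#), N = N(x).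
Criticality under scaling x and scaling the imaginary part, combined with 3B ≤ A² and 3N²A ≤ B²,
gives (A + B)³ ≤ 0, hence x = 0 and q₀² = p⁰² (`eq_zero_of_mem_criticalLocus_axis_one`). Conversely
such points attain the lower bound |p⁰q₀| (`le_potential_axis`). So the critical points are exactly
the points where V_eff = √(-I₄(γ)), and for an axis charge they are the iy with N(y) = |q₀/p⁰|.

The rest is geometry of this slice. It is connected, closed and linear in a logarithmic chart. An
element of Stab_± moving a critical point to a point of the domain has ν = 1, so it respects the
level; the elements U_w U_v⁻¹ with N(w)² = N(v)² fix the axis charge and act transitively. The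
Kähler metric is the Fubini–Study metric of i⟨·, ·̄⟩ and is therefore invariant, so conjugates of
the inversion are the geodesic symmetries. At a point of the slice the symmetry changes the axis
charge to ±(p⁰, 0, 0, -q₀), which has the same critical locus. -/

namespace CubicNormStructure

/-! ### Identities of cubic norm structures and the operator U_x. -/

section AlgebraicIdentities

variable {J : Type*} [AddCommGroup J] [Module ℝ J] (C : CubicNormStructure J)

/-- The product `x × y` as a bilinear map. -/
def cross : J →ₗ[ℝ] J →ₗ[ℝ] J := C.sharp.polarBilin

theorem polar_sharp (x y : J) : QuadraticMap.polar C.sharp x y = C.cross x y := rfl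

theorem sharp_add (x y : J) : C.sharp (x + y) = C.sharp x + C.sharp y + C.cross x y := by
  rw [← polar_sharp, QuadraticMap.polar]; abel

theorem sharp_sub (x y : J) : C.sharp (x - y) = C.sharp x + C.sharp y - C.cross x y := by
  rw [sub_eq_add_neg, sharp_add, map_neg (C.cross x), QuadraticMap.map_neg]; abel

theorem sharp_smul (s : ℝ) (x : J) : C.sharp (s • x) = s ^ 2 • C.sharp x := by
  rw [QuadraticMap.map_smul, sq]

theorem sharp_neg (x : J) : C.sharp (-x) = C.sharp x := QuadraticMap.map_neg _ _

theorem sharp_zero : C.sharp 0 = 0 := QuadraticMap.map_zero _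

theorem cross_comm (x y : J) : C.cross x y = C.cross y x := QuadraticMap.polar_comm _ _ _

theorem cross_self (x : J) : C.cross x x = (2 : ℝ) • C.sharp x := by
  rw [← polar_sharp, QuadraticMap.polar_self, ← Nat.cast_smul_eq_nsmul ℝ]; simp

theorem one_cross' (x : J) : C.cross C.one x = C.trace C.one x • C.one - x :=
  C.one_cross x

theorem norm_smul' (s : ℝ) (x : J) : C.norm (s • x) = s ^ 3 * C.norm x := by
  have h := C.tri_self (s • x)
  simp only [map_smul, LinearMap.smul_apply, smul_eq_mul, C.tri_self] at h
  linarith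

theorem norm_zero' : C.norm 0 = 0 := by simpa using C.norm_smul' 0 0

theorem norm_neg' (x : J) : C.norm (-x) = -C.norm x := by
  have := C.norm_smul' (-1) x
  simp only [neg_smul, one_smul] at this
  rw [this]; ring

/-- Subtracting the expansions of N at x + y and x - y removes the terms even in y; comparison with
the trilinear polarisation leaves the linear one. -/
theorem trace_sharp_left (x y : J) : C.trace (C.sharp x) y = 1 / 2 * C.tri x x y := by
  have h1 := C.norm_add x y
  have h2 := C.norm_add x (-y)
  have e1 := C.tri_self (x + y)
  have e2 := C.tri_self (x + -y)
  have a1 : C.tri y x x = C.tri x x y := by rw [C.tri_swap_left, C.tri_swap_right]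
  have a2 : C.tri x y x = C.tri x x y := by rw [C.tri_swap_right]
  have a3 : C.tri y x y = C.tri x y y := by rw [C.tri_swap_left]
  have a4 : C.tri y y x = C.tri x y y := by rw [C.tri_swap_right, C.tri_swap_left]
  simp only [map_add, map_neg, LinearMap.add_apply, LinearMap.neg_apply, C.tri_self, a1, a2, a3, a4,
    C.norm_neg', C.sharp_neg] at h1 h2 e1 e2
  linarith

theorem trace_cross (x y z : J) : C.trace (C.cross x y) z = C.tri x y z := by
  have h := C.trace_sharp_left (x + y) z
  have a : C.tri y x z = C.tri x y z := C.tri_swap_left _ _ _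
  simp only [sharp_add, map_add, LinearMap.add_apply, C.trace_sharp_left, a] at h
  linarith

theorem trace_cross_rotate (x y z : J) : C.trace (C.cross x y) z = C.trace x (C.cross y z) := by
  rw [C.trace_symm x, trace_cross, trace_cross, C.tri_swap_left, C.tri_swap_right]

theorem trace_sharp_self (x : J) : C.trace (C.sharp x) x = 3 * C.norm x := by
  rw [trace_sharp_left, C.tri_self]; ring

theorem trace_self_sharp (x : J) : C.trace x (C.sharp x) = 3 * C.norm x := by
  rw [C.trace_symm, trace_sharp_self]

theorem trace_one_one : C.trace C.one C.one = 3 := by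
  have := C.trace_sharp_self C.one
  rw [C.sharp_one, C.norm_one] at this
  linarith

theorem trace_cross_left_self (x y : J) :
    C.trace (C.cross x y) x = 2 * C.trace (C.sharp x) y := by
  rw [trace_cross, trace_sharp_left, C.tri_swap_right]; ring

theorem trace_cross_right_self (x y : J) :
    C.trace (C.cross x y) y = 2 * C.trace x (C.sharp y) := by
  rw [C.cross_comm, trace_cross_left_self, C.trace_symm]

theorem norm_add_smul (x y : J) (s : ℝ) : C.norm (x + s • y) =
    C.norm x + s * C.trace (C.sharp x) y + s ^ 2 * C.trace x (C.sharp y) + s ^ 3 * C.norm y := by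
  rw [C.norm_add, norm_smul', sharp_smul, map_smul, map_smul, smul_eq_mul, smul_eq_mul]

/-- These are the coefficients of s and s² in (u^#)^# = N(u)u at u = x + sy. Only the powers s, s²,
s³ remain, and the values at s = 1, -1, 2 separate them. -/
theorem sharp_sharp_linearized (x y : J) :
    C.cross (C.sharp x) (C.cross x y) = C.norm x • y + C.trace (C.sharp x) y • x ∧
    C.sharp (C.cross x y) + C.cross (C.sharp x) (C.sharp y) =
      C.trace (C.sharp x) y • y + C.trace x (C.sharp y) • x := by
  have key : ∀ s : ℝ, s • C.cross (C.sharp x) (C.cross x y) + s ^ 2 • (C.sharp (C.cross x y) +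
      C.cross (C.sharp x) (C.sharp y)) + s ^ 3 • C.cross (C.sharp y) (C.cross x y)
      = s • (C.norm x • y + C.trace (C.sharp x) y • x) + s ^ 2 • (C.trace (C.sharp x) y • y +
        C.trace x (C.sharp y) • x) + s ^ 3 • (C.norm y • x + C.trace x (C.sharp y) • y) := by
    intro s
    have h := C.sharp_sharp (x + s • y)
    simp only [sharp_add, sharp_smul, map_smul, map_add, norm_add_smul, LinearMap.add_apply,
      LinearMap.smul_apply, C.sharp_sharp, C.cross_comm (C.sharp y)] at h ⊢
    linear_combination (norm := module) h
  have h1 := key 1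
  have h2 := key (-1)
  have h3 := key 2
  constructor
  · linear_combination (norm := module) h1 - (1 / 3 : ℝ) • h2 - (1 / 6 : ℝ) • h3
  · linear_combination (norm := module) (1 / 2 : ℝ) • h1 + (1 / 2 : ℝ) • h2

theorem cross_sharp_cross (x y : J) :
    C.cross (C.sharp x) (C.cross x y) = C.norm x • y + C.trace (C.sharp x) y • x :=
  (C.sharp_sharp_linearized x y).1

theorem sharp_cross (x y : J) : C.sharp (C.cross x y) =
    C.trace (C.sharp x) y • y + C.trace x (C.sharp y) • x - C.cross (C.sharp x) (C.sharp y) :=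
  eq_sub_of_add_eq (C.sharp_sharp_linearized x y).2

theorem trace_self (x : J) : C.trace x x =
    C.trace C.one x ^ 2 - 2 * C.trace C.one (C.sharp x) := by
  have h := C.trace_cross_right_self C.one x
  rw [one_cross', map_sub, map_smul, LinearMap.sub_apply, LinearMap.smul_apply, smul_eq_mul] at h
  linarith

theorem norm_sharp (x : J) : C.norm (C.sharp x) = C.norm x ^ 2 := by
  have h := C.trace_self_sharp (C.sharp x)
  rw [C.sharp_sharp, map_smul, C.trace_sharp_self, smul_eq_mul] at h
  linarith

theorem trace_sharp_sharp_self (x : J) : C.trace (C.sharp x) (C.sharp x) =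
    C.trace C.one (C.sharp x) ^ 2 - 2 * C.trace C.one x * C.norm x := by
  rw [trace_self, C.sharp_sharp, map_smul, smul_eq_mul]; ring

theorem cross_self_sharp (x : J) : C.cross x (C.sharp x) =
    (C.trace C.one x * C.trace C.one (C.sharp x) - C.norm x) • C.one
      - C.trace C.one (C.sharp x) • x - C.trace C.one x • C.sharp x := by
  have h := C.cross_sharp_cross x C.one
  rw [C.cross_comm x C.one, one_cross', map_sub, map_smul, C.cross_comm _ C.one, one_cross',
    C.cross_comm _ x, C.trace_symm (C.sharp x)] at h
  linear_combination (norm := module) -h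

/-- The quadratic operator `U_x y = (x, y) x - x^# × y`. -/
def uop (x : J) : J →ₗ[ℝ] J := (C.trace x).smulRight x - C.cross (C.sharp x)

theorem uop_apply (x y : J) : C.uop x y = C.trace x y • x - C.cross (C.sharp x) y := rfl

theorem trace_uop (x y z : J) : C.trace (C.uop x y) z = C.trace y (C.uop x z) := by
  simp only [uop_apply, map_sub, map_smul, LinearMap.sub_apply, LinearMap.smul_apply, smul_eq_mul]
  rw [C.cross_comm _ y, trace_cross_rotate, C.trace_symm y x]; ring

theorem trace_uop_self (x y : J) : C.trace (C.uop x y) y =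
    C.trace x y ^ 2 - 2 * C.trace (C.sharp x) (C.sharp y) := by
  simp only [uop_apply, map_sub, map_smul, LinearMap.sub_apply, LinearMap.smul_apply, smul_eq_mul]
  rw [trace_cross_right_self]; ring

/-- For N(x) ≠ 0 this and `uop_sharp_uop` exhibit N(x)⁻² U_{x^#} as the inverse of U_x. -/
theorem uop_uop_sharp (x y : J) : C.uop x (C.uop (C.sharp x) y) = C.norm x ^ 2 • y := by
  simp only [uop_apply, map_sub, map_smul, C.sharp_sharp, LinearMap.smul_apply,
    cross_sharp_cross, cross_self, C.trace_self_sharp]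
  rw [C.trace_symm x, trace_cross_left_self]
  module

theorem uop_smul (s : ℝ) (x y : J) : C.uop (s • x) y = s ^ 2 • C.uop x y := by
  simp only [uop_apply, sharp_smul, map_smul, LinearMap.smul_apply, smul_eq_mul]; module

theorem uop_sharp_uop (x y : J) (hx : C.norm x ≠ 0) :
    C.uop (C.sharp x) (C.uop x y) = C.norm x ^ 2 • y := by
  have h := C.uop_uop_sharp (C.sharp x) y
  rw [C.sharp_sharp, uop_smul, map_smul, norm_sharp] at h
  have h2 : C.norm x ^ 2 ≠ 0 := pow_ne_zero _ hx
  have := congrArg (fun v => (C.norm x ^ 2)⁻¹ • v) h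
  simp only [smul_smul, inv_mul_cancel₀ h2, one_smul] at this
  rw [this]; congr 1; field_simp

theorem cross_cross_sharp (x y : J) (hx : C.norm x ≠ 0) :
    C.cross x (C.cross (C.sharp x) y) = C.norm x • y + C.trace x y • C.sharp x := by
  have h := C.cross_sharp_cross (C.sharp x) y
  rw [C.sharp_sharp, map_smul, map_smul, norm_sharp] at h
  have := congrArg (fun v => (C.norm x)⁻¹ • v) h
  simp only [LinearMap.smul_apply, smul_smul, smul_add, smul_eq_mul, inv_mul_cancel₀ hx, one_smul] at this
  rw [this]; congr 2 <;> field_simp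

/-- With `norm_uop` this makes U_x a similarity of the whole structure, so that t ↦ U_x t extends to
an element of the group on V acting by U_{x^#} on the dual component. -/
theorem sharp_uop (x y : J) (hx : C.norm x ≠ 0) :
    C.sharp (C.uop x y) = C.uop (C.sharp x) (C.sharp y) := by
  simp only [uop_apply, sharp_sub, sharp_smul, sharp_cross, C.sharp_sharp, map_smul,
    LinearMap.smul_apply, smul_eq_mul, cross_cross_sharp _ _ _ hx]
  module

theorem norm_uop (x y : J) (hx : C.norm x ≠ 0) :
    C.norm (C.uop x y) = C.norm x ^ 2 * C.norm y := by
  have h := C.trace_sharp_self (C.uop x y)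
  rw [sharp_uop _ _ _ hx, C.trace_symm, trace_uop, uop_uop_sharp, map_smul, C.trace_self_sharp,
    smul_eq_mul] at h
  linarith

theorem uop_sharp_cross (x y z : J) (hx : C.norm x ≠ 0) :
    C.cross (C.uop x y) (C.uop x z) = C.uop (C.sharp x) (C.cross y z) := by
  have h := C.sharp_uop x (y + z) hx
  rw [map_add, sharp_add, sharp_add, map_add, map_add, sharp_uop _ _ _ hx, sharp_uop _ _ _ hx] at h
  exact add_left_cancel h

end AlgebraicIdentities

end CubicNormStructure

namespace CubicNormStructure

/-! ### Positive elements are squares. -/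

section SquareRoots

variable {J : Type*} [AddCommGroup J] [Module ℝ J] (C : CubicNormStructure J)

theorem trace_self_nonneg (hC : C.IsEuclidean) (x : J) : 0 ≤ C.trace x x := by
  by_cases h : x = 0
  · simp [h]
  · exact (hC x h).le

theorem eq_zero_of_trace_self (hC : C.IsEuclidean) {x : J} (h : C.trace x x = 0) : x = 0 := by
  by_contra hx
  exact (hC x hx).ne' h

theorem norm_one_smul_sub (l : ℝ) (x : J) : C.norm (l • C.one - x) =
    l ^ 3 - l ^ 2 * C.trace C.one x + l * C.trace C.one (C.sharp x) - C.norm x := by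
  rw [sub_eq_add_neg, C.norm_add, norm_smul', sharp_smul, C.sharp_one, norm_neg', sharp_neg,
    C.norm_one]
  simp only [map_smul, map_neg, LinearMap.smul_apply, smul_eq_mul]
  ring

theorem uop_one (w : J) : C.uop w C.one =
    C.trace C.one w • w - C.trace C.one (C.sharp w) • C.one + C.sharp w := by
  rw [uop_apply, C.cross_comm, one_cross', C.trace_symm w]; abel

/-- The elements all of whose elementary symmetric functions of eigenvalues are positive. -/
def IsPos (y : J) : Prop :=
  0 < C.trace C.one y ∧ 0 < C.trace C.one (C.sharp y) ∧ 0 < C.norm y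

theorem trace_one_uop_one (w : J) : C.trace C.one (C.uop w C.one) = C.trace w w := by
  rw [C.trace_symm, trace_uop, ← trace_uop, uop_one, trace_self]
  simp only [map_sub, map_add, map_smul, LinearMap.sub_apply, LinearMap.add_apply,
    LinearMap.smul_apply, smul_eq_mul, C.trace_one_one]
  rw [C.trace_symm w, C.trace_symm _ C.one]
  ring

/-- U_w 1 is the square of w, and its trace is (w, w). Since (U_w 1)^# = U_{w^#} 1, the same
computation settles the second symmetric function. -/
theorem isPos_uop_one (hC : C.IsEuclidean) {w : J} (hw : C.norm w ≠ 0) :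
    C.IsPos (C.uop w C.one) := by
  refine ⟨?_, ?_, ?_⟩
  · rw [trace_one_uop_one]
    refine hC w ?_
    rintro rfl
    exact hw C.norm_zero'
  · rw [sharp_uop _ _ _ hw, C.sharp_one, trace_one_uop_one]
    refine hC _ ?_
    intro h
    have := C.norm_sharp w
    rw [h, norm_zero'] at this
    exact hw (pow_eq_zero_iff two_ne_zero |>.1 this.symm)
  · rw [norm_uop _ _ _ hw, C.norm_one]
    positivity

/-- Positivity is not lost at the boundary while N > 0: if T = (1, y) vanished, then (y, y) = -2S ≤
0, and if S = (1, y^#) vanished, then (y^#, y^#) = -2TN ≤ 0. Hence the positive set is relatively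
closed in {N > 0}. -/
theorem isPos_of_nonneg (hC : C.IsEuclidean) {y : J} (h1 : 0 ≤ C.trace C.one y)
    (h2 : 0 ≤ C.trace C.one (C.sharp y)) (h3 : 0 < C.norm y) : C.IsPos y := by
  have hy : y ≠ 0 := by
    rintro rfl
    rw [norm_zero'] at h3
    exact h3.false
  have hy' : C.sharp y ≠ 0 := by
    intro h
    have := C.norm_sharp y
    rw [h, norm_zero'] at this
    exact h3.ne' (pow_eq_zero_iff two_ne_zero |>.1 this.symm)
  have e1 := hC _ hy
  have e2 := hC _ hy'
  rw [trace_self] at e1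
  rw [trace_sharp_sharp_self] at e2
  refine ⟨lt_of_le_of_ne h1 ?_, lt_of_le_of_ne h2 ?_, h3⟩
  · intro h
    rw [← h] at e1
    linarith
  · intro h
    rw [← h] at e2
    nlinarith [mul_nonneg h1 h3.le]

/-- The discriminant of the residual quadratic factor is nonnegative. -/
theorem four_mul_le_sq_of_norm_eq_zero (hC : C.IsEuclidean) {x : J} (hx : C.norm x = 0) :
    4 * C.trace C.one (C.sharp x) ≤ C.trace C.one x ^ 2 := by
  set T := C.trace C.one x with hT
  set S := C.trace C.one (C.sharp x) with hS
  have hS2 : C.trace (C.sharp x) (C.sharp x) = S ^ 2 := by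
    rw [trace_sharp_sharp_self, hx, ← hS]; ring
  -- Heuristically, if x has eigenvalues 0, a, b, then S·1 - x^# is S times the projection e onto
  -- the last two, so the vector is S(x - (T/2)e), of squared length S²(a - b)²/2.
  have h := C.trace_self_nonneg hC (S • x - (T / 2) • (S • C.one - C.sharp x))
  have e : C.trace (S • x - (T / 2) • (S • C.one - C.sharp x))
      (S • x - (T / 2) • (S • C.one - C.sharp x)) = S ^ 2 * (T ^ 2 - 4 * S) / 2 := by
    simp only [map_sub, map_smul, LinearMap.sub_apply, LinearMap.smul_apply, smul_eq_mul,
      C.trace_one_one, C.trace_symm x C.one, C.trace_symm _ C.one, C.trace_self_sharp, C.trace_self x,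
      C.trace_sharp_self, hS2, hx, ← hT, ← hS]
    ring
  rw [e] at h
  rcases le_or_gt S 0 with h0 | h0
  · nlinarith [sq_nonneg T]
  · have : 0 < S ^ 2 := by positivity
    nlinarith

/-- The numbers sought are the roots of l³ - Tl² + Sl - N. One root a comes from the intermediate
value theorem; then a·1 - y has norm zero, and `four_mul_le_sq_of_norm_eq_zero` makes the residual
quadratic split over ℝ. The signs of the coefficients exclude roots l ≤ 0. -/
theorem exists_eigenvalues (hC : C.IsEuclidean) {y : J} (hy : C.IsPos y) :
    ∃ a b c : ℝ, 0 < a ∧ 0 < b ∧ 0 < c ∧ C.trace C.one y = a + b + c ∧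
      C.trace C.one (C.sharp y) = a * b + b * c + c * a ∧ C.norm y = a * b * c := by
  obtain ⟨hT, hS, hN⟩ := hy
  set T := C.trace C.one y with hT'
  set S := C.trace C.one (C.sharp y) with hS'
  set N := C.norm y with hN'
  -- At the right endpoint l = T + N/S the polynomial equals l²·N/S + TS, which is positive.
  obtain ⟨a, ha, hroot⟩ : ∃ a ∈ Set.Icc 0 (T + N / S), a ^ 3 - a ^ 2 * T + a * S - N = 0 := by
    have hc : ContinuousOn (fun a : ℝ => a ^ 3 - a ^ 2 * T + a * S - N)
        (Set.Icc 0 (T + N / S)) := by fun_prop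
    have hp : 0 < N / S := by positivity
    have := intermediate_value_Icc (by positivity) hc
    refine this ⟨by simp; linarith, ?_⟩
    have e : (N / S) * S = N := by field_simp
    have : (T + N / S) ^ 3 - (T + N / S) ^ 2 * T + (T + N / S) * S - N =
      (T + N / S) ^ 2 * (N / S) + T * S + ((N / S) * S - N) := by ring
    show (0 : ℝ) ≤ (T + N / S) ^ 3 - (T + N / S) ^ 2 * T + (T + N / S) * S - N
    rw [this, e]
    have : 0 ≤ (T + N / S) ^ 2 * (N / S) := by positivity
    nlinarith
  have ha0 : 0 < a := by
    refine lt_of_le_of_ne ha.1 ?_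
    rintro rfl
    simp at hroot
    linarith
  have hd := C.four_mul_le_sq_of_norm_eq_zero hC (x := a • C.one - y)
    (by rw [norm_one_smul_sub, ← hT', ← hS', ← hN', hroot])
  have e1 : C.trace C.one (a • C.one - y) = 3 * a - T := by
    simp only [map_sub, map_smul, smul_eq_mul, C.trace_one_one, ← hT']; ring
  have e2 : C.trace C.one (C.sharp (a • C.one - y)) = 3 * a ^ 2 - 2 * a * T + S := by
    simp only [sharp_sub, sharp_smul, C.sharp_one, map_sub, map_add, map_smul, smul_eq_mul,
      C.trace_one_one, LinearMap.smul_apply, one_cross', ← hT', ← hS']; ring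
  rw [e1, e2] at hd
  have hD : 0 ≤ (T - a) ^ 2 - 4 * (S - a * (T - a)) := by nlinarith
  set r := Real.sqrt ((T - a) ^ 2 - 4 * (S - a * (T - a))) with hr
  have hr2 : r ^ 2 = (T - a) ^ 2 - 4 * (S - a * (T - a)) := Real.sq_sqrt hD
  have hneg : ∀ l : ℝ, l ≤ 0 → l ^ 3 - l ^ 2 * T + l * S - N < 0 := by
    intro l hl
    have h1 : l ^ 3 ≤ 0 := by
      have := mul_nonneg (sq_nonneg l) (neg_nonneg.2 hl)
      nlinarith
    nlinarith [mul_nonneg (sq_nonneg l) hT.le, mul_nonneg (neg_nonneg.2 hl) hS.le]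
  have hpos : ∀ l : ℝ, l ^ 3 - l ^ 2 * T + l * S - N = 0 → 0 < l := by
    intro l hl
    by_contra h
    exact (hneg l (not_lt.1 h)).ne hl
  have hfac : ∀ l : ℝ, l ^ 3 - l ^ 2 * T + l * S - N =
      (l - a) * ((l - (T - a) / 2) ^ 2 - r ^ 2 / 4) := by
    intro l
    rw [hr2]
    linear_combination hroot
  refine ⟨a, ((T - a) + r) / 2, ((T - a) - r) / 2, ha0, hpos _ ?_, hpos _ ?_, by ring, ?_, ?_⟩
  · rw [hfac]; ring
  · rw [hfac]; ring
  · linear_combination (1 / 4 : ℝ) * hr2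
  · linear_combination (-1 : ℝ) * hroot - (a / 4) * hr2 * (-1)

/-- The eigenvalues of y are written a², b², c². The square root with eigenvalues a, b, c is found
by interpolation in y, 1, y^#: at the eigenvalue a² the element v below takes the value ma² + k -
b²c² = Da, and symmetrically for the others, so w = D⁻¹v. No diagonalisation is needed, since the
identity U_v 1 = D²y is checked directly. -/
theorem exists_uop_one_eq (hC : C.IsEuclidean) {y : J} (hy : C.IsPos y) :
    ∃ w : J, C.norm w ≠ 0 ∧ C.uop w C.one = y := by
  obtain ⟨a', b', c', ha', hb', hc', hT, hS, hN⟩ := C.exists_eigenvalues hC hy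
  obtain ⟨a, ha, rfl⟩ : ∃ a, 0 < a ∧ a' = a ^ 2 :=
    ⟨Real.sqrt a', Real.sqrt_pos.2 ha', (Real.sq_sqrt ha'.le).symm⟩
  obtain ⟨b, hb, rfl⟩ : ∃ a, 0 < a ∧ b' = a ^ 2 :=
    ⟨Real.sqrt b', Real.sqrt_pos.2 hb', (Real.sq_sqrt hb'.le).symm⟩
  obtain ⟨c, hc, rfl⟩ : ∃ a, 0 < a ∧ c' = a ^ 2 :=
    ⟨Real.sqrt c', Real.sqrt_pos.2 hc', (Real.sq_sqrt hc'.le).symm⟩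
  set D := (a + b) * (b + c) * (c + a) with hD
  have hD0 : D ≠ 0 := by positivity
  set k := a ^ 2 * b ^ 2 + b ^ 2 * c ^ 2 + c ^ 2 * a ^ 2 + (a + b + c) * (a * b * c) with hk
  set m := a * b + b * c + c * a with hm
  set v := m • y + k • C.one - C.sharp y with hv
  have hvT : C.trace C.one v = D * (a + b + c) := by
    simp only [hv, map_sub, map_add, map_smul, smul_eq_mul, C.trace_one_one, hT, hS]
    rw [hD, hk, hm]; ring
  have hvs : C.sharp v = (m ^ 2 + m * (a ^ 2 + b ^ 2 + c ^ 2) + k) • C.sharp y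
      + (a ^ 2 * b ^ 2 * c ^ 2 + m * (a ^ 2 * b ^ 2 + b ^ 2 * c ^ 2 + c ^ 2 * a ^ 2) - m * k) • y +
      (k ^ 2 - m * ((a ^ 2 + b ^ 2 + c ^ 2) * (a ^ 2 * b ^ 2 + b ^ 2 * c ^ 2 + c ^ 2 * a ^ 2)
        - a ^ 2 * b ^ 2 * c ^ 2) - k * (a ^ 2 * b ^ 2 + b ^ 2 * c ^ 2 + c ^ 2 * a ^ 2)
        + m * k * (a ^ 2 + b ^ 2 + c ^ 2)) • C.one := by
    simp only [hv, sharp_sub, sharp_add, sharp_smul, map_add, map_smul, LinearMap.add_apply,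
      LinearMap.smul_apply, C.sharp_sharp, C.sharp_one, cross_self_sharp, one_cross',
      C.cross_comm _ C.one, hT, hS, hN]
    module
  have hvS : C.trace C.one (C.sharp v) = D ^ 2 * (a * b + b * c + c * a) := by
    simp only [hvs, map_add, map_smul, smul_eq_mul, C.trace_one_one, hT, hS]
    rw [hD, hk, hm]; ring
  have hu : C.uop v C.one = D ^ 2 • y := by
    rw [uop_one, hvT, hvS, hvs, hv, hk, hm, hD]
    module
  have hw : C.uop (D⁻¹ • v) C.one = y := by
    rw [uop_smul, hu, smul_smul, ← mul_pow, inv_mul_cancel₀ hD0, one_pow, one_smul]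
  -- N(v) is read off from 3N(v) = (v, v^#), with v^# eliminated through U_v 1 = D²y.
  have hvN : C.norm v = D ^ 3 * (a * b * c) := by
    have h1 := C.trace_self_sharp v
    have h2 : C.sharp v = D ^ 2 • y - (D * (a + b + c)) • v + (D ^ 2 * m) • C.one := by
      rw [← hu, uop_one, hvT, hvS]; module
    have h3 : C.trace v y = m * C.trace y y + k * C.trace C.one y - 3 * C.norm y := by
      simp only [hv, map_sub, map_add, map_smul, LinearMap.sub_apply, LinearMap.add_apply,
        LinearMap.smul_apply, smul_eq_mul, C.trace_sharp_self]
    rw [h2, map_add, map_sub, map_smul, map_smul, map_smul, h3, C.trace_symm v C.one, C.trace_self v,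
      hvT, hvS, C.trace_self y, hT, hS, hN, hk, hm] at h1
    simp only [smul_eq_mul] at h1
    rw [hD] at h1 ⊢
    linear_combination (-1 / 3 : ℝ) * h1
  refine ⟨D⁻¹ • v, ?_, hw⟩
  rw [norm_smul', hvN]
  positivity

end SquareRoots

end CubicNormStructure

/-! ### Complex scalars on the complexification. -/

/-- Multiplication by a complex number in the complexification `E × E = E ⊕ i E` of `E`. -/
def complexSMul {E : Type*} [AddCommGroup E] [Module ℝ E] (c : ℂ) (v : E × E) : E × E :=
  (c.re • v.1 - c.im • v.2, c.re • v.2 + c.im • v.1)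

section ComplexSMul

variable {E : Type*} [AddCommGroup E] [Module ℝ E]

theorem complexSMul_one (v : E × E) : complexSMul 1 v = v := by
  simp [complexSMul]

theorem complexSMul_mul (c d : ℂ) (v : E × E) :
    complexSMul (c * d) v = complexSMul c (complexSMul d v) := by
  ext <;> simp only [complexSMul, Complex.mul_re, Complex.mul_im] <;> module

theorem complexSMul_neg (c : ℂ) (v : E × E) : complexSMul c (-v) = complexSMul (-c) v := by
  ext <;> simp only [complexSMul, Complex.neg_re, Complex.neg_im, Prod.fst_neg, Prod.snd_neg] <;>
    module

theorem complexSMul_neg_one (v : E × E) : complexSMul (-1) v = -v := by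
  rw [← complexSMul_neg, complexSMul_one]

theorem map_complexSMul {F : Type*} [AddCommGroup F] [Module ℝ F] (f : E →ₗ[ℝ] F) (c : ℂ)
    (v : E × E) : (f (complexSMul c v).1, f (complexSMul c v).2) =
      complexSMul c (f v.1, f v.2) := by
  simp [complexSMul]

end ComplexSMul

/-- The element of `V_ℂ` with the given complex components. -/
def ChargeSpace.mkC {J : Type*} (a : ℂ) (p q : J × J) (d : ℂ) : ChargeSpace J × ChargeSpace J :=
  ((a.re, p.1, q.1, d.re), (a.im, p.2, q.2, d.im))

namespace CubicNormStructure

/-! ### Translations, the inversion and the maps U_w as elements of the group. -/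

section GroupElements

variable {J : Type*} [AddCommGroup J] [Module ℝ J] (C : CubicNormStructure J)

theorem complexSMul_mkC (c a : ℂ) (p q : J × J) (d : ℂ) :
    complexSMul c (ChargeSpace.mkC a p q d) =
      ChargeSpace.mkC (c * a) (complexSMul c p) (complexSMul c q) (c * d) := by
  simp only [complexSMul, ChargeSpace.mkC, Complex.mul_re, Complex.mul_im, Prod.smul_mk,
    Prod.mk_sub_mk, Prod.mk_add_mk, smul_eq_mul]

theorem period_eq_mkC (z : J × J) :
    C.period z = ChargeSpace.mkC 1 z (-C.sharpC z) (C.normC z) := by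
  simp [period, ChargeSpace.mkC]

theorem complexSMul_period (c : ℂ) (z : J × J) : complexSMul c (C.period z) =
    ChargeSpace.mkC c (complexSMul c z) (complexSMul (-c) (C.sharpC z)) (c * C.normC z) := by
  rw [period_eq_mkC, complexSMul_mkC, mul_one, complexSMul_neg]

theorem moves_iff (g : ChargeSpace J ≃ₗ[ℝ] ChargeSpace J) (z w : J × J) : C.Moves g z w ↔
    ∃ c : ℂ, c ≠ 0 ∧ (g (C.period z).1, g (C.period z).2) = complexSMul c (C.period w) := by
  simp [Moves, complexSMul, Prod.ext_iff]

theorem Moves.trans {g h : ChargeSpace J ≃ₗ[ℝ] ChargeSpace J} {z w u : J × J}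
    (h1 : C.Moves g z w) (h2 : C.Moves h w u) : C.Moves (h * g) z u := by
  rw [moves_iff] at *
  obtain ⟨c, hc, e1⟩ := h1
  obtain ⟨d, hd, e2⟩ := h2
  refine ⟨c * d, mul_ne_zero hc hd, ?_⟩
  rw [complexSMul_mul, ← e2]
  rw [Prod.ext_iff] at e1
  have := map_complexSMul (h : ChargeSpace J →ₗ[ℝ] ChargeSpace J) c (C.period w)
  rw [← e1.1, ← e1.2] at this
  exact this

theorem moves_one (z : J × J) : C.Moves 1 z z :=
  (C.moves_iff _ _ _).2 ⟨1, one_ne_zero, by rw [complexSMul_one]; rfl⟩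

theorem Moves.symm {g : ChargeSpace J ≃ₗ[ℝ] ChargeSpace J} {z w : J × J}
    (h1 : C.Moves g z w) : C.Moves g⁻¹ w z := by
  rw [moves_iff] at *
  obtain ⟨c, hc, e1⟩ := h1
  refine ⟨c⁻¹, inv_ne_zero hc, ?_⟩
  rw [Prod.ext_iff] at e1
  have := map_complexSMul (g⁻¹ : ChargeSpace J ≃ₗ[ℝ] ChargeSpace J).toLinearMap c (C.period w)
  rw [← e1.1, ← e1.2] at this
  have hg : ∀ v, (g⁻¹ : ChargeSpace J ≃ₗ[ℝ] ChargeSpace J) (g v) = v := fun v =>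
    g.symm_apply_apply v
  simp only [LinearEquiv.coe_coe, hg] at this
  rw [show C.period z = ((C.period z).1, (C.period z).2) from rfl, this, ← complexSMul_mul,
    inv_mul_cancel₀ hc, complexSMul_one]

theorem sharpC_complexSMul (c : ℂ) (z : J × J) :
    C.sharpC (complexSMul c z) = complexSMul (c ^ 2) (C.sharpC z) := by
  ext <;> simp only [sharpC, complexSMul, polar_sharp, sharp_sub, sharp_add, sharp_smul, map_add,
    map_sub, map_smul, LinearMap.sub_apply, LinearMap.smul_apply, sq,
    Complex.mul_re, Complex.mul_im, cross_self, C.cross_comm z.2 z.1] <;> module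

theorem normC_complexSMul (c : ℂ) (z : J × J) :
    C.normC (complexSMul c z) = c ^ 3 * C.normC z := by
  have e : c ^ 3 = c * (c * c) := by ring
  have h1 : ∀ s t : ℝ, C.norm (s • z.1 + t • z.2) = s ^ 3 * C.norm z.1
      + s ^ 2 * t * C.trace (C.sharp z.1) z.2 + s * t ^ 2 * C.trace z.1 (C.sharp z.2)
      + t ^ 3 * C.norm z.2 := by
    intro s t
    simp only [norm_add, norm_smul', sharp_smul, map_smul, LinearMap.smul_apply, smul_eq_mul]
    ring
  have h2 : c.re • z.1 - c.im • z.2 = c.re • z.1 + (-c.im) • z.2 := by module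
  have h3 : c.re • z.2 + c.im • z.1 = c.im • z.1 + c.re • z.2 := by module
  have a1 := C.trace_cross_left_self z.1 z.2
  have a2 := C.trace_cross_right_self z.1 z.2
  apply Complex.ext <;> simp only [normC, complexSMul, e, h2, h3, h1, sharp_add,
    sharp_smul, map_add, map_smul, LinearMap.add_apply,
    LinearMap.smul_apply, Complex.mul_re, Complex.mul_im, C.trace_sharp_self, C.trace_self_sharp,
    C.trace_symm z.1 (C.cross _ _), C.trace_symm z.2 (C.cross _ _), C.trace_symm z.2 (C.sharp z.1),
    C.trace_symm (C.sharp z.2) z.1, a1, a2, smul_eq_mul] <;> ring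

theorem sharpC_sharpC (z : J × J) : C.sharpC (C.sharpC z) = complexSMul (C.normC z) z := by
  obtain ⟨x, y⟩ := z
  have h1 := C.cross_sharp_cross x y
  have h2 := C.cross_sharp_cross y x
  rw [C.cross_comm y x] at h2
  ext
  · simp only [sharpC, complexSMul, polar_sharp, normC, sharp_sub, sharp_cross, C.sharp_sharp]
    module
  · simp only [sharpC, complexSMul, polar_sharp, normC, map_sub, LinearMap.sub_apply, h1, h2]
    rw [C.trace_symm (C.sharp y) x]
    module

/-- Computing ((z^#)^#)^# in two ways gives d z^# = 0 with d = N(z)² - N(z^#). Were d nonzero,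
applying # again would give d²N(z)z = 0, hence z = 0 and N(z) = 0. -/
theorem normC_sharpC {z : J × J} (hz : C.normC z ≠ 0) :
    C.normC (C.sharpC z) = C.normC z ^ 2 := by
  have h1 := C.sharpC_sharpC (C.sharpC z)
  rw [C.sharpC_sharpC z, sharpC_complexSMul] at h1
  set d := C.normC z ^ 2 - C.normC (C.sharpC z) with hd
  have h2 : complexSMul d (C.sharpC z) = 0 := by
    rw [Prod.ext_iff] at h1
    ext
    · have := h1.1
      simp only [complexSMul, hd, Complex.sub_re, Complex.sub_im, Prod.fst_zero] at this ⊢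
      linear_combination (norm := module) this
    · have := h1.2
      simp only [complexSMul, hd, Complex.sub_re, Complex.sub_im, Prod.snd_zero] at this ⊢
      linear_combination (norm := module) this
  by_contra hne
  have hd0 : d ≠ 0 := fun h => hne (sub_eq_zero.1 h).symm
  have hs0 : C.sharpC (complexSMul d (C.sharpC z)) = complexSMul (d ^ 2 * C.normC z) z := by
    rw [sharpC_complexSMul, sharpC_sharpC, complexSMul_mul]
  have h00 : C.sharpC (0 : J × J) = 0 := by
    ext <;> simp [sharpC, C.sharp_zero]
  rw [h2, h00] at hs0
  have hz0 : z = 0 := by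
    have h3 : d ^ 2 * C.normC z ≠ 0 := mul_ne_zero (pow_ne_zero _ hd0) hz
    rw [← complexSMul_one z, ← inv_mul_cancel₀ h3, complexSMul_mul, ← hs0]
    simp [complexSMul]
  apply hz
  rw [hz0]
  simp [normC, C.norm_zero', C.sharp_zero]
  rfl

/-- The unipotent element that translates the tube domain by `x`. -/
def translation (x : J) : ChargeSpace J ≃ₗ[ℝ] ChargeSpace J where
  toFun v := (v.1, v.2.1 + v.1 • x, v.2.2.1 - C.cross v.2.1 x - v.1 • C.sharp x,
    v.2.2.2 - C.trace v.2.2.1 x + C.trace v.2.1 (C.sharp x) + v.1 * C.norm x)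
  invFun v := (v.1, v.2.1 - v.1 • x, v.2.2.1 + C.cross v.2.1 x - v.1 • C.sharp x,
    v.2.2.2 + C.trace v.2.2.1 x + C.trace v.2.1 (C.sharp x) - v.1 * C.norm x)
  map_add' v w := by
    ext <;> simp only [Prod.fst_add, Prod.snd_add, map_add, LinearMap.add_apply, add_smul]
    · module
    · module
    · ring
  map_smul' s v := by
    ext <;> simp only [Prod.smul_fst, Prod.smul_snd, map_smul, LinearMap.smul_apply, smul_eq_mul,
      RingHom.id_apply]
    · module
    · module
    · ring
  left_inv v := by
    ext
    · rfl
    · simp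
    · simp only [map_add, map_smul, LinearMap.add_apply, LinearMap.smul_apply, cross_self]
      module
    · simp only [map_add, map_sub, map_smul, LinearMap.add_apply, LinearMap.sub_apply,
        LinearMap.smul_apply, trace_cross_right_self, smul_eq_mul, C.trace_self_sharp,
        C.trace_sharp_self]
      ring
  right_inv v := by
    ext
    · rfl
    · simp
    · simp only [map_sub, map_smul, LinearMap.sub_apply, LinearMap.smul_apply, cross_self]
      module
    · simp only [map_add, map_sub, map_smul, LinearMap.add_apply, LinearMap.sub_apply,
        LinearMap.smul_apply, trace_cross_right_self, smul_eq_mul, C.trace_self_sharp,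
        C.trace_sharp_self]
      ring

theorem translation_apply (x : J) (v : ChargeSpace J) : C.translation x v =
    (v.1, v.2.1 + v.1 • x, v.2.2.1 - C.cross v.2.1 x - v.1 • C.sharp x,
      v.2.2.2 - C.trace v.2.2.1 x + C.trace v.2.1 (C.sharp x) + v.1 * C.norm x) := rfl

theorem symp_translation (x : J) (v w : ChargeSpace J) :
    C.symp (C.translation x v) (C.translation x w) = C.symp v w := by
  have h1 : C.trace (C.cross v.2.1 x) w.2.1 = C.trace v.2.1 (C.cross w.2.1 x) := by
    rw [trace_cross_rotate, C.cross_comm x]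
  have h2 : C.trace (C.cross v.2.1 x) x = 2 * C.trace v.2.1 (C.sharp x) :=
    C.trace_cross_right_self _ _
  have h3 : C.trace x (C.cross w.2.1 x) = 2 * C.trace w.2.1 (C.sharp x) := by
    rw [C.trace_symm, C.trace_cross_right_self]
  simp only [symp, translation_apply, map_add, map_sub, map_smul, LinearMap.add_apply,
    LinearMap.sub_apply, LinearMap.smul_apply, smul_eq_mul, h1, h2, h3, C.trace_self_sharp,
    C.trace_sharp_self, C.trace_symm (C.sharp x), C.trace_symm x w.2.2.1]
  ring

/-- A translation by -p/p⁰ removes p. Both q + p^#/p⁰ and the squared expression are unchanged by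
translations, so the invariance of I₄ becomes visible off the hyperplane p⁰ = 0. -/
theorem quartic_eq_of_ne_zero {v : ChargeSpace J} (hv : v.1 ≠ 0) : C.quartic v =
    4 * v.1 * C.norm (v.2.2.1 + v.1⁻¹ • C.sharp v.2.1) - (v.1 * v.2.2.2 + C.trace v.2.1 v.2.2.1
      + 2 * v.1⁻¹ * C.norm v.2.1) ^ 2 := by
  rw [norm_add_smul, C.sharp_sharp, norm_sharp, quartic, map_smul, smul_eq_mul,
    C.trace_symm v.2.2.1]
  field_simp
  ring

theorem quartic_translation (x : J) (v : ChargeSpace J) :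
    C.quartic (C.translation x v) = C.quartic v := by
  by_cases hv : v.1 = 0
  · have h1 : C.trace v.2.1 (C.cross v.2.1 x) = 2 * C.trace (C.sharp v.2.1) x := by
      rw [C.trace_symm, trace_cross_left_self]
    have h2 : C.trace (C.cross v.2.2.1 (C.cross v.2.1 x)) (C.sharp v.2.1) =
        C.norm v.2.1 * C.trace v.2.2.1 x + C.trace (C.sharp v.2.1) x * C.trace v.2.1 v.2.2.1 := by
      rw [trace_cross_rotate, C.cross_comm _ (C.sharp _), cross_sharp_cross]
      simp only [map_add, map_smul, smul_eq_mul, C.trace_symm v.2.2.1 v.2.1]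
    have h3 : C.trace (C.cross (C.sharp v.2.1) (C.sharp x)) (C.sharp v.2.1) =
        2 * C.norm v.2.1 * C.trace v.2.1 (C.sharp x) := by
      rw [trace_cross_left_self, C.sharp_sharp, map_smul, LinearMap.smul_apply, smul_eq_mul]; ring
    simp only [quartic, translation_apply, hv, zero_smul, add_zero, sub_zero, zero_mul, map_sub,
      LinearMap.sub_apply, sharp_sub, sharp_cross, map_add, map_smul, LinearMap.add_apply,
      LinearMap.smul_apply, smul_eq_mul, h1, h2, h3, C.trace_self_sharp,
      C.trace_symm x (C.sharp v.2.1)]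
    ring
  · rw [quartic_eq_of_ne_zero _ hv, quartic_eq_of_ne_zero _ (by exact hv)]
    have e1 : (C.translation x v).2.2.1 + (C.translation x v).1⁻¹ • C.sharp (C.translation x v).2.1
        = v.2.2.1 + v.1⁻¹ • C.sharp v.2.1 := by
      simp only [translation_apply, sharp_add, sharp_smul, smul_add, map_smul, smul_smul]
      rw [show v.1⁻¹ * v.1 ^ 2 = v.1 by field_simp, inv_mul_cancel₀ hv]
      module
    rw [e1]
    congr 2
    have h1 : C.trace v.2.1 (C.cross v.2.1 x) = 2 * C.trace (C.sharp v.2.1) x := by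
      rw [C.trace_symm, trace_cross_left_self]
    have h2 : C.trace x (C.cross v.2.1 x) = 2 * C.trace v.2.1 (C.sharp x) := by
      rw [C.trace_symm, trace_cross_right_self]
    simp only [translation_apply, norm_add_smul, map_add, map_sub, map_smul, LinearMap.add_apply,
      LinearMap.smul_apply, smul_eq_mul, h1, h2, C.trace_self_sharp, C.trace_symm v.2.2.1 x]
    field_simp
    ring

theorem translation_mem_group (x : J) : C.translation x ∈ C.group :=
  ⟨1, one_ne_zero, fun v w => by rw [symp_translation, one_mul], fun v => by
    rw [quartic_translation]; ring⟩

theorem translation_moves (x : J) (z : J × J) : C.Moves (C.translation x) z (z.1 + x, z.2) := by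
  rw [moves_iff]
  refine ⟨1, one_ne_zero, ?_⟩
  have h1 := C.trace_cross_right_self x z.2
  have h2 := C.trace_cross_rotate z.1 x z.2
  have h3 := C.trace_cross_rotate z.1 z.2 x
  rw [complexSMul_one]
  ext <;> simp only [period, translation_apply, sharpC, normC, polar_sharp, norm_add, sharp_add,
    map_add, LinearMap.add_apply, map_neg, map_sub, LinearMap.neg_apply, LinearMap.sub_apply,
    zero_smul, one_smul, zero_mul, one_mul, add_zero, sub_zero, C.cross_comm z.2 x,
    C.trace_symm (C.sharp z.2) x, C.trace_symm (C.sharp x) z.2]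
  · module
  · ring
  · abel
  · rw [h3, h2, C.cross_comm z.2 x]
    ring

/-- The element of the group acting on the tube domain by `t ↦ -t⁻¹`. -/
def inversion : ChargeSpace J ≃ₗ[ℝ] ChargeSpace J where
  toFun v := (v.2.2.2, v.2.2.1, -v.2.1, -v.1)
  invFun v := (-v.2.2.2, -v.2.2.1, v.2.1, v.1)
  map_add' v w := by ext <;> simp <;> abel
  map_smul' s v := by ext <;> simp
  left_inv v := by simp
  right_inv v := by simp

theorem inversion_apply (v : ChargeSpace J) :
    (inversion : ChargeSpace J ≃ₗ[ℝ] ChargeSpace J) v = (v.2.2.2, v.2.2.1, -v.2.1, -v.1) := rfl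

theorem inversion_mul_inversion :
    (inversion * inversion : ChargeSpace J ≃ₗ[ℝ] ChargeSpace J) = LinearEquiv.neg ℝ := by
  apply LinearEquiv.ext
  intro v
  rw [LinearEquiv.mul_apply, inversion_apply, inversion_apply]
  rfl

theorem symp_inversion (v w : ChargeSpace J) : C.symp (inversion v) (inversion w) = C.symp v w := by
  simp only [symp, inversion_apply, map_neg, LinearMap.neg_apply]
  ring

theorem quartic_inversion (v : ChargeSpace J) : C.quartic (inversion v) = C.quartic v := by
  simp only [quartic, inversion_apply, map_neg, LinearMap.neg_apply, sharp_neg, norm_neg', C.trace_symm v.2.2.1,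
    C.trace_symm (C.sharp v.2.2.1)]
  ring

theorem inversion_mem_group : inversion ∈ C.group :=
  ⟨1, one_ne_zero, fun v w => by rw [symp_inversion, one_mul], fun v => by
    rw [quartic_inversion]; ring⟩

/-- The automorphy factor is N(t), the last component of Ω(t), which the inversion moves to the
front; the next component is -t^# = N(t)·(-t⁻¹). -/
theorem inversion_period {z : J × J} (hz : C.normC z ≠ 0) :
    (inversion (C.period z).1, inversion (C.period z).2) =
      complexSMul (C.normC z) (C.period (complexSMul (-(C.normC z)⁻¹) (C.sharpC z))) := by
  rw [complexSMul_period, sharpC_complexSMul, sharpC_sharpC, normC_complexSMul, normC_sharpC _ hz]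
  simp only [← complexSMul_mul]
  rw [show C.normC z * -(C.normC z)⁻¹ = -1 by field_simp,
    show -C.normC z * ((-(C.normC z)⁻¹) ^ 2 * C.normC z) = -1 by field_simp,
    show C.normC z * ((-(C.normC z)⁻¹) ^ 3 * C.normC z ^ 2) = -1 by field_simp,
    complexSMul_neg_one, complexSMul_neg_one]
  simp [period_eq_mkC, ChargeSpace.mkC, inversion_apply]

theorem inversion_moves {z : J × J} (hz : C.normC z ≠ 0) :
    C.Moves inversion z (complexSMul (-(C.normC z)⁻¹) (C.sharpC z)) :=
  (C.moves_iff _ _ _).2 ⟨_, hz, C.inversion_period hz⟩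

/-- The element of the group acting on the tube domain by `t ↦ U_w t`. -/
noncomputable def levi (w : J) (hw : C.norm w ≠ 0) : ChargeSpace J ≃ₗ[ℝ] ChargeSpace J where
  toFun v := (v.1, C.uop w v.2.1, C.uop (C.sharp w) v.2.2.1, C.norm w ^ 2 * v.2.2.2)
  invFun v := (v.1, (C.norm w ^ 2)⁻¹ • C.uop (C.sharp w) v.2.1,
    (C.norm w ^ 2)⁻¹ • C.uop w v.2.2.1, (C.norm w ^ 2)⁻¹ * v.2.2.2)
  map_add' v v' := by
    ext <;> simp only [Prod.fst_add, Prod.snd_add, map_add, mul_add]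
  map_smul' s v := by
    ext <;> simp only [Prod.smul_fst, Prod.smul_snd, map_smul, smul_eq_mul, RingHom.id_apply]
    ring
  left_inv v := by
    have h2 : C.norm w ^ 2 ≠ 0 := pow_ne_zero _ hw
    simp [uop_sharp_uop _ _ _ hw, uop_uop_sharp, smul_smul, h2]
  right_inv v := by
    have h2 : C.norm w ^ 2 ≠ 0 := pow_ne_zero _ hw
    simp [uop_sharp_uop _ _ _ hw, uop_uop_sharp, smul_smul, h2]

theorem levi_apply (w : J) (hw : C.norm w ≠ 0) (v : ChargeSpace J) : C.levi w hw v =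
    (v.1, C.uop w v.2.1, C.uop (C.sharp w) v.2.2.1, C.norm w ^ 2 * v.2.2.2) := rfl

theorem trace_uop_uop_sharp (w x y : J) :
    C.trace (C.uop w x) (C.uop (C.sharp w) y) = C.norm w ^ 2 * C.trace x y := by
  rw [trace_uop, uop_uop_sharp, map_smul, smul_eq_mul]

theorem symp_levi (w : J) (hw : C.norm w ≠ 0) (v v' : ChargeSpace J) :
    C.symp (C.levi w hw v) (C.levi w hw v') = C.norm w ^ 2 * C.symp v v' := by
  simp only [symp, levi_apply, C.trace_symm (C.uop (C.sharp w) _), trace_uop_uop_sharp]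
  rw [C.trace_symm v'.2.1]
  ring

theorem quartic_levi (w : J) (hw : C.norm w ≠ 0) (v : ChargeSpace J) :
    C.quartic (C.levi w hw v) = (C.norm w ^ 2) ^ 2 * C.quartic v := by
  have hs : C.norm (C.sharp w) ≠ 0 := by rw [norm_sharp]; exact pow_ne_zero _ hw
  simp only [quartic, levi_apply, norm_uop _ _ _ hw, norm_uop _ _ _ hs, sharp_uop _ _ _ hw,
    sharp_uop _ _ _ hs, C.sharp_sharp, uop_smul, map_smul, LinearMap.smul_apply, smul_eq_mul,
    norm_sharp, trace_uop_uop_sharp]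
  ring

theorem levi_mem_group (w : J) (hw : C.norm w ≠ 0) : C.levi w hw ∈ C.group :=
  ⟨C.norm w ^ 2, pow_ne_zero _ hw, C.symp_levi w hw, C.quartic_levi w hw⟩

theorem levi_moves (w : J) (hw : C.norm w ≠ 0) (z : J × J) :
    C.Moves (C.levi w hw) z (C.uop w z.1, C.uop w z.2) := by
  rw [moves_iff]
  refine ⟨1, one_ne_zero, ?_⟩
  rw [complexSMul_one]
  ext <;> simp only [period, levi_apply, sharpC, normC, polar_sharp, norm_uop _ _ _ hw,
    sharp_uop _ _ _ hw, uop_sharp_cross _ _ _ _ hw, map_neg, map_sub,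
    trace_uop_uop_sharp, C.trace_symm (C.uop (C.sharp w) _)]
  · ring
  · rw [C.trace_symm z.2]
    ring

theorem normC_uop {w : J} (hw : C.norm w ≠ 0) (z : J × J) :
    C.normC (C.uop w z.1, C.uop w z.2) = (C.norm w ^ 2 : ℝ) * C.normC z := by
  apply Complex.ext <;> simp only [normC, norm_uop _ _ _ hw, sharp_uop _ _ _ hw,
    trace_uop_uop_sharp, C.trace_symm (C.uop (C.sharp w) _), Complex.re_ofReal_mul,
    Complex.im_ofReal_mul]
  · ring
  · rw [C.trace_symm z.2]; ring

/-- In terms of the eigenvalues λ of x this is ∏|λ + i|² = ∏(1 + λ²). Its positivity gives N ≠ 0 on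
the tube domain, so that t⁻¹ exists there. -/
theorem normSq_normC_one (x : J) : Complex.normSq (C.normC (x, C.one)) =
    1 + C.trace x x + C.trace (C.sharp x) (C.sharp x) + C.norm x ^ 2 := by
  rw [Complex.normSq_apply, trace_self, trace_sharp_sharp_self]
  simp only [normC, C.sharp_one, C.norm_one, C.trace_symm x C.one, C.trace_symm _ C.one]
  ring

/-- This is half of i⟨Ω, Ω̄⟩, so e^{-K} = 8 N(Im t). -/
theorem symp_period (z : J × J) : C.symp (C.period z).1 (C.period z).2 = 4 * C.norm z.2 := by
  have h1 := C.trace_cross_left_self z.1 z.2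
  have h2 := C.trace_cross_right_self z.1 z.2
  simp only [symp, period, sharpC, normC, polar_sharp, map_neg, map_sub, LinearMap.neg_apply,
    LinearMap.sub_apply, C.trace_symm z.1 (C.cross _ _), h1, C.trace_sharp_self]
  ring

theorem symp_complexSMul (c : ℂ) (v : ChargeSpace J × ChargeSpace J) :
    C.symp (complexSMul c v).1 (complexSMul c v).2 = Complex.normSq c * C.symp v.1 v.2 := by
  have h1 := C.trace_symm v.1.2.1
  have h2 := C.trace_symm v.2.2.1
  simp only [symp, complexSMul, Prod.fst_sub, Prod.snd_sub, Prod.fst_add, Prod.snd_add,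
    Prod.smul_fst, Prod.smul_snd, map_add, map_sub, map_smul,
    LinearMap.sub_apply, LinearMap.smul_apply, smul_eq_mul, Complex.normSq_apply, h1, h2]
  ring

/-- Compare ⟨Re Ω, Im Ω⟩ before and after g. The relation controls the sign of N(Im w), and between
points of the domain it forces ν > 0. -/
theorem norm_of_moves {g : ChargeSpace J ≃ₗ[ℝ] ChargeSpace J} {ν : ℝ}
    (hg : ∀ v w, C.symp (g v) (g w) = ν * C.symp v w) {z w : J × J} {c : ℂ}
    (h : (g (C.period z).1, g (C.period z).2) = complexSMul c (C.period w)) :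
    ν * C.norm z.2 = Complex.normSq c * C.norm w.2 := by
  have h1 := hg (C.period z).1 (C.period z).2
  rw [Prod.ext_iff] at h
  simp only at h
  rw [h.1, h.2, symp_complexSMul, symp_period, symp_period] at h1
  linarith

theorem Moves.neg {g : ChargeSpace J ≃ₗ[ℝ] ChargeSpace J} {z w : J × J} (h : C.Moves g z w) :
    C.Moves (LinearEquiv.neg ℝ * g) z w := by
  rw [moves_iff] at *
  obtain ⟨c, hc, e⟩ := h
  refine ⟨-c, neg_ne_zero.2 hc, ?_⟩
  rw [← complexSMul_neg, ← complexSMul_neg_one, ← complexSMul_mul, mul_comm, complexSMul_mul, ← e,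
    complexSMul_neg_one]
  rfl

end GroupElements

end CubicNormStructure

/-! ### Smoothness of bilinear expressions in finite dimension. -/

section BilinearCalculus

variable {E F G : Type*} [NormedAddCommGroup E] [NormedSpace ℝ E] [FiniteDimensional ℝ E]
  [NormedAddCommGroup F] [NormedSpace ℝ F] [FiniteDimensional ℝ F]
  [NormedAddCommGroup G] [NormedSpace ℝ G]

theorem LinearMap.isBoundedBilinearMap_of_finiteDimensional (B : E →ₗ[ℝ] F →ₗ[ℝ] G) :
    IsBoundedBilinearMap ℝ (fun p : E × F => B p.1 p.2) :=
  (LinearMap.toContinuousLinearMap ((LinearMap.toContinuousLinearMap :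
    (F →ₗ[ℝ] G) ≃ₗ[ℝ] F →L[ℝ] G).toLinearMap ∘ₗ B)).isBoundedBilinearMap

theorem ContDiff.bilinear {X : Type*} [NormedAddCommGroup X] [NormedSpace ℝ X]
    (B : E →ₗ[ℝ] F →ₗ[ℝ] G) {f : X → E} {g : X → F} {n : WithTop ℕ∞} (hf : ContDiff ℝ n f)
    (hg : ContDiff ℝ n g) : ContDiff ℝ n (fun x => B (f x) (g x)) :=
  B.isBoundedBilinearMap_of_finiteDimensional.contDiff.comp (hf.prodMk hg)

omit [FiniteDimensional ℝ F] in
theorem ContDiff.linear {X : Type*} [NormedAddCommGroup X] [NormedSpace ℝ X]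
    (B : E →ₗ[ℝ] F) {f : X → E} {n : WithTop ℕ∞} (hf : ContDiff ℝ n f) :
    ContDiff ℝ n (fun x => B (f x)) :=
  (LinearMap.toContinuousLinearMap B).contDiff.comp hf

end BilinearCalculus

namespace CubicNormStructure

/-! ### The positive cone, the tube domain and the elements that preserve it. -/

section Topology

variable {J : Type*} [NormedAddCommGroup J] [NormedSpace ℝ J] [FiniteDimensional ℝ J]
  (C : CubicNormStructure J)

omit [FiniteDimensional ℝ J] in
theorem sharp_eq_half (x : J) : C.sharp x = (1 / 2 : ℝ) • C.cross x x := by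
  rw [cross_self]; module

omit [FiniteDimensional ℝ J] in
theorem norm_eq_third (x : J) : C.norm x = 1 / 3 * C.trace (C.sharp x) x := by
  rw [trace_sharp_self]; ring

theorem contDiff_sharp {n : WithTop ℕ∞} : ContDiff ℝ n C.sharp := by
  simp only [funext C.sharp_eq_half]
  exact (contDiff_id.bilinear C.cross contDiff_id).const_smul (1 / 2 : ℝ)

theorem contDiff_norm {n : WithTop ℕ∞} : ContDiff ℝ n C.norm := by
  rw [funext C.norm_eq_third]
  exact contDiff_const.mul (C.contDiff_sharp.bilinear C.trace contDiff_id)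

theorem hasFDerivAt_sharp (x : J) :
    HasFDerivAt C.sharp (LinearMap.toContinuousLinearMap (C.cross x)) x := by
  have h := (HasFDerivAt.comp (g := fun p : J × J => C.cross p.1 p.2) (f := fun x => (id x, id x)) x
    (C.cross.isBoundedBilinearMap_of_finiteDimensional.hasFDerivAt (x, x))
    ((hasFDerivAt_id x).prodMk (hasFDerivAt_id x))).const_smul (1 / 2 : ℝ)
  have e : (C.sharp : J → J) =
      (1 / 2 : ℝ) • ((fun p : J × J => C.cross p.1 p.2) ∘ fun x => (id x, id x)) := by
    funext y
    simp only [Pi.smul_apply, Function.comp, id]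
    exact C.sharp_eq_half y
  rw [e]
  refine h.congr_fderiv ?_
  ext v
  simp only [smul_apply, ContinuousLinearMap.comp_apply,
    IsBoundedBilinearMap.deriv_apply, ContinuousLinearMap.prod_apply, ContinuousLinearMap.id_apply,
    LinearMap.coe_toContinuousLinearMap']
  rw [C.cross_comm v x]
  module

theorem hasFDerivAt_norm (x : J) :
    HasFDerivAt C.norm (LinearMap.toContinuousLinearMap (C.trace (C.sharp x))) x := by
  have h := (HasFDerivAt.comp (g := fun p : J × J => C.trace p.1 p.2)
    (f := fun x => (C.sharp x, id x)) x
    (C.trace.isBoundedBilinearMap_of_finiteDimensional.hasFDerivAt (C.sharp x, x))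
    ((C.hasFDerivAt_sharp x).prodMk (hasFDerivAt_id x))).const_mul (1 / 3 : ℝ)
  have e : C.norm = fun y => (1 / 3 : ℝ) *
      ((fun p : J × J => C.trace p.1 p.2) ∘ fun x => (C.sharp x, id x)) y := by
    funext y
    exact C.norm_eq_third y
  rw [e]
  refine h.congr_fderiv ?_
  ext v
  simp only [smul_apply, ContinuousLinearMap.comp_apply,
    IsBoundedBilinearMap.deriv_apply, ContinuousLinearMap.prod_apply, ContinuousLinearMap.id_apply,
    LinearMap.coe_toContinuousLinearMap', trace_cross_left_self, smul_eq_mul]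
  ring

theorem isOpen_isPos : IsOpen {y | C.IsPos y} := by
  have h1 : Continuous fun y => C.trace C.one y :=
    ((contDiff_id (𝕜 := ℝ) (n := 0)).linear (C.trace C.one)).continuous
  have h2 : Continuous C.sharp := (C.contDiff_sharp (n := 0)).continuous
  have h3 : Continuous C.norm := (C.contDiff_norm (n := 0)).continuous
  exact (isOpen_lt continuous_const h1).inter
    ((isOpen_lt continuous_const (h1.comp h2)).inter (isOpen_lt continuous_const h3))

omit [FiniteDimensional ℝ J] in
theorem isPos_one : C.IsPos C.one := by
  simp [IsPos, C.sharp_one, C.trace_one_one, C.norm_one]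

omit [FiniteDimensional ℝ J] in
theorem cone_subset_norm_pos {y : J} (hy : y ∈ C.cone) : 0 < C.norm y :=
  connectedComponentIn_subset {y | 0 < C.norm y} C.one hy

/-- The positive set is open and, by `isPos_of_nonneg`, relatively closed in {N > 0}, so the
connected cone cannot leave it. Conversely the segment from 1 to a positive y stays in {N > 0},
because N(s·1 + ty) is a polynomial in s, t with positive coefficients. -/
theorem mem_cone_iff (hC : C.IsEuclidean) {y : J} : y ∈ C.cone ↔ C.IsPos y := by
  constructor
  · have h1 : Continuous fun y => C.trace C.one y :=
      ((contDiff_id (𝕜 := ℝ) (n := 0)).linear (C.trace C.one)).continuous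
    have h2 : Continuous C.sharp := (C.contDiff_sharp (n := 0)).continuous
    have hone : C.one ∈ {y | 0 < C.norm y} := by simp [C.norm_one]
    have hsub : C.cone ⊆ {y | C.IsPos y} := by
      refine isPreconnected_connectedComponentIn.subset_of_closure_inter_subset C.isOpen_isPos
        ⟨C.one, mem_connectedComponentIn hone, C.isPos_one⟩ ?_
      rintro y ⟨hy1, hy2⟩
      have hcl : closure {y | C.IsPos y} ⊆
          {y | 0 ≤ C.trace C.one y} ∩ {y | 0 ≤ C.trace C.one (C.sharp y)} := by
        refine closure_minimal (fun y hy => ⟨hy.1.le, hy.2.1.le⟩) ?_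
        exact (isClosed_le continuous_const h1).inter
          (isClosed_le continuous_const (h1.comp h2))
      exact C.isPos_of_nonneg hC (hcl hy1).1 (hcl hy1).2 (C.cone_subset_norm_pos hy2)
    exact fun h => hsub h
  · intro hy
    have hseg : IsPreconnected (segment ℝ C.one y) := (convex_segment _ _).isPreconnected
    refine hseg.subset_connectedComponentIn (left_mem_segment ℝ _ _) ?_ (right_mem_segment ℝ _ _)
    rintro _ ⟨s, t, hs, ht, hst, rfl⟩
    obtain ⟨hT, hS, hN⟩ := hy
    show 0 < C.norm (s • C.one + t • y)
    rw [norm_add_smul, norm_smul', sharp_smul, C.sharp_one, C.norm_one]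
    simp only [map_smul, LinearMap.smul_apply, smul_eq_mul]
    have h3 : 0 ≤ t * (s ^ 2 * C.trace C.one y) := by positivity
    have h4 : 0 ≤ t ^ 2 * (s * C.trace C.one (C.sharp y)) := by positivity
    rcases hs.eq_or_lt with h | h
    · rw [← h, zero_add] at hst
      rw [hst, ← h]; simpa using hN
    · have : 0 < s ^ 3 := by positivity
      have : 0 ≤ t ^ 3 * C.norm y := by positivity
      linarith

theorem isOpen_cone (hC : C.IsEuclidean) : IsOpen C.cone := by
  have : C.cone = {y | C.IsPos y} := Set.ext fun y => C.mem_cone_iff hC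
  rw [this]
  exact C.isOpen_isPos

omit [FiniteDimensional ℝ J] in
theorem isPreconnected_cone : IsPreconnected C.cone := isPreconnected_connectedComponentIn

omit [FiniteDimensional ℝ J] in
theorem one_mem_cone : C.one ∈ C.cone := mem_connectedComponentIn (by simp [C.norm_one])

theorem smul_mem_cone (hC : C.IsEuclidean) {s : ℝ} (hs : 0 < s) {y : J} (hy : y ∈ C.cone) :
    s • y ∈ C.cone := by
  rw [mem_cone_iff _ hC] at *
  obtain ⟨h1, h2, h3⟩ := hy
  refine ⟨?_, ?_, ?_⟩
  · rw [map_smul, smul_eq_mul]; positivity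
  · rw [sharp_smul, map_smul, smul_eq_mul]; positivity
  · rw [norm_smul']; positivity

theorem exists_uop_one_eq_of_mem_cone (hC : C.IsEuclidean) {y : J} (hy : y ∈ C.cone) :
    ∃ w : J, C.norm w ≠ 0 ∧ C.uop w C.one = y :=
  C.exists_uop_one_eq hC ((C.mem_cone_iff hC).1 hy)

theorem uop_one_mem_cone (hC : C.IsEuclidean) {w : J} (hw : C.norm w ≠ 0) :
    C.uop w C.one ∈ C.cone := (C.mem_cone_iff hC).2 (C.isPos_uop_one hC hw)

/-- A linear map that preserves positivity of the norm and maps some point of the cone into the cone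
maps all of the cone into the cone. -/
theorem mapsTo_cone_of_linear {f : J →ₗ[ℝ] J} (hf : ∀ y, 0 < C.norm y → 0 < C.norm (f y))
    {y₀ : J} (h₀ : y₀ ∈ C.cone) (h₁ : f y₀ ∈ C.cone) {y : J} (hy : y ∈ C.cone) :
    f y ∈ C.cone := by
  have hc : Continuous f := ((contDiff_id (𝕜 := ℝ) (n := 0)).linear f).continuous
  have h := (C.isPreconnected_cone.image f hc.continuousOn).subset_connectedComponentIn
    (Set.mem_image_of_mem f h₀) (F := {y | 0 < C.norm y})
    (by rintro _ ⟨z, hz, rfl⟩; exact hf z (C.cone_subset_norm_pos hz))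
  rw [← connectedComponentIn_eq h₁] at h
  exact h (Set.mem_image_of_mem f hy)

theorem uop_mem_cone (hC : C.IsEuclidean) {w : J} (hw : C.norm w ≠ 0) {y : J} (hy : y ∈ C.cone) :
    C.uop w y ∈ C.cone := by
  refine C.mapsTo_cone_of_linear (fun y hy => ?_) C.one_mem_cone (C.uop_one_mem_cone hC hw) hy
  rw [norm_uop _ _ _ hw]
  positivity

theorem isOpen_domain (hC : C.IsEuclidean) : IsOpen C.domain :=
  (C.isOpen_cone hC).preimage continuous_snd

omit [FiniteDimensional ℝ J] in
theorem isPreconnected_domain : IsPreconnected C.domain := by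
  have h := (isPreconnected_univ (α := J)).prod C.isPreconnected_cone
  have e : C.domain = Set.univ ×ˢ C.cone := by ext z; simp [domain]
  rw [e]; exact h

omit [FiniteDimensional ℝ J] in
theorem domain_norm_pos {z : J × J} (hz : z ∈ C.domain) : 0 < C.norm z.2 :=
  C.cone_subset_norm_pos hz

theorem exists_uop_pair (hC : C.IsEuclidean) {z : J × J} (hz : z ∈ C.domain) :
    ∃ (w : J) (x : J), C.norm w ≠ 0 ∧ z = (C.uop w x, C.uop w C.one) := by
  obtain ⟨w, hw, h⟩ := C.exists_uop_one_eq_of_mem_cone hC hz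
  refine ⟨w, (C.norm w ^ 2)⁻¹ • C.uop (C.sharp w) z.1, hw, ?_⟩
  have h2 : C.norm w ^ 2 ≠ 0 := pow_ne_zero _ hw
  rw [map_smul, uop_uop_sharp, smul_smul, inv_mul_cancel₀ h2, one_smul, h]

theorem normC_ne_zero (hC : C.IsEuclidean) {z : J × J} (hz : z ∈ C.domain) : C.normC z ≠ 0 := by
  obtain ⟨w, x, hw, rfl⟩ := C.exists_uop_pair hC hz
  have e := C.normC_uop hw (x, C.one)
  simp only at e
  rw [e]
  refine mul_ne_zero (by exact_mod_cast pow_ne_zero _ hw) ?_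
  intro h
  have := C.normSq_normC_one x
  rw [h, map_zero] at this
  have h1 := C.trace_self_nonneg hC x
  have h2 := C.trace_self_nonneg hC (C.sharp x)
  nlinarith [sq_nonneg (C.norm x)]

/-- The image of `t` under `t ↦ -t⁻¹`. -/
noncomputable def negInv (z : J × J) : J × J := complexSMul (-(C.normC z)⁻¹) (C.sharpC z)

theorem contDiff_normC {n : WithTop ℕ∞} : ContDiff ℝ n C.normC := by
  have h1 : ContDiff ℝ n fun z : J × J => C.norm z.1 - C.trace z.1 (C.sharp z.2) :=
    (C.contDiff_norm.comp contDiff_fst).sub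
      (contDiff_fst.bilinear C.trace (C.contDiff_sharp.comp contDiff_snd))
  have h2 : ContDiff ℝ n fun z : J × J => C.trace (C.sharp z.1) z.2 - C.norm z.2 :=
    ((C.contDiff_sharp.comp contDiff_fst).bilinear C.trace contDiff_snd).sub
      (C.contDiff_norm.comp contDiff_snd)
  exact Complex.equivRealProdCLM.symm.contDiff.comp (h1.prodMk h2)

theorem contDiff_sharpC {n : WithTop ℕ∞} : ContDiff ℝ n C.sharpC :=
  ((C.contDiff_sharp.comp contDiff_fst).sub (C.contDiff_sharp.comp contDiff_snd)).prodMk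
    (contDiff_fst.bilinear C.cross contDiff_snd)

theorem contDiff_period {n : WithTop ℕ∞} : ContDiff ℝ n C.period := by
  have h1 := C.contDiff_sharpC (n := n)
  have h2 := C.contDiff_normC (n := n)
  exact (contDiff_const.prodMk (contDiff_fst.prodMk ((contDiff_fst.comp h1).neg.prodMk
    (Complex.reCLM.contDiff.comp h2)))).prodMk (contDiff_const.prodMk (contDiff_snd.prodMk
    ((contDiff_snd.comp h1).neg.prodMk (Complex.imCLM.contDiff.comp h2))))

omit [FiniteDimensional ℝ J] in
theorem contDiffOn_complexSMul {X : Type*} [NormedAddCommGroup X] [NormedSpace ℝ X] {s : Set X}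
    {n : WithTop ℕ∞} {c : X → ℂ} {f : X → J × J} (hc : ContDiffOn ℝ n c s)
    (hf : ContDiffOn ℝ n f s) : ContDiffOn ℝ n (fun x => complexSMul (c x) (f x)) s := by
  have hr : ContDiffOn ℝ n (fun x => (c x).re) s := Complex.reCLM.contDiff.comp_contDiffOn hc
  have hi : ContDiffOn ℝ n (fun x => (c x).im) s := Complex.imCLM.contDiff.comp_contDiffOn hc
  have h1 : ContDiffOn ℝ n (fun x => (f x).1) s := contDiff_fst.comp_contDiffOn hf
  have h2 : ContDiffOn ℝ n (fun x => (f x).2) s := contDiff_snd.comp_contDiffOn hf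
  exact ((hr.smul h1).sub (hi.smul h2)).prodMk ((hr.smul h2).add (hi.smul h1))

/-- The imaginary part of -t⁻¹ has positive norm by `norm_of_moves`; connectedness of the domain and
the fixed point i·1 select the right component of {N > 0}. -/
theorem negInv_mem_domain (hC : C.IsEuclidean) {z : J × J} (hz : z ∈ C.domain) :
    C.negInv z ∈ C.domain := by
  have hpos : ∀ z ∈ C.domain, 0 < C.norm (C.negInv z).2 := by
    intro z hz
    have h0 := C.normC_ne_zero hC hz
    have h := C.norm_of_moves (ν := 1) (fun v w => by rw [symp_inversion, one_mul])
      (C.inversion_period h0)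
    have h1 := C.domain_norm_pos hz
    have h2 : 0 < Complex.normSq (C.normC z) := Complex.normSq_pos.2 h0
    rw [one_mul] at h
    have h3 : 0 < Complex.normSq (C.normC z) * C.norm (C.negInv z).2 := h ▸ h1
    exact (pos_iff_pos_of_mul_pos h3).1 h2
  have hcont : ContinuousOn (fun z => (C.negInv z).2) C.domain := by
    have h : ContDiffOn ℝ 0 C.negInv C.domain := by
      refine contDiffOn_complexSMul ?_ C.contDiff_sharpC.contDiffOn
      exact (ContDiffOn.inv C.contDiff_normC.contDiffOn fun z hz => C.normC_ne_zero hC hz).neg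
    exact continuous_snd.comp_continuousOn h.continuousOn
  have hi : ((0, C.one) : J × J) ∈ C.domain := C.one_mem_cone
  have hone : (C.negInv (0, C.one)).2 = C.one := by
    have e : C.normC (0, C.one) = -Complex.I := by
      apply Complex.ext <;> simp [normC, C.norm_zero', C.sharp_zero, C.norm_one]
    simp [negInv, e, complexSMul, sharpC, C.sharp_zero, C.sharp_one]
  have h := (C.isPreconnected_domain.image _ hcont).subset_connectedComponentIn
    (x := C.one) (F := {y | 0 < C.norm y}) ⟨_, hi, hone⟩
    (by rintro _ ⟨z, hz, rfl⟩; exact hpos z hz)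
  exact h (Set.mem_image_of_mem _ hz)

/-- The elements of the group that map the tube domain onto itself. -/
def domainGroup : Subgroup (ChargeSpace J ≃ₗ[ℝ] ChargeSpace J) where
  carrier := {g | g ∈ C.group ∧ C.PreservesDomain g}
  one_mem' := ⟨C.group.one_mem, fun z hz => ⟨z, hz, C.moves_one z⟩, fun z hz => ⟨z, hz, C.moves_one z⟩⟩
  mul_mem' := by
    rintro a b ⟨ha, ha1, ha2⟩ ⟨hb, hb1, hb2⟩
    refine ⟨C.group.mul_mem ha hb, fun z hz => ?_, fun w hw => ?_⟩
    · obtain ⟨u, hu, h1⟩ := hb1 z hz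
      obtain ⟨w, hw, h2⟩ := ha1 u hu
      exact ⟨w, hw, h1.trans C h2⟩
    · obtain ⟨u, hu, h1⟩ := ha2 w hw
      obtain ⟨z, hz, h2⟩ := hb2 u hu
      exact ⟨z, hz, h2.trans C h1⟩
  inv_mem' := by
    rintro a ⟨ha, ha1, ha2⟩
    refine ⟨C.group.inv_mem ha, fun z hz => ?_, fun w hw => ?_⟩
    · obtain ⟨u, hu, h1⟩ := ha2 z hz
      exact ⟨u, hu, h1.symm C⟩
    · obtain ⟨u, hu, h1⟩ := ha1 w hw
      exact ⟨u, hu, h1.symm C⟩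

omit [FiniteDimensional ℝ J] in
theorem translation_mem (x : J) : C.translation x ∈ C.domainGroup := by
  refine ⟨C.translation_mem_group x, fun z hz => ⟨_, ?_, C.translation_moves x z⟩,
    fun w hw => ⟨(w.1 - x, w.2), hw, ?_⟩⟩
  · exact hz
  · simpa using C.translation_moves x (w.1 - x, w.2)

theorem inversion_mem (hC : C.IsEuclidean) : inversion ∈ C.domainGroup := by
  refine ⟨C.inversion_mem_group, fun z hz => ⟨_, C.negInv_mem_domain hC hz,
    C.inversion_moves (C.normC_ne_zero hC hz)⟩, fun w hw => ⟨_, C.negInv_mem_domain hC hw, ?_⟩⟩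
  -- The inversion squares to -1, which acts trivially on the projective space, so a move by its
  -- inverse is also a move by the inversion.
  have h := ((C.inversion_moves (C.normC_ne_zero hC hw)).symm C).neg
  rw [← inversion_mul_inversion, mul_assoc, mul_inv_cancel, mul_one] at h
  exact h

theorem levi_mem (hC : C.IsEuclidean) {w : J} (hw : C.norm w ≠ 0) :
    C.levi w hw ∈ C.domainGroup := by
  refine ⟨C.levi_mem_group w hw, fun z hz => ⟨_, C.uop_mem_cone hC hw hz, C.levi_moves w hw z⟩,
    fun z hz => ⟨((C.norm w ^ 2)⁻¹ • C.uop (C.sharp w) z.1,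
      (C.norm w ^ 2)⁻¹ • C.uop (C.sharp w) z.2), ?_, ?_⟩⟩
  · have hs : C.norm (C.sharp w) ≠ 0 := by rw [norm_sharp]; exact pow_ne_zero _ hw
    exact C.smul_mem_cone hC (by positivity) (C.uop_mem_cone hC hs hz)
  · have h2 : C.norm w ^ 2 ≠ 0 := pow_ne_zero _ hw
    have h := C.levi_moves w hw ((C.norm w ^ 2)⁻¹ • C.uop (C.sharp w) z.1,
      (C.norm w ^ 2)⁻¹ • C.uop (C.sharp w) z.2)
    simpa only [map_smul, uop_uop_sharp, smul_smul, inv_mul_cancel₀ h2, one_smul] using h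

end Topology

end CubicNormStructure

namespace CubicNormStructure

/-! ### A covariant formula for the potential. -/

section Invariants

variable {J : Type*} [AddCommGroup J] [Module ℝ J] (C : CubicNormStructure J)

/-- The coefficient of `s²` in `I₄(v + s w)`. -/
noncomputable def quarticSnd (v w : ChargeSpace J) : ℝ :=
  (C.quartic (v + w) + C.quartic (v - w)) / 2 - C.quartic v - C.quartic w

theorem quarticSnd_eq (v w : ChargeSpace J) : C.quarticSnd v w =
    4 * v.1 * C.trace v.2.2.1 (C.sharp w.2.2.1) + 4 * w.1 * C.trace (C.sharp v.2.2.1) w.2.2.1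
      - 4 * v.2.2.2 * C.trace v.2.1 (C.sharp w.2.1)
      - 4 * w.2.2.2 * C.trace (C.sharp v.2.1) w.2.1
      + 4 * (C.trace (C.sharp w.2.2.1) (C.sharp v.2.1)
        + C.trace (C.cross v.2.2.1 w.2.2.1) (C.cross v.2.1 w.2.1)
        + C.trace (C.sharp v.2.2.1) (C.sharp w.2.1))
      - (v.1 * w.2.2.2 + w.1 * v.2.2.2 + C.trace v.2.1 w.2.2.1 + C.trace w.2.1 v.2.2.1) ^ 2
      - 2 * (v.1 * v.2.2.2 + C.trace v.2.1 v.2.2.1) * (w.1 * w.2.2.2 + C.trace w.2.1 w.2.2.1) := by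
  have hn : ∀ x y, C.norm (x - y) = C.norm x - C.trace (C.sharp x) y + C.trace x (C.sharp y)
      - C.norm y := by
    intro x y
    rw [sub_eq_add_neg, C.norm_add, norm_neg', sharp_neg, map_neg]; ring
  simp only [quarticSnd, quartic, Prod.fst_add, Prod.snd_add, Prod.fst_sub, Prod.snd_sub,
    C.norm_add, hn, sharp_add, sharp_sub, map_add, map_sub, LinearMap.add_apply,
    LinearMap.sub_apply]
  ring

/-- The s²-coefficient is a quadratic form in w, and the sum of its values at the real and imaginary
parts is its hermitian extension, which scales by |c|². -/
theorem quarticSnd_complexSMul (v : ChargeSpace J) (c : ℂ) (w : ChargeSpace J × ChargeSpace J) :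
    C.quarticSnd v (complexSMul c w).1 + C.quarticSnd v (complexSMul c w).2 =
      Complex.normSq c * (C.quarticSnd v w.1 + C.quarticSnd v w.2) := by
  have h1 := C.trace_symm w.1.2.1
  have h2 := C.trace_symm w.2.2.1
  simp only [quarticSnd_eq, complexSMul, Prod.fst_sub, Prod.snd_sub, Prod.fst_add, Prod.snd_add,
    Prod.smul_fst, Prod.smul_snd, sharp_add, sharp_sub, sharp_smul, map_add, map_sub, map_smul,
    LinearMap.add_apply, LinearMap.sub_apply, LinearMap.smul_apply, smul_eq_mul,
    Complex.normSq_apply, C.cross_comm w.2.2.2.1 w.1.2.2.1, C.cross_comm w.2.2.1 w.1.2.1]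
  ring

/-- The function `e^{-K} V_eff`, in a form that is visibly equivariant. -/
noncomputable def chargeForm (γ : ChargeSpace J) (z : J × J) : ℝ :=
  3 * (C.symp γ (C.period z).1 ^ 2 + C.symp γ (C.period z).2 ^ 2)
    - (C.quarticSnd γ (C.period z).1 + C.quarticSnd γ (C.period z).2)

/-- An invariant formula for the effective potential. -/
noncomputable def potential (γ : ChargeSpace J) (z : J × J) : ℝ :=
  C.chargeForm γ z / (8 * C.norm z.2)

theorem symp_complexSMul_sq (γ : ChargeSpace J) (c : ℂ) (w : ChargeSpace J × ChargeSpace J) :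
    C.symp γ (complexSMul c w).1 ^ 2 + C.symp γ (complexSMul c w).2 ^ 2 =
      Complex.normSq c * (C.symp γ w.1 ^ 2 + C.symp γ w.2 ^ 2) := by
  simp only [symp, complexSMul, Prod.fst_sub, Prod.snd_sub, Prod.fst_add, Prod.snd_add,
    Prod.smul_fst, Prod.smul_snd, map_add, map_sub, map_smul, smul_eq_mul, Complex.normSq_apply]
  ring

theorem quarticSnd_map {g : ChargeSpace J ≃ₗ[ℝ] ChargeSpace J} {ν : ℝ}
    (hg : ∀ v, C.quartic (g v) = ν ^ 2 * C.quartic v) (v w : ChargeSpace J) :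
    C.quarticSnd (g v) (g w) = ν ^ 2 * C.quarticSnd v w := by
  simp only [quarticSnd, ← map_add, ← map_sub, hg]
  ring

theorem chargeForm_equivariant {g : ChargeSpace J ≃ₗ[ℝ] ChargeSpace J} {ν : ℝ}
    (hs : ∀ v w, C.symp (g v) (g w) = ν * C.symp v w)
    (hg : ∀ v, C.quartic (g v) = ν ^ 2 * C.quartic v) {z w : J × J} {c : ℂ}
    (h : (g (C.period z).1, g (C.period z).2) = complexSMul c (C.period w)) (γ : ChargeSpace J) :
    Complex.normSq c * C.chargeForm (g γ) w = ν ^ 2 * C.chargeForm γ z := by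
  have h1 := C.symp_complexSMul_sq (g γ) c (C.period w)
  have h2 := C.quarticSnd_complexSMul (g γ) c (C.period w)
  rw [← h] at h1 h2
  simp only [hs, C.quarticSnd_map hg] at h1 h2
  rw [chargeForm, chargeForm]
  linear_combination (-3) * h1 + h2

theorem chargeForm_zero_left (γ : ChargeSpace J) (y : J) : C.chargeForm γ (0, y) =
    4 * (γ.2.2.2 ^ 2 + γ.1 ^ 2 * C.norm y ^ 2 + C.trace (C.sharp y) γ.2.1 ^ 2
      + C.trace y γ.2.2.1 ^ 2 - 2 * C.norm y * C.trace y (C.sharp γ.2.1)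
      - 2 * C.trace (C.sharp y) (C.sharp γ.2.2.1)) := by
  obtain ⟨p₀, p, q, q₀⟩ := γ
  simp only [chargeForm, quarticSnd_eq, symp, period, sharpC, normC, polar_sharp, C.norm_zero',
    C.sharp_zero, C.sharp_sharp, map_zero, LinearMap.zero_apply, zero_sub, sub_zero,
    neg_zero, neg_neg, map_smul, LinearMap.smul_apply, smul_eq_mul,
    C.trace_symm p (C.sharp y), C.trace_symm q y, C.trace_symm (C.sharp p) y,
    C.trace_symm (C.sharp q) (C.sharp y)]
  ring

/-- Translations have multiplier and automorphy factor 1, so all values reduce to points iy, where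
`chargeForm_zero_left` applies. -/
theorem chargeForm_translation (γ : ChargeSpace J) (x y : J) :
    C.chargeForm γ (x, y) = C.chargeForm (C.translation (-x) γ) (0, y) := by
  have h1 := C.translation_moves (-x) (x, y)
  obtain ⟨c, hc, h⟩ := (C.moves_iff _ _ _).1 h1
  have hc1 : c = 1 := by
    have e : C.translation (-x) (C.period (x, y)).1 = (complexSMul c (C.period (x + -x, y))).1 := by
      rw [← h]
    have e' : C.translation (-x) (C.period (x, y)).2 = (complexSMul c (C.period (x + -x, y))).2 := by
      rw [← h]
    have h2 := congrArg Prod.fst e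
    have h3 := congrArg Prod.fst e'
    simp only [translation_apply, period, complexSMul, Prod.fst_sub, Prod.fst_add, Prod.smul_fst,
      smul_eq_mul, mul_one, mul_zero, sub_zero, zero_add] at h2 h3
    exact Complex.ext h2.symm h3.symm
  have := C.chargeForm_equivariant (ν := 1) (fun v w => by rw [symp_translation, one_mul])
    (fun v => by rw [quartic_translation]; ring) h γ
  rw [hc1] at this
  simp only [map_one, one_mul, one_pow, add_neg_cancel] at this
  exact this.symm

theorem chargeForm_axis (p₀ q₀ : ℝ) (x y : J) : C.chargeForm (p₀, 0, 0, q₀) (x, y) =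
    4 * ((q₀ - p₀ * C.norm x) ^ 2 + p₀ ^ 2 * (C.norm y ^ 2 + C.trace (C.sharp y) x ^ 2
      + C.trace y (C.sharp x) ^ 2 - 2 * C.norm y * C.trace y (C.sharp x)
      - 2 * C.norm x * C.trace (C.sharp y) x)) := by
  rw [chargeForm_translation, chargeForm_zero_left]
  simp only [translation_apply, map_zero, LinearMap.zero_apply, zero_add, sub_zero, smul_neg,
    norm_neg', sharp_neg, zero_sub, map_neg, sharp_smul, map_smul, smul_eq_mul, C.sharp_sharp,
    neg_zero]
  ring

/-- From z to w the numerator scales by ν²/|c|² and the norm of the imaginary part by ν/|c|², so one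
factor ν survives. -/
theorem potential_equivariant {g : ChargeSpace J ≃ₗ[ℝ] ChargeSpace J} {ν : ℝ} (hν : ν ≠ 0)
    (hs : ∀ v w, C.symp (g v) (g w) = ν * C.symp v w)
    (hg : ∀ v, C.quartic (g v) = ν ^ 2 * C.quartic v) {z w : J × J} (hm : C.Moves g z w)
    (hz : C.norm z.2 ≠ 0) (γ : ChargeSpace J) :
    C.potential (g γ) w = ν * C.potential γ z := by
  obtain ⟨c, hc, h⟩ := (C.moves_iff _ _ _).1 hm
  have h1 := C.norm_of_moves hs h
  have h2 := C.chargeForm_equivariant hs hg h γ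
  have hc2 : Complex.normSq c ≠ 0 := by rwa [Ne, Complex.normSq_eq_zero]
  have hw : C.norm w.2 ≠ 0 := by
    intro h0
    rw [h0, mul_zero] at h1
    exact mul_ne_zero hν hz h1
  rw [potential, potential]
  field_simp
  apply mul_left_cancel₀ hc2
  linear_combination C.norm z.2 * h2 + ν * C.chargeForm γ z * h1

theorem multiplier_pos {g : ChargeSpace J ≃ₗ[ℝ] ChargeSpace J} {ν : ℝ}
    (hs : ∀ v w, C.symp (g v) (g w) = ν * C.symp v w) {z w : J × J} (hm : C.Moves g z w)
    (hz : 0 < C.norm z.2) (hw : 0 < C.norm w.2) : 0 < ν := by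
  obtain ⟨c, hc, h⟩ := (C.moves_iff _ _ _).1 hm
  have h1 := C.norm_of_moves hs h
  have h2 : 0 < Complex.normSq c * C.norm w.2 := mul_pos (Complex.normSq_pos.2 hc) hw
  rw [← h1] at h2
  exact (pos_iff_pos_of_mul_pos h2).2 hz

theorem potential_neg (γ : ChargeSpace J) (z : J × J) : C.potential (-γ) z = C.potential γ z := by
  rw [potential, potential]
  congr 1
  simp only [chargeForm, symp, quarticSnd_eq, Prod.fst_neg, Prod.snd_neg, sharp_neg, map_neg,
    LinearMap.neg_apply]
  ring

theorem quartic_axis (p₀ q₀ : ℝ) : C.quartic (p₀, 0, 0, q₀) = -(p₀ * q₀) ^ 2 := by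
  simp [quartic, C.norm_zero', C.sharp_zero]

end Invariants

/-! ### Normal form of charges with negative quartic invariant. -/

section NormalForm

variable {J : Type*} [NormedAddCommGroup J] [NormedSpace ℝ J] [FiniteDimensional ℝ J]
  (C : CubicNormStructure J)

/-- If p⁰ = 0, translation by x followed by inversion produces the first component q₀ - (q, x) + (p,
x^#). If this vanished for all x, its homogeneous parts would give q₀ = 0, q = 0 and (p, x^#) = 0;
polarising the last at 1, where 1 × x = (1, x)1 - x, would give p = 0. -/
theorem exists_fst_ne_zero (hC : C.IsEuclidean) {γ : ChargeSpace J} (hγ : γ ≠ 0) :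
    ∃ g ∈ C.domainGroup, (g γ).1 ≠ 0 := by
  by_cases h0 : γ.1 = 0
  swap
  · exact ⟨1, C.domainGroup.one_mem, h0⟩
  by_contra! hcon
  have key : ∀ x : J, γ.2.2.2 - C.trace γ.2.2.1 x + C.trace γ.2.1 (C.sharp x) = 0 := by
    intro x
    have := hcon _ (C.domainGroup.mul_mem (C.inversion_mem hC) (C.translation_mem x))
    rw [LinearEquiv.mul_apply, inversion_apply, translation_apply] at this
    simpa [h0] using this
  have e0 : γ.2.2.2 = 0 := by simpa [C.sharp_zero] using key 0
  have e1 : ∀ x : J, C.trace γ.2.2.1 x = 0 := by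
    intro x
    have h1 := key x
    have h2 := key (-x)
    rw [sharp_neg, map_neg] at h2
    linarith
  have e2 : ∀ x : J, C.trace γ.2.1 (C.sharp x) = 0 := by
    intro x
    have h1 := key x
    rw [e1, e0] at h1
    linarith
  have e3 : ∀ x : J, C.trace γ.2.1 (C.cross C.one x) = 0 := by
    intro x
    have h := e2 (C.one + x)
    rw [sharp_add, map_add, map_add, e2, e2] at h
    linarith
  have e4 : C.trace γ.2.1 C.one = 0 := by simpa [C.sharp_one] using e2 C.one
  have e5 : ∀ x : J, C.trace γ.2.1 x = 0 := by
    intro x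
    have h := e3 x
    rw [one_cross', map_sub, map_smul, e4, smul_zero] at h
    linarith
  apply hγ
  exact Prod.ext h0 (Prod.ext (C.eq_zero_of_trace_self hC (e5 _))
    (Prod.ext (C.eq_zero_of_trace_self hC (e1 _)) e0))

omit [FiniteDimensional ℝ J] in
theorem translation_eq_of_fst_ne_zero {γ : ChargeSpace J} (h : γ.1 ≠ 0) :
    (C.translation (-(γ.1⁻¹ • γ.2.1)) γ).1 = γ.1 ∧
    (C.translation (-(γ.1⁻¹ • γ.2.1)) γ).2.1 = 0 ∧
    (C.translation (-(γ.1⁻¹ • γ.2.1)) γ).2.2.1 = γ.2.2.1 + γ.1⁻¹ • C.sharp γ.2.1 := by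
  refine ⟨rfl, ?_, ?_⟩
  · simp [translation_apply, smul_smul, h]
  · simp only [translation_apply, map_neg, map_smul, cross_self, sharp_neg, sharp_smul, smul_smul]
    rw [show γ.1 * γ.1⁻¹ ^ 2 = γ.1⁻¹ by field_simp]
    module

omit [FiniteDimensional ℝ J] in
theorem quartic_neg_of_mem {g : ChargeSpace J ≃ₗ[ℝ] ChargeSpace J} (hg : g ∈ C.group)
    {γ : ChargeSpace J} (h : C.quartic γ < 0) : C.quartic (g γ) < 0 := by
  obtain ⟨ν, hν, -, h2⟩ := hg
  rw [h2]
  exact mul_neg_of_pos_of_neg (by positivity) h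

/-- Every charge vector with negative quartic invariant can be moved into the plane spanned by
`(1, 0, 0, 0)` and `(0, 0, 0, 1)`. -/
theorem exists_normal_form (hC : C.IsEuclidean) {γ : ChargeSpace J} (hγ : C.quartic γ < 0) :
    ∃ g ∈ C.domainGroup, ∃ p₀ q₀ : ℝ, g γ = (p₀, 0, 0, q₀) := by
  have step1 : ∃ g ∈ C.domainGroup, (g γ).1 ≠ 0 ∧ (g γ).2.1 = 0 := by
    obtain ⟨g, hg, h1⟩ := C.exists_fst_ne_zero hC (γ := γ) (by
      rintro rfl
      simp [quartic, C.norm_zero', C.sharp_zero] at hγ)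
    have h := C.translation_eq_of_fst_ne_zero h1
    refine ⟨_, C.domainGroup.mul_mem (C.translation_mem (-((g γ).1⁻¹ • (g γ).2.1))) hg, ?_, ?_⟩
    · rw [LinearEquiv.mul_apply, h.1]; exact h1
    · rw [LinearEquiv.mul_apply, h.2.1]
  -- To (p⁰, 0, q, q₀) one applies, up to sign, the conjugate by the inversion of translation by βq.
  -- Here -I₄ = (p⁰q₀)² - 4p⁰n is the discriminant of nβ² + p⁰q₀β + p⁰. At a root β the new p⁰ is
  -- -p⁰(q₀β + 2)² and the new q + p^#/p⁰ vanishes, so a last translation removes p and q together.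
  have step2 : ∃ g ∈ C.domainGroup, (g γ).1 ≠ 0 ∧
      (g γ).2.2.1 + (g γ).1⁻¹ • C.sharp (g γ).2.1 = 0 := by
    obtain ⟨g, hg, h1, h2⟩ := step1
    have hq := C.quartic_neg_of_mem hg.1 hγ
    generalize hv : g γ = v at h1 h2 hq
    obtain ⟨p₀, p, q, q₀⟩ := v
    simp only at h1 h2
    subst h2
    set n := C.norm q with hn
    have hD : 0 < (p₀ * q₀) ^ 2 - 4 * p₀ * n := by
      simp only [quartic, C.norm_zero', C.sharp_zero, map_zero, LinearMap.zero_apply] at hq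
      linarith
    obtain ⟨β, hβ⟩ : ∃ β : ℝ, n * β ^ 2 + p₀ * q₀ * β + p₀ = 0 := by
      by_cases hn0 : n = 0
      · have hq0 : q₀ ≠ 0 := by
          rintro rfl
          simp [hn0] at hD
        exact ⟨-q₀⁻¹, by rw [hn0]; field_simp; ring⟩
      · have hs := Real.sq_sqrt hD.le
        set r := Real.sqrt ((p₀ * q₀) ^ 2 - 4 * p₀ * n)
        refine ⟨(-(p₀ * q₀) + r) / (2 * n), ?_⟩
        field_simp
        linear_combination hs
    have hm := C.domainGroup.mul_mem (C.domainGroup.mul_mem (C.inversion_mem hC)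
      (C.translation_mem (β • q))) (C.domainGroup.mul_mem (C.inversion_mem hC) hg)
    have hval : (inversion * C.translation (β • q) * (inversion * g) :
        ChargeSpace J ≃ₗ[ℝ] ChargeSpace J) γ =
        (-p₀ * (q₀ * β + 2) ^ 2, -((β * (2 + q₀ * β)) • C.sharp q), -((1 + q₀ * β) • q), -q₀) := by
      simp only [LinearEquiv.mul_apply, hv, inversion_apply, translation_apply, norm_smul',
        sharp_smul, map_smul, cross_self,
        C.trace_self_sharp, map_zero, LinearMap.zero_apply, neg_zero, smul_eq_mul, ← hn]
      refine Prod.ext ?_ (Prod.ext ?_ (Prod.ext ?_ rfl))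
      · simp only
        linear_combination (3 + q₀ * β) * hβ
      · simp only
        module
      · simp only
        module
    -- For a root β, the equation q₀β = -2 would make the discriminant vanish.
    have hne : q₀ * β + 2 ≠ 0 := by
      intro h
      have e : (p₀ * q₀) ^ 2 - 4 * p₀ * n = 0 := by
        linear_combination (-p₀ * q₀ ^ 2) * hβ + (p₀ * n * (q₀ * β - 2) + p₀ ^ 2 * q₀ ^ 2) * h
      exact hD.ne' e
    refine ⟨_, hm, ?_, ?_⟩
    · rw [hval]
      exact mul_ne_zero (neg_ne_zero.2 h1) (pow_ne_zero _ hne)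
    · rw [hval]
      simp only [sharp_neg, sharp_smul, C.sharp_sharp, ← hn, smul_smul]
      rw [← neg_smul, ← add_smul]
      convert zero_smul ℝ q
      field_simp
      linear_combination (-(q₀ * β + 2) ^ 2) * hβ
  obtain ⟨g, hg, h1, h2⟩ := step2
  have h := C.translation_eq_of_fst_ne_zero h1
  refine ⟨_, C.domainGroup.mul_mem (C.translation_mem (-((g γ).1⁻¹ • (g γ).2.1))) hg,
    (g γ).1, (C.translation (-((g γ).1⁻¹ • (g γ).2.1)) (g γ)).2.2.2, ?_⟩
  rw [LinearEquiv.mul_apply]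
  exact Prod.ext h.1 (Prod.ext h.2.1 (Prod.ext (h.2.2.trans h2) rfl))

end NormalForm

end CubicNormStructure

/-! ### Derivatives of the period, the Kähler potential and the central charge. -/

theorem fderiv_apply_of_cubic_expansion {E F : Type*} [NormedAddCommGroup E] [NormedSpace ℝ E]
    [NormedAddCommGroup F] [NormedSpace ℝ F] {f : E → F} {z w : E} (hf : DifferentiableAt ℝ f z)
    {a b c : F} (h : ∀ s : ℝ, f (z + s • w) = f z + s • a + s ^ 2 • b + s ^ 3 • c) :
    fderiv ℝ f z w = a := by
  have h1 := hf.hasFDerivAt.hasLineDerivAt w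
  have h2 : HasLineDerivAt ℝ f a z w := by
    unfold HasLineDerivAt
    simp only [h]
    have e1 := ((hasDerivAt_id (0 : ℝ)).smul_const a).const_add (f z)
    have e2 := ((hasDerivAt_id (0 : ℝ)).pow 2).smul_const b
    have e3 := ((hasDerivAt_id (0 : ℝ)).pow 3).smul_const c
    exact ((e1.add e2).add e3).congr_deriv (by simp)
  exact h1.unique h2

namespace CubicNormStructure

section Calculus

variable {J : Type*} [NormedAddCommGroup J] [NormedSpace ℝ J] (C : CubicNormStructure J)

/-- The derivative of the period vector at `z`. -/
noncomputable def periodDeriv (z w : J × J) : ChargeSpace J × ChargeSpace J :=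
  ((0, w.1, -(C.cross z.1 w.1 - C.cross z.2 w.2),
      C.trace (C.sharpC z).1 w.1 - C.trace (C.sharpC z).2 w.2),
    (0, w.2, -(C.cross z.1 w.2 + C.cross z.2 w.1),
      C.trace (C.sharpC z).1 w.2 + C.trace (C.sharpC z).2 w.1))

theorem kahlerPotential_eq (z : J × J) : C.kahlerPotential z = -Real.log (8 * C.norm z.2) := by
  have h := C.symp_period z
  have h1 : C.symp (C.period z).1 (-(C.period z).2) = -(4 * C.norm z.2) := by
    rw [← h]
    simp only [symp, Prod.fst_neg, Prod.snd_neg, map_neg]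
    ring
  have h2 : C.symp (C.period z).2 (C.period z).1 = -(4 * C.norm z.2) := by
    rw [← h, symp, symp, C.trace_symm (C.period z).2.2.2.1, C.trace_symm (C.period z).2.2.1]
    ring
  rw [kahlerPotential]
  simp only [sympC, Complex.mul_re, Complex.I_re, Complex.I_im, h1, h2]
  congr 2
  ring

theorem centralCharge_eq (γ : ChargeSpace J) (z : J × J) : C.centralCharge γ z =
    ⟨C.symp γ (C.period z).1, C.symp γ (C.period z).2⟩ := by
  simp [centralCharge, sympC, symp]

variable [FiniteDimensional ℝ J]

theorem fderiv_period (z w : J × J) : fderiv ℝ C.period z w = C.periodDeriv z w := by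
  refine fderiv_apply_of_cubic_expansion
    ((C.contDiff_period (n := 1)).differentiable one_ne_zero).differentiableAt
    (b := ((0, 0, -(C.sharpC w).1, C.trace z.1 (C.sharpC w).1 - C.trace z.2 (C.sharpC w).2),
      (0, 0, -(C.sharpC w).2, C.trace z.1 (C.sharpC w).2 + C.trace z.2 (C.sharpC w).1)))
    (c := ((0, 0, 0, (C.normC w).re), (0, 0, 0, (C.normC w).im))) (fun s => ?_)
  have h1 := C.trace_cross_rotate z.1 z.2 w.2
  have k1 : C.trace (C.cross z.2 w.2) w.1 = C.trace z.2 (C.cross w.1 w.2) := by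
    rw [trace_cross_rotate, C.cross_comm w.2]
  have h3 := C.trace_cross_rotate z.1 w.1 w.2
  have k2 : C.trace (C.cross z.1 w.1) z.2 = C.trace (C.cross z.1 z.2) w.1 := by
    rw [trace_cross_rotate, trace_cross_rotate, C.cross_comm w.1]
  have h8 := C.cross_comm z.2 w.1
  ext <;> simp only [periodDeriv, period, sharpC, normC, polar_sharp, Prod.fst_add, Prod.snd_add,
    Prod.smul_fst, Prod.smul_snd, norm_add_smul, sharp_add, sharp_smul, map_add, map_sub, map_smul,
    LinearMap.add_apply, LinearMap.sub_apply, LinearMap.smul_apply, smul_eq_mul, mul_zero, add_zero,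
    smul_zero]
  · module
  · linear_combination s * h1 - s * C.trace_symm w.1 (C.sharp z.2) -
      s ^ 2 * (C.trace_symm w.1 (C.cross z.2 w.2) + k1)
  · rw [h8]; module
  · linear_combination s ^ 2 * C.trace_symm (C.sharp w.1) z.2 + s ^ 2 * h3 + s * k2

theorem hasFDerivAt_kahlerPotential {z : J × J} (hz : 0 < C.norm z.2) :
    HasFDerivAt C.kahlerPotential (-(C.norm z.2)⁻¹ • (LinearMap.toContinuousLinearMap
      (C.trace (C.sharp z.2))).comp (ContinuousLinearMap.snd ℝ J J)) z := by
  have h1 := (((C.hasFDerivAt_norm z.2).comp z hasFDerivAt_snd).const_mul 8).log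
    (by simpa using hz.ne')
  rw [funext C.kahlerPotential_eq]
  refine h1.neg.congr_fderiv ?_
  ext v
  · simp
  · simp
    field_simp

theorem dHol_kahlerPotential {z : J × J} (hz : 0 < C.norm z.2) (v : J) :
    dHol (fun w => (C.kahlerPotential w : ℂ)) v z =
      ⟨0, C.trace (C.sharp z.2) v / (2 * C.norm z.2)⟩ := by
  have h := Complex.ofRealCLM.hasFDerivAt.comp z (C.hasFDerivAt_kahlerPotential hz)
  have e : fderiv ℝ (fun w => (C.kahlerPotential w : ℂ)) z = _ := h.fderiv
  rw [dHol, e]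
  apply Complex.ext <;> simp
  field_simp

theorem dAnti_kahlerPotential {z : J × J} (hz : 0 < C.norm z.2) (v : J) :
    dAnti (fun w => (C.kahlerPotential w : ℂ)) v z =
      ⟨0, -(C.trace (C.sharp z.2) v / (2 * C.norm z.2))⟩ := by
  have h := Complex.ofRealCLM.hasFDerivAt.comp z (C.hasFDerivAt_kahlerPotential hz)
  have e : fderiv ℝ (fun w => (C.kahlerPotential w : ℂ)) z = _ := h.fderiv
  rw [dAnti, e]
  apply Complex.ext <;> simp
  field_simp

theorem dHol_centralCharge (γ : ChargeSpace J) (z : J × J) (v : J) :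
    dHol (C.centralCharge γ) v z =
      ⟨C.symp γ (C.periodDeriv z (v, 0)).1, C.symp γ (C.periodDeriv z (v, 0)).2⟩ := by
  let Lr : (ChargeSpace J × ChargeSpace J) →ₗ[ℝ] ℂ :=
    { toFun := fun u => ⟨C.symp γ u.1, C.symp γ u.2⟩
      map_add' := fun u v => by
        apply Complex.ext <;> simp only [symp, Prod.fst_add, Prod.snd_add, map_add, Complex.add_re,
          Complex.add_im] <;> ring
      map_smul' := fun s u => by
        apply Complex.ext <;> simp only [symp, Prod.smul_fst, Prod.smul_snd, map_smul, smul_eq_mul,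
          RingHom.id_apply, Complex.real_smul, Complex.re_ofReal_mul, Complex.im_ofReal_mul] <;>
          ring }
  have hd : HasFDerivAt C.period (fderiv ℝ C.period z) z :=
    ((C.contDiff_period (n := 1)).differentiable one_ne_zero).differentiableAt.hasFDerivAt
  have h := (LinearMap.toContinuousLinearMap Lr).hasFDerivAt.comp z hd
  have e : fderiv ℝ (C.centralCharge γ) z =
      (LinearMap.toContinuousLinearMap Lr).comp (fderiv ℝ C.period z) := by
    rw [funext (C.centralCharge_eq γ)]
    exact h.fderiv
  -- Cauchy–Riemann equations for Ω: the derivative along iv is i times that along v, so ½(∂_x -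
  -- i∂_y) reproduces ∂_x.
  have h2 : C.periodDeriv z (0, v) = (-(C.periodDeriv z (v, 0)).2, (C.periodDeriv z (v, 0)).1) := by
    simp [periodDeriv]
  rw [dHol, e]
  simp only [ContinuousLinearMap.comp_apply, fderiv_period, h2, LinearMap.coe_toContinuousLinearMap']
  have h3 : C.symp γ (-(C.periodDeriv z (v, 0)).2) = -C.symp γ (C.periodDeriv z (v, 0)).2 := by
    simp only [symp, Prod.fst_neg, Prod.snd_neg, map_neg]
    ring
  apply Complex.ext <;> simp [Lr, h3] <;> ring

theorem hasFDerivAt_trace_sharp (y v : J) : HasFDerivAt (fun y => C.trace (C.sharp y) v)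
    (LinearMap.toContinuousLinearMap (C.trace v ∘ₗ C.cross y)) y := by
  have h := (LinearMap.toContinuousLinearMap (C.trace v)).hasFDerivAt.comp y (C.hasFDerivAt_sharp y)
  simp only [C.trace_symm _ v]
  exact h

variable {ι : Type*} (b : Module.Basis ι ℝ J)

/-- K depends only on y = Im t, so the metric is a quarter of the Hessian of -log N(y). Its two
terms (y^#, ·)(y^#, ·)/N² and -(y × ·, ·)/N assemble into U_{y^#}/N². -/
theorem metric_apply (hC : C.IsEuclidean) {z : J × J} (hz : z ∈ C.domain) (i j : ι) :
    C.metric b z i j =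
      ((C.trace (C.uop (C.sharp z.2) (b i)) (b j) / (4 * C.norm z.2 ^ 2) : ℝ) : ℂ) := by
  have hN := C.domain_norm_pos hz
  have heq : (fun w => dAnti (fun w => (C.kahlerPotential w : ℂ)) (b j) w) =ᶠ[nhds z]
      fun w => (((-1 / 2) * (C.trace (C.sharp w.2) (b j) * (C.norm w.2)⁻¹) : ℝ) : ℂ) *
        Complex.I := by
    filter_upwards [(C.isOpen_domain hC).mem_nhds hz] with w hw
    rw [dAnti_kahlerPotential _ (C.domain_norm_pos hw)]
    apply Complex.ext <;> simp only [Complex.mul_re, Complex.mul_im, Complex.ofReal_re,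
      Complex.ofReal_im, Complex.I_re, Complex.I_im] <;> ring
  have hinv := (hasDerivAt_inv hN.ne').comp_hasFDerivAt z
    ((C.hasFDerivAt_norm z.2).comp z hasFDerivAt_snd)
  have h1 := ((C.hasFDerivAt_trace_sharp z.2 (b j)).comp z hasFDerivAt_snd).mul hinv
  have h2 := (Complex.ofRealCLM.hasFDerivAt.comp z (h1.const_mul (-1 / 2))).mul_const Complex.I
  have e : fderiv ℝ (fun w => dAnti (fun w => (C.kahlerPotential w : ℂ)) (b j) w) z = _ :=
    heq.fderiv_eq.trans h2.fderiv
  have h3 := C.trace_symm (b j) (C.cross z.2 (b i))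
  have e1 : fderiv ℝ (fun w => dAnti (fun w => (C.kahlerPotential w : ℂ)) (b j) w) z (b i, 0)
      = 0 := by
    rw [e]; simp
  have e2 : fderiv ℝ (fun w => dAnti (fun w => (C.kahlerPotential w : ℂ)) (b j) w) z (0, b i)
      = Complex.I * ((C.trace (C.uop (C.sharp z.2) (b i)) (b j) / (2 * C.norm z.2 ^ 2) : ℝ) : ℂ)
      := by
    rw [e]
    simp only [smul_apply, ContinuousLinearMap.comp_apply, Complex.ofRealCLM_apply, smul_eq_mul]
    congr 2
    simp [uop_apply, C.sharp_sharp, h3]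
    field_simp
    ring
  rw [metric, Matrix.of_apply, dHol, e1, e2, ← mul_assoc, Complex.I_mul_I]
  push_cast
  ring

end Calculus

end CubicNormStructure

namespace CubicNormStructure

/-! ### Identification of V_eff with the covariant formula. -/

section EffectivePotential

variable {J : Type*} [NormedAddCommGroup J] [NormedSpace ℝ J] [FiniteDimensional ℝ J]
  (C : CubicNormStructure J) {ι : Type*} [Fintype ι] [DecidableEq ι] (b : Module.Basis ι ℝ J)

omit [FiniteDimensional ℝ J] [DecidableEq ι] in
theorem sum_mul_trace_basis (c : ι → ℝ) (x : J) :
    ∑ j, c j * C.trace x (b j) = C.trace x (∑ j, c j • b j) := by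
  simp [map_sum]

omit [DecidableEq ι] in
theorem metric_mulVec (hC : C.IsEuclidean) {z : J × J} (hz : z ∈ C.domain) (c : ι → ℂ) (i : ι) :
    (C.metric b z).mulVec c i =
      ⟨C.trace (C.uop (C.sharp z.2) (b i)) (∑ j, (c j).re • b j) / (4 * C.norm z.2 ^ 2),
        C.trace (C.uop (C.sharp z.2) (b i)) (∑ j, (c j).im • b j) / (4 * C.norm z.2 ^ 2)⟩ := by
  rw [← C.sum_mul_trace_basis b, ← C.sum_mul_trace_basis b, Matrix.mulVec, dotProduct]
  simp only [C.metric_apply b hC hz]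
  apply Complex.ext <;> simp only [Complex.re_sum, Complex.im_sum, Finset.sum_div]
  · refine Finset.sum_congr rfl fun j _ => ?_
    rw [Complex.re_ofReal_mul]; ring
  · refine Finset.sum_congr rfl fun j _ => ?_
    rw [Complex.im_ofReal_mul]; ring

omit [FiniteDimensional ℝ J] [Fintype ι] [DecidableEq ι] in
theorem eq_zero_of_trace_basis (hC : C.IsEuclidean) {v : J} (h : ∀ i, C.trace (b i) v = 0) :
    v = 0 := by
  refine C.eq_zero_of_trace_self hC ?_
  have : C.trace.flip v = 0 := b.ext fun i => by simpa using h i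
  simpa using LinearMap.congr_fun this v

theorem isUnit_metric (hC : C.IsEuclidean) {z : J × J} (hz : z ∈ C.domain) :
    IsUnit (C.metric b z) := by
  have hN := C.domain_norm_pos hz
  rw [← Matrix.mulVec_injective_iff_isUnit]
  have key : ∀ c : ι → ℝ, (∀ i, C.trace (C.uop (C.sharp z.2) (b i)) (∑ j, c j • b j) = 0) →
      c = 0 := by
    intro c hc
    have h1 : C.uop (C.sharp z.2) (∑ j, c j • b j) = 0 :=
      C.eq_zero_of_trace_basis b hC fun i => by rw [← trace_uop]; exact hc i
    have h2 := C.uop_uop_sharp z.2 (∑ j, c j • b j)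
    rw [h1, map_zero] at h2
    have h3 : ∑ j, c j • b j = 0 :=
      (smul_eq_zero.1 h2.symm).resolve_left (pow_ne_zero _ hN.ne')
    funext i
    exact Fintype.linearIndependent_iff.1 b.linearIndependent c h3 i
  have hker : ∀ c : ι → ℂ, (C.metric b z).mulVec c = 0 → c = 0 := by
    intro c hc
    have h4 : (4 * C.norm z.2 ^ 2) ≠ 0 := by positivity
    have hr := key (fun j => (c j).re) fun i => by
      have := congrFun hc i
      rw [metric_mulVec _ _ hC hz] at this
      simpa [h4, hN.ne'] using congrArg Complex.re this
    have hi := key (fun j => (c j).im) fun i => by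
      have := congrFun hc i
      rw [metric_mulVec _ _ hC hz] at this
      simpa [h4, hN.ne'] using congrArg Complex.im this
    funext i
    exact Complex.ext (congrFun hr i) (congrFun hi i)
  intro c d hcd
  have := hker (c - d) (by rw [Matrix.mulVec_sub]; exact sub_eq_zero.2 hcd)
  exact sub_eq_zero.1 this

/-- The metric is U_{y^#}/(4N²), with inverse 4U_y, so the covector with components (α + iβ, b_i)
has the preimage 4U_y(α + iβ), the vector c below. -/
theorem metric_inv_sum (hC : C.IsEuclidean) {z : J × J} (hz : z ∈ C.domain) (α β : J)
    (a : ι → ℂ) (ha : ∀ i, a i = ⟨C.trace α (b i), C.trace β (b i)⟩) :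
    (∑ i, ∑ j, (C.metric b z)⁻¹ j i * a i * (starRingEnd ℂ) (a j)).re =
      4 * C.trace (C.uop z.2 α) α + 4 * C.trace (C.uop z.2 β) β := by
  have hN := C.domain_norm_pos hz
  set c : ι → ℂ := fun j => ⟨b.repr ((4 : ℝ) • C.uop z.2 α) j, b.repr ((4 : ℝ) • C.uop z.2 β) j⟩
    with hc
  have h1 : (C.metric b z).mulVec c = a := by
    funext i
    rw [metric_mulVec _ _ hC hz, ha]
    simp only [hc, b.sum_repr]
    have : ∀ δ : J, C.trace (C.uop (C.sharp z.2) (b i)) ((4 : ℝ) • C.uop z.2 δ) /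
        (4 * C.norm z.2 ^ 2) = C.trace δ (b i) := by
      intro δ
      rw [trace_uop, map_smul, uop_sharp_uop _ _ _ hN.ne', map_smul, map_smul, C.trace_symm δ]
      simp only [smul_eq_mul]
      field_simp
    rw [this, this]
  have h2 : (C.metric b z)⁻¹.mulVec a = c := by
    rw [← h1, Matrix.mulVec_mulVec, Matrix.nonsing_inv_mul _
      ((Matrix.isUnit_iff_isUnit_det _).1 (C.isUnit_metric b hC hz)), Matrix.one_mulVec]
  have h3 : ∑ i, ∑ j, (C.metric b z)⁻¹ j i * a i * (starRingEnd ℂ) (a j) =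
      ∑ j, c j * (starRingEnd ℂ) (a j) := by
    rw [Finset.sum_comm]
    refine Finset.sum_congr rfl fun j _ => ?_
    rw [← Finset.sum_mul, ← h2]
    rfl
  rw [h3, Complex.re_sum]
  have h4 : ∀ j, (c j * (starRingEnd ℂ) (a j)).re =
      b.repr ((4 : ℝ) • C.uop z.2 α) j * C.trace α (b j) +
      b.repr ((4 : ℝ) • C.uop z.2 β) j * C.trace β (b j) := by
    intro j
    rw [ha]
    simp [hc]
  simp only [h4]
  rw [Finset.sum_add_distrib, sum_mul_trace_basis, sum_mul_trace_basis, b.sum_repr, b.sum_repr,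
    map_smul, map_smul, C.trace_symm α, C.trace_symm β]
  simp

/-- Translating the charge by -x turns every ingredient into an expression in γ' and y. Then D_iZ =
(α + iβ, b_i), where the multiples of y^# in α and β contain the term (∂_iK)Z, and the inverse
metric reduces |DZ|² to values of U_y. -/
theorem effectivePotential_eq (hC : C.IsEuclidean) (γ : ChargeSpace J) {z : J × J}
    (hz : z ∈ C.domain) : C.effectivePotential b γ z = C.potential γ z := by
  have hN := C.domain_norm_pos hz
  obtain ⟨x, y⟩ := z
  obtain ⟨p₀, p, q, q₀⟩ := γ
  simp only at hN
  set γ' := C.translation (-x) (p₀, p, q, q₀) with hγ'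
  have g1 : γ'.1 = p₀ := rfl
  have g2 : γ'.2.1 = p - p₀ • x := by simp [hγ', translation_apply, sub_eq_add_neg]
  have g3 : γ'.2.2.1 = q + C.cross p x - p₀ • C.sharp x := by
    simp [hγ', translation_apply]
  have g4 : γ'.2.2.2 = q₀ + C.trace q x + C.trace p (C.sharp x) - p₀ * C.norm x := by
    simp [hγ', translation_apply, norm_neg']
    ring
  have hZr : C.symp (p₀, p, q, q₀) (C.period (x, y)).1 =
      γ'.2.2.2 - C.trace (C.sharp y) γ'.2.1 := by
    rw [g4, g2]
    simp only [symp, period, sharpC, normC, map_neg, map_sub, map_smul, smul_eq_mul,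
      C.trace_symm (C.sharp y), LinearMap.sub_apply, LinearMap.smul_apply]
    ring
  have hZi : C.symp (p₀, p, q, q₀) (C.period (x, y)).2 =
      C.trace y γ'.2.2.1 + p₀ * C.norm y := by
    have h1 := C.trace_cross_rotate p x y
    rw [g3]
    simp only [symp, period, sharpC, normC, polar_sharp, map_neg, map_sub, map_add, map_smul,
      smul_eq_mul, C.trace_symm y, h1, LinearMap.add_apply, LinearMap.sub_apply,
      LinearMap.smul_apply]
    ring
  set Zr := C.symp (p₀, p, q, q₀) (C.period (x, y)).1
  set Zi := C.symp (p₀, p, q, q₀) (C.period (x, y)).2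
  have hZc : C.centralCharge (p₀, p, q, q₀) (x, y) = ⟨Zr, Zi⟩ := C.centralCharge_eq _ _
  clear_value Zr Zi
  set α := γ'.2.2.1 + (p₀ - Zi / (2 * C.norm y)) • C.sharp y with hα
  set β := C.cross y γ'.2.1 + (Zr / (2 * C.norm y)) • C.sharp y with hβ
  have hcov : ∀ i, C.covDeriv b (p₀, p, q, q₀) (x, y) i = ⟨C.trace α (b i), C.trace β (b i)⟩ := by
    intro i
    have h1 := C.trace_cross_rotate p x (b i)
    have h2 := C.trace_cross_rotate p y (b i)
    have h3 := C.cross_comm y p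
    have h4 := C.cross_comm y x
    have h5 := C.trace_symm (C.sharp y) (b i)
    rw [covDeriv, dHol_centralCharge, C.dHol_kahlerPotential hN, hZc]
    apply Complex.ext
    · simp only [Complex.add_re, Complex.mul_re, symp, periodDeriv, sharpC, polar_sharp, hα, g3,
        map_add, map_sub, map_smul, map_neg, map_zero, LinearMap.add_apply, LinearMap.sub_apply,
        LinearMap.smul_apply, smul_eq_mul, h1]
      ring
    · simp only [Complex.add_im, Complex.mul_im, symp, periodDeriv, sharpC, polar_sharp, hβ, g2,
        map_add, map_sub, map_smul, map_neg, map_zero, LinearMap.add_apply, LinearMap.sub_apply,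
        LinearMap.smul_apply, smul_eq_mul, h2, h3, h4]
      ring
  rw [effectivePotential, C.metric_inv_sum b hC hz α β _ hcov, kahlerPotential_eq, hZc,
    Complex.sq_norm, Complex.normSq_mk, Real.exp_neg, Real.exp_log (by positivity), potential,
    chargeForm_translation, chargeForm_zero_left, ← hγ']
  -- Since U_y y^# = N(y)y, the contribution of the y^#-direction to the quadratic form of U_y is
  -- explicit.
  have uadd : ∀ (a : J) (c : ℝ), C.trace (C.uop y (a + c • C.sharp y)) (a + c • C.sharp y) =
      C.trace (C.uop y a) a + 2 * c * C.norm y * C.trace y a + 3 * c ^ 2 * C.norm y ^ 2 := by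
    intro a c
    have e1 : C.uop y (C.sharp y) = C.norm y • y := by
      rw [uop_apply, C.trace_self_sharp, cross_self, C.sharp_sharp]; module
    have e2 : C.trace (C.uop y a) (C.sharp y) = C.norm y * C.trace y a := by
      rw [trace_uop, e1, map_smul, C.trace_symm a, smul_eq_mul]
    simp only [map_add, map_smul, LinearMap.add_apply, LinearMap.smul_apply, smul_eq_mul, e1, e2,
      C.trace_self_sharp]
    ring
  have u1 : C.trace (C.uop y α) α = C.trace y γ'.2.2.1 ^ 2
      - 2 * C.trace (C.sharp y) (C.sharp γ'.2.2.1)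
      + 2 * (p₀ - Zi / (2 * C.norm y)) * C.norm y * C.trace y γ'.2.2.1
      + 3 * (p₀ - Zi / (2 * C.norm y)) ^ 2 * C.norm y ^ 2 := by
    rw [hα, uadd, trace_uop_self]
  have u2 : C.trace (C.uop y β) β = 2 * C.trace (C.sharp y) γ'.2.1 ^ 2
      - 2 * C.norm y * C.trace y (C.sharp γ'.2.1)
      + 2 * (Zr / (2 * C.norm y)) * C.norm y * (2 * C.trace (C.sharp y) γ'.2.1)
      + 3 * (Zr / (2 * C.norm y)) ^ 2 * C.norm y ^ 2 := by
    have e1 : C.trace y (C.cross y γ'.2.1) = 2 * C.trace (C.sharp y) γ'.2.1 := by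
      rw [C.trace_symm, trace_cross_left_self]
    rw [hβ, uadd, e1, uop_apply, cross_sharp_cross, e1]
    simp only [map_sub, map_add, map_smul, LinearMap.sub_apply, LinearMap.add_apply,
      LinearMap.smul_apply, smul_eq_mul, e1, C.trace_symm γ'.2.1, trace_cross_right_self]
    ring
  change (8 * C.norm y)⁻¹ * (4 * C.trace (C.uop y α) α + 4 * C.trace (C.uop y β) β +
    (Zr * Zr + Zi * Zi)) = _
  rw [u1, u2, hZr, hZi, g1]
  field_simp
  ring

omit [DecidableEq ι] [Fintype ι] in
theorem contDiff_quartic {n : WithTop ℕ∞} : ContDiff ℝ n C.quartic := by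
  have h1 : ContDiff ℝ n fun v : ChargeSpace J => v.1 := contDiff_fst
  have h2 : ContDiff ℝ n fun v : ChargeSpace J => v.2.1 := contDiff_fst.comp contDiff_snd
  have h3 : ContDiff ℝ n fun v : ChargeSpace J => v.2.2.1 :=
    contDiff_fst.comp (contDiff_snd.comp contDiff_snd)
  have h4 : ContDiff ℝ n fun v : ChargeSpace J => v.2.2.2 :=
    contDiff_snd.comp (contDiff_snd.comp contDiff_snd)
  exact ((((contDiff_const.mul h1).mul (C.contDiff_norm.comp h3)).sub
    ((contDiff_const.mul h4).mul (C.contDiff_norm.comp h2))).add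
    (contDiff_const.mul ((C.contDiff_sharp.comp h3).bilinear C.trace (C.contDiff_sharp.comp h2)))).sub
    (((h1.mul h4).add (h2.bilinear C.trace h3)).pow 2)

omit [DecidableEq ι] [Fintype ι] in
theorem contDiff_symp (γ : ChargeSpace J) {n : WithTop ℕ∞} : ContDiff ℝ n (C.symp γ) := by
  have h1 : ContDiff ℝ n fun v : ChargeSpace J => v.1 := contDiff_fst
  have h2 : ContDiff ℝ n fun v : ChargeSpace J => v.2.1 := contDiff_fst.comp contDiff_snd
  have h3 : ContDiff ℝ n fun v : ChargeSpace J => v.2.2.1 :=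
    contDiff_fst.comp (contDiff_snd.comp contDiff_snd)
  have h4 : ContDiff ℝ n fun v : ChargeSpace J => v.2.2.2 :=
    contDiff_snd.comp (contDiff_snd.comp contDiff_snd)
  exact (((contDiff_const.mul h1).add (h2.linear (C.trace γ.2.2.1))).sub
    (contDiff_const.mul h4)).sub (h3.linear (C.trace γ.2.1))

omit [DecidableEq ι] [Fintype ι] in
theorem contDiff_chargeForm (γ : ChargeSpace J) {n : WithTop ℕ∞} :
    ContDiff ℝ n (C.chargeForm γ) := by
  have h1 : ContDiff ℝ n fun z => (C.period z).1 := contDiff_fst.comp C.contDiff_period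
  have h2 : ContDiff ℝ n fun z => (C.period z).2 := contDiff_snd.comp C.contDiff_period
  have hq : ContDiff ℝ n (C.quarticSnd γ) :=
    ((((C.contDiff_quartic.comp (contDiff_const.add contDiff_id)).add
      (C.contDiff_quartic.comp (contDiff_const.sub contDiff_id))).div_const 2).sub
      contDiff_const).sub C.contDiff_quartic
  exact (contDiff_const.mul ((((C.contDiff_symp γ).comp h1).pow 2).add
    (((C.contDiff_symp γ).comp h2).pow 2))).sub ((hq.comp h1).add (hq.comp h2))

omit [DecidableEq ι] [Fintype ι] in
theorem differentiableAt_potential (γ : ChargeSpace J) {z : J × J} (hz : C.norm z.2 ≠ 0) :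
    DifferentiableAt ℝ (C.potential γ) z := by
  have h2 : ContDiff ℝ 1 (fun z : J × J => 8 * C.norm z.2) :=
    contDiff_const.mul (C.contDiff_norm.comp contDiff_snd)
  exact ((C.contDiff_chargeForm γ).contDiffAt.div h2.contDiffAt
    (by simpa using hz)).differentiableAt one_ne_zero

theorem mem_criticalLocus_iff (hC : C.IsEuclidean) (γ : ChargeSpace J) (z : J × J) :
    z ∈ C.criticalLocus b γ ↔
      z ∈ C.domain ∧ HasFDerivAt (C.potential γ) (0 : J × J →L[ℝ] ℝ) z := by
  refine and_congr_right fun hz => ?_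
  have h : C.effectivePotential b γ =ᶠ[nhds z] C.potential γ := by
    filter_upwards [(C.isOpen_domain hC).mem_nhds hz] with w hw
    exact C.effectivePotential_eq b hC γ hw
  exact h.hasFDerivAt_iff

end EffectivePotential

end CubicNormStructure

namespace CubicNormStructure

/-! ### The action on the tube domain and on critical loci. -/

section Action

variable {J : Type*} [AddCommGroup J] [Module ℝ J] (C : CubicNormStructure J)

/-- The automorphy factor of `g` at `z`: the first component of `g Ω(z)`. -/
noncomputable def factor (g : ChargeSpace J ≃ₗ[ℝ] ChargeSpace J) (z : J × J) : ℂ :=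
  ⟨(g (C.period z).1).1, (g (C.period z).2).1⟩

/-- The fractional linear action of `g` on the tube domain. -/
noncomputable def action (g : ChargeSpace J ≃ₗ[ℝ] ChargeSpace J) (z : J × J) : J × J :=
  complexSMul (C.factor g z)⁻¹ ((g (C.period z).1).2.1, (g (C.period z).2).2.1)

theorem factor_eq {g : ChargeSpace J ≃ₗ[ℝ] ChargeSpace J} {z w : J × J} {c : ℂ}
    (h : (g (C.period z).1, g (C.period z).2) = complexSMul c (C.period w)) :
    C.factor g z = c := by
  rw [complexSMul_period, Prod.ext_iff] at h
  simp only at h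
  rw [factor, h.1, h.2]
  rfl

/-- The first component of Ω is 1, so g Ω(z) = cΩ(w) determines both c and w: the target of a move
is unique. -/
theorem action_eq_of_moves {g : ChargeSpace J ≃ₗ[ℝ] ChargeSpace J} {z w : J × J}
    (hm : C.Moves g z w) : C.action g z = w := by
  obtain ⟨c, hc, h⟩ := (C.moves_iff _ _ _).1 hm
  rw [action, C.factor_eq h]
  rw [complexSMul_period, Prod.ext_iff] at h
  simp only at h
  rw [h.1, h.2]
  show complexSMul c⁻¹ (complexSMul c w) = w
  rw [← complexSMul_mul, inv_mul_cancel₀ hc, complexSMul_one]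

theorem factor_spec {g : ChargeSpace J ≃ₗ[ℝ] ChargeSpace J} {z w : J × J}
    (hm : C.Moves g z w) : C.factor g z ≠ 0 ∧
    (g (C.period z).1, g (C.period z).2) = complexSMul (C.factor g z) (C.period w) := by
  obtain ⟨c, hc, h⟩ := (C.moves_iff _ _ _).1 hm
  rw [C.factor_eq h]
  exact ⟨hc, h⟩

end Action

section DomainAction

variable {J : Type*} [NormedAddCommGroup J] [NormedSpace ℝ J] (C : CubicNormStructure J)

theorem moves_action {g : ChargeSpace J ≃ₗ[ℝ] ChargeSpace J} (hg : g ∈ C.domainGroup) {z : J × J}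
    (hz : z ∈ C.domain) : C.Moves g z (C.action g z) := by
  obtain ⟨w, -, h⟩ := hg.2.1 z hz
  rwa [C.action_eq_of_moves h]

theorem action_mem {g : ChargeSpace J ≃ₗ[ℝ] ChargeSpace J} (hg : g ∈ C.domainGroup) {z : J × J}
    (hz : z ∈ C.domain) : C.action g z ∈ C.domain := by
  obtain ⟨w, hw, h⟩ := hg.2.1 z hz
  rwa [C.action_eq_of_moves h]

theorem action_mul {g h : ChargeSpace J ≃ₗ[ℝ] ChargeSpace J} (hg : g ∈ C.domainGroup)
    (hh : h ∈ C.domainGroup) {z : J × J} (hz : z ∈ C.domain) :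
    C.action (g * h) z = C.action g (C.action h z) :=
  C.action_eq_of_moves ((C.moves_action hh hz).trans C (C.moves_action hg (C.action_mem hh hz)))

theorem action_inv_action {g : ChargeSpace J ≃ₗ[ℝ] ChargeSpace J} (hg : g ∈ C.domainGroup)
    {z : J × J} (hz : z ∈ C.domain) : C.action g⁻¹ (C.action g z) = z :=
  C.action_eq_of_moves ((C.moves_action hg hz).symm C)

theorem action_action_inv {g : ChargeSpace J ≃ₗ[ℝ] ChargeSpace J} (hg : g ∈ C.domainGroup)
    {z : J × J} (hz : z ∈ C.domain) : C.action g (C.action g⁻¹ z) = z := by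
  have := C.action_inv_action (C.domainGroup.inv_mem hg) hz
  rwa [inv_inv] at this

/-- One pair of points of the domain fixes the sign of ν. Preservation of the domain is not assumed,
because a general element of Stab_± need not have it. -/
theorem exists_multiplier {g : ChargeSpace J ≃ₗ[ℝ] ChargeSpace J} (hg : g ∈ C.group)
    {z w : J × J} (hz : z ∈ C.domain) (hw : w ∈ C.domain) (hm : C.Moves g z w) :
    ∃ ν : ℝ, 0 < ν ∧ (∀ γ, C.quartic (g γ) = ν ^ 2 * C.quartic γ) ∧
      (∀ v w, C.symp (g v) (g w) = ν * C.symp v w) ∧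
      ∀ γ z w, z ∈ C.domain → C.Moves g z w → C.potential (g γ) w = ν * C.potential γ z := by
  obtain ⟨ν, hν, h1, h2⟩ := hg
  exact ⟨ν, C.multiplier_pos h1 hm (C.domain_norm_pos hz) (C.domain_norm_pos hw), h2, h1,
    fun γ z w hz hm => C.potential_equivariant hν h1 h2 hm (C.domain_norm_pos hz).ne' γ⟩

theorem exists_multiplier_of_mem {g : ChargeSpace J ≃ₗ[ℝ] ChargeSpace J} (hg : g ∈ C.domainGroup) :
    ∃ ν : ℝ, 0 < ν ∧ (∀ γ, C.quartic (g γ) = ν ^ 2 * C.quartic γ) ∧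
      (∀ v w, C.symp (g v) (g w) = ν * C.symp v w) ∧
      ∀ γ z, z ∈ C.domain → C.potential (g γ) (C.action g z) = ν * C.potential γ z := by
  have h0 : ((0, C.one) : J × J) ∈ C.domain := C.one_mem_cone
  obtain ⟨ν, hν, h1, h2, h3⟩ := C.exists_multiplier hg.1 h0 (C.action_mem hg h0)
    (C.moves_action hg h0)
  exact ⟨ν, hν, h1, h2, fun γ z hz => h3 γ z _ hz (C.moves_action hg hz)⟩

variable [FiniteDimensional ℝ J]

theorem contDiff_factor (g : ChargeSpace J ≃ₗ[ℝ] ChargeSpace J) {n : WithTop ℕ∞} :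
    ContDiff ℝ n (C.factor g) := by
  have h1 : ContDiff ℝ n fun z => g (C.period z).1 :=
    (contDiff_fst.comp C.contDiff_period).linear g.toLinearMap
  have h2 : ContDiff ℝ n fun z => g (C.period z).2 :=
    (contDiff_snd.comp C.contDiff_period).linear g.toLinearMap
  exact Complex.equivRealProdCLM.symm.contDiff.comp
    ((contDiff_fst.comp h1).prodMk (contDiff_fst.comp h2))

theorem contDiffOn_action {g : ChargeSpace J ≃ₗ[ℝ] ChargeSpace J} (hg : g ∈ C.domainGroup)
    {n : WithTop ℕ∞} : ContDiffOn ℝ n (C.action g) C.domain := by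
  have h1 : ContDiff ℝ n fun z => g (C.period z).1 :=
    (contDiff_fst.comp C.contDiff_period).linear g.toLinearMap
  have h2 : ContDiff ℝ n fun z => g (C.period z).2 :=
    (contDiff_snd.comp C.contDiff_period).linear g.toLinearMap
  refine contDiffOn_complexSMul ?_ (((contDiff_fst.comp (contDiff_snd.comp h1)).prodMk
    (contDiff_fst.comp (contDiff_snd.comp h2))).contDiffOn)
  exact ContDiffOn.inv (C.contDiff_factor g).contDiffOn fun z hz =>
    (C.factor_spec (C.moves_action hg hz)).1

theorem differentiableAt_action (hC : C.IsEuclidean) {g : ChargeSpace J ≃ₗ[ℝ] ChargeSpace J}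
    (hg : g ∈ C.domainGroup) {z : J × J} (hz : z ∈ C.domain) :
    DifferentiableAt ℝ (C.action g) z :=
  ((C.contDiffOn_action hg (n := 1)).contDiffAt
    ((C.isOpen_domain hC).mem_nhds hz)).differentiableAt one_ne_zero

variable {ι : Type*} [Fintype ι] [DecidableEq ι] (b : Module.Basis ι ℝ J)

theorem action_mem_criticalLocus (hC : C.IsEuclidean) {g : ChargeSpace J ≃ₗ[ℝ] ChargeSpace J}
    (hg : g ∈ C.domainGroup) {γ : ChargeSpace J} {z : J × J} (hz : z ∈ C.criticalLocus b γ) :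
    C.action g z ∈ C.criticalLocus b (g γ) := by
  rw [mem_criticalLocus_iff _ _ hC] at hz ⊢
  obtain ⟨hz, hd⟩ := hz
  have hw := C.action_mem hg hz
  refine ⟨hw, ?_⟩
  obtain ⟨ν, -, -, -, h⟩ := C.exists_multiplier_of_mem hg
  have hd' : HasFDerivAt (C.potential γ) (0 : J × J →L[ℝ] ℝ) (C.action g⁻¹ (C.action g z)) := by
    rwa [C.action_inv_action hg hz]
  have h1 := (hd'.comp _ (C.differentiableAt_action hC (C.domainGroup.inv_mem hg)
    hw).hasFDerivAt).const_mul ν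
  rw [ContinuousLinearMap.zero_comp, smul_zero] at h1
  refine h1.congr_of_eventuallyEq ?_
  filter_upwards [(C.isOpen_domain hC).mem_nhds hw] with u hu
  have := h γ _ (C.action_mem (C.domainGroup.inv_mem hg) hu)
  rwa [C.action_action_inv hg hu] at this

theorem action_mem_criticalLocus_iff (hC : C.IsEuclidean)
    {g : ChargeSpace J ≃ₗ[ℝ] ChargeSpace J} (hg : g ∈ C.domainGroup) {γ : ChargeSpace J}
    {z : J × J} (hz : z ∈ C.domain) :
    C.action g z ∈ C.criticalLocus b (g γ) ↔ z ∈ C.criticalLocus b γ := by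
  refine ⟨fun h => ?_, C.action_mem_criticalLocus b hC hg⟩
  have h1 := C.action_mem_criticalLocus b hC (C.domainGroup.inv_mem hg) h
  rw [C.action_inv_action hg hz] at h1
  rwa [show g⁻¹ (g γ) = γ from g.symm_apply_apply γ] at h1

end DomainAction

/-! ### Critical points for the charge (p⁰, 0, 0, q₀). -/

section Axis

variable {J : Type*} [NormedAddCommGroup J] [NormedSpace ℝ J] (C : CubicNormStructure J)

theorem potential_axis_smul (p₀ q₀ : ℝ) (x : J) {l : ℝ} (hl : l ≠ 0) :
    C.potential (p₀, 0, 0, q₀) (x, l • C.one) =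
      ((q₀ - p₀ * C.norm x) ^ 2 + p₀ ^ 2 * (l ^ 6 + l ^ 4 * C.trace x x
        + l ^ 2 * C.trace (C.sharp x) (C.sharp x))) / (2 * l ^ 3) := by
  rw [potential, chargeForm_axis, trace_self, trace_sharp_sharp_self]
  simp only [norm_smul', sharp_smul, C.sharp_one, C.norm_one, map_smul, LinearMap.smul_apply,
    smul_eq_mul]
  field_simp
  ring

theorem potential_axis_one (p₀ q₀ : ℝ) (x : J) : C.potential (p₀, 0, 0, q₀) (x, C.one) =
    ((q₀ - p₀ * C.norm x) ^ 2 + p₀ ^ 2 * (1 + C.trace x x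
      + C.trace (C.sharp x) (C.sharp x))) / 2 := by
  have := C.potential_axis_smul p₀ q₀ x one_ne_zero
  rw [one_smul] at this
  rw [this]; ring

theorem potential_axis_zero (p₀ q₀ : ℝ) (y : J) : C.potential (p₀, 0, 0, q₀) (0, y) =
    (q₀ ^ 2 + p₀ ^ 2 * C.norm y ^ 2) / (2 * C.norm y) := by
  rw [potential, chargeForm_axis]
  simp only [C.norm_zero', C.sharp_zero, map_zero]
  rw [show (8 * C.norm y) = 4 * (2 * C.norm y) by ring, mul_div_mul_left _ _ four_ne_zero]
  ring

/-- The inequalities (x ± x^#, x ± x^#) ≥ 0 give A + B ≥ 6|N|, which more than compensates the term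
p⁰N in (q₀ - p⁰N)² + p⁰² ≥ 2|p⁰(q₀ - p⁰N)|. -/
theorem le_potential_axis_one (hC : C.IsEuclidean) (p₀ q₀ : ℝ) (x : J) :
    |p₀ * q₀| ≤ C.potential (p₀, 0, 0, q₀) (x, C.one) := by
  rw [potential_axis_one]
  have h1 := C.trace_self_nonneg hC (x + C.sharp x)
  have h2 := C.trace_self_nonneg hC (x - C.sharp x)
  simp only [map_add, map_sub, LinearMap.add_apply, LinearMap.sub_apply, C.trace_self_sharp,
    C.trace_sharp_self] at h1 h2
  set A := C.trace x x
  set B := C.trace (C.sharp x) (C.sharp x)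
  set N := C.norm x
  have h3 := mul_nonneg (sq_nonneg p₀) h1
  have h4 := mul_nonneg (sq_nonneg p₀) h2
  have hA := mul_nonneg (sq_nonneg p₀) (C.trace_self_nonneg hC x)
  have hB := mul_nonneg (sq_nonneg p₀) (C.trace_self_nonneg hC (C.sharp x))
  rw [abs_le]
  constructor
  · nlinarith [sq_nonneg (q₀ - p₀ * N + p₀)]
  · nlinarith [sq_nonneg (q₀ - p₀ * N - p₀)]

theorem levi_axis {w : J} (hw : C.norm w ≠ 0) (p₀ q₀ : ℝ) :
    C.levi w hw (p₀, 0, 0, q₀ / C.norm w ^ 2) = (p₀, 0, 0, q₀) := by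
  simp only [levi_apply, map_zero]
  rw [mul_div_cancel₀ _ (pow_ne_zero 2 hw)]

theorem action_levi {w : J} (hw : C.norm w ≠ 0) (z : J × J) :
    C.action (C.levi w hw) z = (C.uop w z.1, C.uop w z.2) :=
  C.action_eq_of_moves (C.levi_moves w hw z)

theorem potential_axis_uop (p₀ q₀ : ℝ) {w : J} (hw : C.norm w ≠ 0) (x : J) :
    C.potential (p₀, 0, 0, q₀) (C.uop w x, C.uop w C.one) =
      C.norm w ^ 2 * C.potential (p₀, 0, 0, q₀ / C.norm w ^ 2) (x, C.one) := by
  have h := C.potential_equivariant (pow_ne_zero 2 hw) (C.symp_levi w hw) (C.quartic_levi w hw)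
    (C.levi_moves w hw (x, C.one)) (by simp [C.norm_one]) (p₀, 0, 0, q₀ / C.norm w ^ 2)
  rwa [levi_axis] at h

/-- The test vector is 3x² - (x, x)1 with x² = U_x 1, three times the traceless part of x². In
eigenvalues this is 3(ab + bc + ca) ≤ (a + b + c)² for the squares a, b, c of the eigenvalues of x.
-/
theorem three_mul_sharp_le (hC : C.IsEuclidean) (x : J) :
    3 * C.trace (C.sharp x) (C.sharp x) ≤ C.trace x x ^ 2 := by
  have h := C.trace_self_nonneg hC ((3 : ℝ) • (C.trace C.one x • x + C.sharp x)
    - (C.trace C.one x ^ 2 + C.trace C.one (C.sharp x)) • C.one)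
  simp only [map_add, map_sub, map_smul, LinearMap.add_apply, LinearMap.sub_apply,
    LinearMap.smul_apply, smul_eq_mul, C.trace_symm x C.one, C.trace_symm (C.sharp x) C.one,
    C.trace_self_sharp, C.trace_sharp_self, C.trace_one_one, C.trace_self x,
    C.trace_sharp_sharp_self] at h ⊢
  nlinarith

theorem three_mul_norm_le (hC : C.IsEuclidean) (x : J) :
    3 * (C.norm x ^ 2 * C.trace x x) ≤ C.trace (C.sharp x) (C.sharp x) ^ 2 := by
  have h := C.three_mul_sharp_le hC (C.sharp x)
  rw [C.sharp_sharp, map_smul, map_smul, LinearMap.smul_apply, smul_eq_mul, smul_eq_mul] at h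
  linarith

variable [FiniteDimensional ℝ J]

theorem le_potential_axis (hC : C.IsEuclidean) (p₀ q₀ : ℝ) {z : J × J} (hz : z ∈ C.domain) :
    |p₀ * q₀| ≤ C.potential (p₀, 0, 0, q₀) z := by
  obtain ⟨w, x, hw, rfl⟩ := C.exists_uop_pair hC hz
  have h := C.le_potential_axis_one hC p₀ (q₀ / C.norm w ^ 2) x
  have hN : 0 < C.norm w ^ 2 := by positivity
  rw [potential_axis_uop _ _ _ hw]
  rw [← mul_div_assoc, abs_div, abs_of_pos hN, div_le_iff₀ hN] at h
  linarith

variable {ι : Type*} [Fintype ι] [DecidableEq ι] (b : Module.Basis ι ℝ J)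

/-- Two curves suffice, s ↦ (sx, 1) and s ↦ (x, s·1) at s = 1. With q₀ = p⁰(N + k) they give A + 2B
= 3Nk and 3 + A - B = 3k²; two inequalities between A, B, N then force A = B = 0, and so k² = 1. -/
theorem eq_zero_of_mem_criticalLocus_axis_one (hC : C.IsEuclidean) {p₀ q₀ : ℝ} (hp : p₀ ≠ 0)
    {x : J} (h : (x, C.one) ∈ C.criticalLocus b (p₀, 0, 0, q₀)) : x = 0 ∧ q₀ ^ 2 = p₀ ^ 2 := by
  rw [mem_criticalLocus_iff _ _ hC] at h
  obtain ⟨-, h⟩ := h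
  set A := C.trace x x with hA
  set B := C.trace (C.sharp x) (C.sharp x) with hB
  set N := C.norm x with hN
  have e1 : -(p₀ * N) * (q₀ - p₀ * N) * 3 + p₀ ^ 2 * (A + 2 * B) = 0 := by
    have hl : HasDerivAt (fun s : ℝ => ((s • x, C.one) : J × J)) (x, 0) 1 := by
      have := ((hasDerivAt_id (1 : ℝ)).smul_const x).prodMk (hasDerivAt_const (1 : ℝ) C.one)
      simpa using this
    have h' : HasFDerivAt (C.potential (p₀, 0, 0, q₀)) (0 : J × J →L[ℝ] ℝ)
        ((1 : ℝ) • x, C.one) := by rwa [one_smul]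
    have h1 := h'.comp_hasDerivAt (1 : ℝ) hl
    have h2 : HasDerivAt (fun s : ℝ => ((q₀ - p₀ * (s ^ 3 * N)) ^ 2
        + p₀ ^ 2 * (1 + s ^ 2 * A + s ^ 4 * B)) / 2)
        (-(p₀ * N) * (q₀ - p₀ * N) * 3 + p₀ ^ 2 * (A + 2 * B)) 1 := by
      have d := fun n : ℕ => (hasDerivAt_id (1 : ℝ)).pow n
      have a1 := ((((d 3).mul_const N).const_mul p₀).const_sub q₀).pow 2
      have a2 := ((((d 2).mul_const A).const_add 1).add ((d 4).mul_const B)).const_mul (p₀ ^ 2)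
      refine ((a1.add a2).div_const 2).congr_deriv ?_
      simp
      ring
    have h3 : (C.potential (p₀, 0, 0, q₀) ∘ fun s : ℝ => ((s • x, C.one) : J × J)) =
        fun s : ℝ => ((q₀ - p₀ * (s ^ 3 * N)) ^ 2
          + p₀ ^ 2 * (1 + s ^ 2 * A + s ^ 4 * B)) / 2 := by
      funext s
      simp only [Function.comp, potential_axis_one, norm_smul', sharp_smul, map_smul,
        LinearMap.smul_apply, smul_eq_mul, ← hA, ← hB, ← hN]
      ring
    rw [h3] at h1
    simpa using h2.unique h1
  have e2 : p₀ ^ 2 * (3 + A - B) = 3 * (q₀ - p₀ * N) ^ 2 := by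
    have hl : HasDerivAt (fun s : ℝ => ((x, s • C.one) : J × J)) (0, C.one) 1 := by
      have := (hasDerivAt_const (1 : ℝ) x).prodMk ((hasDerivAt_id (1 : ℝ)).smul_const C.one)
      simpa using this
    have h' : HasFDerivAt (C.potential (p₀, 0, 0, q₀)) (0 : J × J →L[ℝ] ℝ)
        (x, (1 : ℝ) • C.one) := by rwa [one_smul]
    have h1 := h'.comp_hasDerivAt (1 : ℝ) hl
    have h2 : HasDerivAt (fun s : ℝ => ((q₀ - p₀ * N) ^ 2
        + p₀ ^ 2 * (s ^ 6 + s ^ 4 * A + s ^ 2 * B)) / (2 * s ^ 3))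
        ((p₀ ^ 2 * (3 + A - B) - 3 * (q₀ - p₀ * N) ^ 2) / 2) 1 := by
      have d := fun n : ℕ => (hasDerivAt_id (1 : ℝ)).pow n
      have a1 := ((((d 6).add ((d 4).mul_const A)).add ((d 2).mul_const B)).const_mul
        (p₀ ^ 2)).const_add ((q₀ - p₀ * N) ^ 2)
      refine (a1.div ((d 3).const_mul 2) (by simp)).congr_deriv ?_
      simp
      ring
    have h3 : (C.potential (p₀, 0, 0, q₀) ∘ fun s : ℝ => ((x, s • C.one) : J × J)) =ᶠ[nhds 1]
        fun s : ℝ => ((q₀ - p₀ * N) ^ 2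
          + p₀ ^ 2 * (s ^ 6 + s ^ 4 * A + s ^ 2 * B)) / (2 * s ^ 3) := by
      filter_upwards [isOpen_ne.mem_nhds (one_ne_zero (α := ℝ))] with s hs
      exact C.potential_axis_smul p₀ q₀ x hs
    have h4 := h2.unique (h1.congr_of_eventuallyEq h3.symm)
    simp only [zero_apply] at h4
    linarith
  have hA0 : 0 ≤ A := C.trace_self_nonneg hC x
  have hB0 : 0 ≤ B := C.trace_self_nonneg hC (C.sharp x)
  have i1 := C.three_mul_sharp_le hC x
  have i2 := C.three_mul_norm_le hC x
  rw [← hA, ← hB] at i1 i2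
  rw [← hN] at i2
  obtain ⟨k, rfl⟩ : ∃ k, q₀ = p₀ * (N + k) := ⟨q₀ / p₀ - N, by field_simp; ring⟩
  have hp2 : p₀ ^ 2 ≠ 0 := pow_ne_zero _ hp
  have f1 : A + 2 * B = 3 * N * k := by
    apply mul_left_cancel₀ hp2
    linear_combination e1
  have f2 : 3 + A - B = 3 * k ^ 2 := by
    apply mul_left_cancel₀ hp2
    linear_combination e2
  -- Squaring A + 2B = 3Nk and using 3N²A ≤ B² bounds the left side by 3B²k².
  have f3 : A * (A + 2 * B) ^ 2 ≤ B ^ 2 * (3 + A - B) := by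
    rw [f1, f2]
    nlinarith [mul_le_mul_of_nonneg_right i2 (sq_nonneg k)]
  -- Bounding 3B² by A²B in `f3` leaves exactly the expansion of a cube.
  have f4 : (A + B) ^ 3 ≤ 0 := by
    nlinarith [mul_le_mul_of_nonneg_right i1 hB0]
  have f5 : A + B ≤ 0 := by
    by_contra hlt
    exact absurd f4 (not_le.2 (pow_pos (not_le.1 hlt) 3))
  have hx : x = 0 := C.eq_zero_of_trace_self hC (by rw [← hA]; linarith)
  refine ⟨hx, ?_⟩
  have hN0 : N = 0 := by rw [hN, hx, norm_zero']
  have hA1 : A = 0 := by linarith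
  have hB1 : B = 0 := by linarith
  rw [hA1, hB1] at f2
  rw [hN0]
  linear_combination (-p₀ ^ 2 / 3) * f2

/-- A map U_w moves a critical point to imaginary part 1, where the critical equations are solved;
the resulting points have value |p⁰q₀|. This is a lower bound on the whole open domain, so points
with that value are minima and hence critical. -/
theorem criticalLocus_axis_tfae (hC : C.IsEuclidean) {p₀ q₀ : ℝ} (hp : p₀ ≠ 0) (hq : q₀ ≠ 0)
    {z : J × J} (hz : z ∈ C.domain) : List.TFAE [z ∈ C.criticalLocus b (p₀, 0, 0, q₀),
      z.1 = 0 ∧ C.norm z.2 = |q₀ / p₀|, C.potential (p₀, 0, 0, q₀) z = |p₀ * q₀|] := by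
  tfae_have 1 → 2 := by
    intro h
    obtain ⟨w, x, hw, rfl⟩ := C.exists_uop_pair hC hz
    have hw2 : 0 < C.norm w ^ 2 := by positivity
    have h1 : ((x, C.one) : J × J) ∈ C.domain := C.one_mem_cone
    have h2 := C.action_mem_criticalLocus_iff b hC (C.levi_mem hC hw)
      (γ := (p₀, 0, 0, q₀ / C.norm w ^ 2)) h1
    rw [levi_axis, action_levi] at h2
    obtain ⟨hx, hpq⟩ := C.eq_zero_of_mem_criticalLocus_axis_one b hC hp (h2.1 h)
    refine ⟨by simp [hx], ?_⟩
    rw [norm_uop _ _ _ hw, C.norm_one, mul_one, abs_div, eq_div_iff (abs_ne_zero.2 hp)]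
    have h3 : |q₀ / C.norm w ^ 2| = |p₀| := (sq_eq_sq_iff_abs_eq_abs _ _).1 hpq
    rw [abs_div, abs_of_pos hw2, div_eq_iff hw2.ne'] at h3
    rw [h3]; ring
  tfae_have 2 → 3 := by
    rintro ⟨h1, h2⟩
    obtain ⟨x, y⟩ := z
    simp only at h1 h2
    subst h1
    have h0 : 0 < |p₀| := abs_pos.2 hp
    have h0' : 0 < |q₀| := abs_pos.2 hq
    rw [potential_axis_zero, h2, abs_div, abs_mul, ← sq_abs q₀, ← sq_abs p₀]
    field_simp
    ring
  tfae_have 3 → 1 := by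
    intro h
    rw [mem_criticalLocus_iff _ _ hC]
    refine ⟨hz, ?_⟩
    have hmin : IsLocalMin (C.potential (p₀, 0, 0, q₀)) z := by
      filter_upwards [(C.isOpen_domain hC).mem_nhds hz] with u hu
      rw [h]
      exact C.le_potential_axis hC p₀ q₀ hu
    have hd := (C.differentiableAt_potential (p₀, 0, 0, q₀) (C.domain_norm_pos hz).ne').hasFDerivAt
    rwa [hmin.fderiv_eq_zero] at hd
  tfae_finish

/-- On the axis |p⁰q₀| = √(-I₄), and V_eff and √(-I₄) both scale by ν. Criticality thus becomes a
pointwise condition, which can be followed along a single move by an element that need not preserve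
the domain. -/
theorem mem_criticalLocus_iff_potential (hC : C.IsEuclidean) {γ : ChargeSpace J}
    (hγ : C.quartic γ < 0) {z : J × J} (hz : z ∈ C.domain) :
    z ∈ C.criticalLocus b γ ↔ C.potential γ z = Real.sqrt (-C.quartic γ) := by
  obtain ⟨g, hg, p₀, q₀, h⟩ := C.exists_normal_form hC hγ
  obtain ⟨ν, hν, h1, -, h3⟩ := C.exists_multiplier_of_mem hg
  have hq := C.quartic_neg_of_mem hg.1 hγ
  rw [h, quartic_axis] at hq
  have hp0 : p₀ ≠ 0 := by rintro rfl; simp at hq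
  have hq0 : q₀ ≠ 0 := by rintro rfl; simp at hq
  have h4 := h1 γ
  rw [h, quartic_axis] at h4
  have h5 : |p₀ * q₀| = ν * Real.sqrt (-C.quartic γ) := by
    rw [← Real.sqrt_sq hν.le, ← Real.sqrt_mul (sq_nonneg _), ← Real.sqrt_sq_eq_abs]
    congr 1
    linarith
  have h6 : C.action g z ∈ C.criticalLocus b (p₀, 0, 0, q₀) ↔
      C.potential (p₀, 0, 0, q₀) (C.action g z) = |p₀ * q₀| :=
    (C.criticalLocus_axis_tfae b hC hp0 hq0 (C.action_mem hg hz)).out 0 2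
  rw [← C.action_mem_criticalLocus_iff b hC hg hz, h, h6, h5, ← h, h3 γ z hz]
  exact mul_right_inj' hν.ne'

end Axis

end CubicNormStructure

namespace CubicNormStructure

/-! ### Invariance of the Kähler metric. -/

section Gram

variable {J : Type*} [AddCommGroup J] [Module ℝ J] (C : CubicNormStructure J)

/-- The squared Fubini–Study length `(|h(u, v)|² - h(u, u) h(v, v)) / h(v, v)²` of the tangent vector
at `[v]` represented by `u`, for the hermitian form `h(u, v) = i ⟨u, v̄⟩`. -/
noncomputable def gram (v u : ChargeSpace J × ChargeSpace J) : ℝ :=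
  ((C.symp u.1 v.2 - C.symp u.2 v.1) ^ 2 + (C.symp u.1 v.1 + C.symp u.2 v.2) ^ 2
    - (2 * C.symp u.1 u.2) * (2 * C.symp v.1 v.2)) / (2 * C.symp v.1 v.2) ^ 2

theorem symp_swap (v w : ChargeSpace J) : C.symp v w = -C.symp w v := by
  rw [symp, symp, C.trace_symm v.2.2.1, C.trace_symm v.2.1]
  ring

theorem gram_map {g : ChargeSpace J ≃ₗ[ℝ] ChargeSpace J} {ν : ℝ} (hν : ν ≠ 0)
    (hg : ∀ v w, C.symp (g v) (g w) = ν * C.symp v w) (v u : ChargeSpace J × ChargeSpace J) :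
    C.gram (g v.1, g v.2) (g u.1, g u.2) = C.gram v u := by
  simp only [gram, hg]
  rw [show (ν * C.symp u.1 v.2 - ν * C.symp u.2 v.1) ^ 2 +
      (ν * C.symp u.1 v.1 + ν * C.symp u.2 v.2) ^ 2 -
      2 * (ν * C.symp u.1 u.2) * (2 * (ν * C.symp v.1 v.2)) =
      ν ^ 2 * ((C.symp u.1 v.2 - C.symp u.2 v.1) ^ 2 + (C.symp u.1 v.1 + C.symp u.2 v.2) ^ 2
    - (2 * C.symp u.1 u.2) * (2 * C.symp v.1 v.2)) by ring,
    show (2 * (ν * C.symp v.1 v.2)) ^ 2 = ν ^ 2 * (2 * C.symp v.1 v.2) ^ 2 by ring]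
  exact mul_div_mul_left _ _ (pow_ne_zero 2 hν)

theorem symp_add_left (u v w : ChargeSpace J) : C.symp (u + v) w = C.symp u w + C.symp v w := by
  simp only [symp, Prod.fst_add, Prod.snd_add, map_add, LinearMap.add_apply]
  ring

theorem symp_smul_left (a : ℝ) (v w : ChargeSpace J) : C.symp (a • v) w = a * C.symp v w := by
  simp only [symp, Prod.smul_fst, Prod.smul_snd, map_smul, LinearMap.smul_apply, smul_eq_mul]
  ring

theorem symp_add_right (u v w : ChargeSpace J) : C.symp w (u + v) = C.symp w u + C.symp w v := by
  rw [symp_swap, symp_add_left, C.symp_swap w, C.symp_swap w]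
  ring

theorem symp_smul_right (a : ℝ) (v w : ChargeSpace J) : C.symp w (a • v) = a * C.symp w v := by
  rw [symp_swap, symp_smul_left, C.symp_swap w]
  ring

theorem symp_self (v : ChargeSpace J) : C.symp v v = 0 := by
  have := C.symp_swap v v
  linarith

/-- The Fubini–Study length sees u only modulo ℂv, and v and u only up to a common scalar. -/
theorem gram_complexSMul {c : ℂ} (hc : c ≠ 0) (d : ℂ) (v u : ChargeSpace J × ChargeSpace J) :
    C.gram (complexSMul c v) (complexSMul d v + complexSMul c u) = C.gram v u := by
  have hn : Complex.normSq c ≠ 0 := by simpa using hc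
  have e1 : C.symp v.2 v.1 = -C.symp v.1 v.2 := C.symp_swap _ _
  have e2 : C.symp u.2 u.1 = -C.symp u.1 u.2 := C.symp_swap _ _
  have e3 : C.symp v.1 u.1 = -C.symp u.1 v.1 := C.symp_swap _ _
  have e4 : C.symp v.1 u.2 = -C.symp u.2 v.1 := C.symp_swap _ _
  have e5 : C.symp v.2 u.1 = -C.symp u.1 v.2 := C.symp_swap _ _
  have e6 : C.symp v.2 u.2 = -C.symp u.2 v.2 := C.symp_swap _ _
  have hden : (2 * C.symp (complexSMul c v).1 (complexSMul c v).2) ^ 2 =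
      Complex.normSq c ^ 2 * (2 * C.symp v.1 v.2) ^ 2 := by
    rw [symp_complexSMul]; ring
  rw [gram, gram, hden, ← mul_div_mul_left _ ((2 * C.symp v.1 v.2) ^ 2) (pow_ne_zero 2 hn)]
  congr 1
  simp only [complexSMul, sub_eq_add_neg, ← neg_smul, Prod.fst_add, Prod.snd_add, symp_add_left,
    symp_add_right, symp_smul_left, symp_smul_right, symp_self, e1, e2, e3, e4, e5, e6,
    Complex.normSq_apply]
  ring

end Gram

section Isometry

variable {J : Type*} [NormedAddCommGroup J] [NormedSpace ℝ J] (C : CubicNormStructure J)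
  [FiniteDimensional ℝ J]

/-- Differentiate g Ω(z) = f(z) Ω(gz). The term with df is a multiple of Ω(gz), which `gram`
ignores. -/
theorem map_periodDeriv (hC : C.IsEuclidean) {g : ChargeSpace J ≃ₗ[ℝ] ChargeSpace J}
    (hg : g ∈ C.domainGroup) {z : J × J} (hz : z ∈ C.domain) (w : J × J) : ∃ d : ℂ,
    (g (C.periodDeriv z w).1, g (C.periodDeriv z w).2) =
      complexSMul d (C.period (C.action g z)) + complexSMul (C.factor g z)
        (C.periodDeriv (C.action g z) (fderiv ℝ (C.action g) z w)) := by
  have hP : ∀ z, HasFDerivAt C.period (fderiv ℝ C.period z) z := fun z =>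
    ((C.contDiff_period (n := 1)).differentiable one_ne_zero).differentiableAt.hasFDerivAt
  have hF : HasFDerivAt (C.factor g) (fderiv ℝ (C.factor g) z) z :=
    ((C.contDiff_factor g (n := 1)).differentiable one_ne_zero).differentiableAt.hasFDerivAt
  have hA := (C.differentiableAt_action hC hg hz).hasFDerivAt
  have hQ := (hP _).comp z hA
  have hre := Complex.reCLM.hasFDerivAt.comp z hF
  have him := Complex.imCLM.hasFDerivAt.comp z hF
  have h1 := ((hre.smul hQ.fst).sub (him.smul hQ.snd)).prodMk
    ((hre.smul hQ.snd).add (him.smul hQ.fst))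
  have h2 := ((LinearMap.toContinuousLinearMap g.toLinearMap).hasFDerivAt.comp z (hP z).fst).prodMk
    ((LinearMap.toContinuousLinearMap g.toLinearMap).hasFDerivAt.comp z (hP z).snd)
  have heq := h2.congr_of_eventuallyEq (f₁ := fun z => complexSMul (C.factor g z)
      (C.period (C.action g z))) (by
    filter_upwards [(C.isOpen_domain hC).mem_nhds hz] with u hu
    exact (C.factor_spec (C.moves_action hg hu)).2.symm)
  have h3 := DFunLike.congr_fun (heq.unique h1) w
  refine ⟨fderiv ℝ (C.factor g) z w, ?_⟩
  rw [← fderiv_period, ← fderiv_period]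
  refine Eq.trans h3 ?_
  simp only [complexSMul]
  refine Prod.ext ?_ ?_
  · simp
    abel
  · simp
    abel

theorem gram_action (hC : C.IsEuclidean) {g : ChargeSpace J ≃ₗ[ℝ] ChargeSpace J}
    (hg : g ∈ C.domainGroup) {z : J × J} (hz : z ∈ C.domain) (w : J × J) :
    C.gram (C.period (C.action g z))
      (C.periodDeriv (C.action g z) (fderiv ℝ (C.action g) z w)) =
      C.gram (C.period z) (C.periodDeriv z w) := by
  obtain ⟨ν, hν, -, h, -⟩ := C.exists_multiplier_of_mem hg
  obtain ⟨d, hd⟩ := C.map_periodDeriv hC hg hz w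
  obtain ⟨hf, hf'⟩ := C.factor_spec (C.moves_action hg hz)
  rw [← C.gram_map hν.ne' h (C.period z), hf', hd, C.gram_complexSMul hf]

omit [FiniteDimensional ℝ J] in
theorem action_translation (x : J) : C.action (C.translation x) = fun z => (z.1 + x, z.2) :=
  funext fun z => C.action_eq_of_moves (C.translation_moves x z)

theorem gram_period (hC : C.IsEuclidean) {z : J × J} (hz : z ∈ C.domain) (w : J × J) :
    C.gram (C.period z) (C.periodDeriv z w) =
      (C.trace (C.uop (C.sharp z.2) w.1) w.1 + C.trace (C.uop (C.sharp z.2) w.2) w.2) /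
        (4 * C.norm z.2 ^ 2) := by
  have hN := C.domain_norm_pos hz
  rw [← C.gram_action hC (C.translation_mem (-z.1)) hz w]
  have hd : fderiv ℝ (C.action (C.translation (-z.1))) z w = w := by
    rw [action_translation]
    have h : HasFDerivAt (fun z' : J × J => (z'.1 + -z.1, z'.2))
        ((ContinuousLinearMap.fst ℝ J J).prod (ContinuousLinearMap.snd ℝ J J)) z :=
      (hasFDerivAt_fst.add_const _).prodMk hasFDerivAt_snd
    rw [h.fderiv]
    rfl
  rw [hd, action_translation]
  have k1 : C.trace w.1 (C.cross z.2 w.1) = C.trace (C.cross z.2 w.1) w.1 := C.trace_symm _ _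
  have k2 : C.trace w.2 (C.cross z.2 w.2) = C.trace (C.cross z.2 w.2) w.2 := C.trace_symm _ _
  have k3 := C.trace_symm z.2 (C.cross z.2 w.1)
  have k4 := C.trace_symm z.2 (C.cross z.2 w.2)
  have k5 : C.trace (C.cross z.2 w.1) z.2 = 2 * C.trace (C.sharp z.2) w.1 :=
    C.trace_cross_left_self _ _
  have k6 : C.trace (C.cross z.2 w.2) z.2 = 2 * C.trace (C.sharp z.2) w.2 :=
    C.trace_cross_left_self _ _
  have k9 : C.trace (C.sharp z.2) z.2 = 3 * C.norm z.2 := C.trace_sharp_self z.2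
  have k7 := C.trace_symm w.1 (C.sharp z.2)
  have k8 := C.trace_symm w.2 (C.sharp z.2)
  rw [gram, div_eq_div_iff]
  · simp [symp, period, periodDeriv, sharpC, normC, uop_apply, C.sharp_sharp, k1, k5, k6,
      k7, k8, k9, C.norm_zero']
    ring
  · simp [symp, period, sharpC, normC, C.norm_zero', k9]
    linarith
  · positivity

variable {ι : Type*} [Fintype ι] [DecidableEq ι] (b : Module.Basis ι ℝ J)

omit [FiniteDimensional ℝ J] [DecidableEq ι] in
theorem trace_eq_sum_basis (B : J →ₗ[ℝ] J →ₗ[ℝ] ℝ) (x y : J) :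
    B x y = ∑ i, ∑ j, B (b i) (b j) * b.repr x i * b.repr y j := by
  conv_lhs => rw [← b.sum_repr x, ← b.sum_repr y]
  simp only [map_sum, LinearMap.sum_apply, map_smul, LinearMap.smul_apply, smul_eq_mul]
  rw [Finset.sum_comm]
  simp only [Finset.mul_sum]
  refine Finset.sum_congr rfl fun i _ => Finset.sum_congr rfl fun j _ => by ring

-- Because e^{-K} = i⟨Ω, Ω̄⟩, the form ∂∂̄K is the pulled-back Fubini–Study metric; both sides are
-- evaluated here as the quadratic form of U_{y^#}/(4N²). Isometry of the group action then follows
-- from `gram_action`.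
omit [DecidableEq ι] in
theorem lengthSq_eq (hC : C.IsEuclidean) {z : J × J} (hz : z ∈ C.domain) (w : J × J) :
    C.lengthSq b z w = C.gram (C.period z) (C.periodDeriv z w) := by
  rw [C.gram_period hC hz, lengthSq, Complex.re_sum]
  have h := fun x => trace_eq_sum_basis b (C.trace ∘ₗ C.uop (C.sharp z.2)) x x
  simp only [LinearMap.comp_apply] at h
  rw [h w.1, h w.2, ← Finset.sum_add_distrib, Finset.sum_div]
  refine Finset.sum_congr rfl fun i _ => ?_
  rw [Complex.re_sum, ← Finset.sum_add_distrib, Finset.sum_div]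
  refine Finset.sum_congr rfl fun j _ => ?_
  rw [C.metric_apply b hC hz, mul_assoc, Complex.re_ofReal_mul]
  simp
  ring

omit [DecidableEq ι] in
theorem lengthSq_action (hC : C.IsEuclidean) {g : ChargeSpace J ≃ₗ[ℝ] ChargeSpace J}
    (hg : g ∈ C.domainGroup) {z : J × J} (hz : z ∈ C.domain) (w : J × J) :
    C.lengthSq b (C.action g z) (fderiv ℝ (C.action g) z w) = C.lengthSq b z w := by
  rw [C.lengthSq_eq b hC hz, C.lengthSq_eq b hC (C.action_mem hg hz), C.gram_action hC hg hz]

end Isometry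

end CubicNormStructure

namespace CubicNormStructure

/-! ### Geodesic symmetries. -/

section Symmetry

variable {J : Type*} [NormedAddCommGroup J] [NormedSpace ℝ J] (C : CubicNormStructure J)

theorem base_mem_domain : ((0, C.one) : J × J) ∈ C.domain := C.one_mem_cone

theorem normC_base : C.normC (0, C.one) = -Complex.I := by
  apply Complex.ext <;> simp [normC, C.norm_one, C.norm_zero']

theorem action_inversion_base : C.action inversion (0, C.one) = (0, C.one) := by
  rw [C.action_eq_of_moves (C.inversion_moves (by simp [normC_base])), normC_base]
  simp [complexSMul, sharpC, C.sharp_one]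

variable [FiniteDimensional ℝ J]

theorem action_inversion_inversion (hC : C.IsEuclidean) {z : J × J} (hz : z ∈ C.domain) :
    C.action inversion (C.action inversion z) = z := by
  rw [← C.action_mul (C.inversion_mem hC) (C.inversion_mem hC) hz, inversion_mul_inversion]
  exact C.action_eq_of_moves (C.moves_one z).neg

/-- The automorphy factor at i·1 is -i. In the relation of `map_periodDeriv` the first component of
V gives d, and the J-component then gives the differential. -/
theorem fderiv_action_inversion_base (hC : C.IsEuclidean) :
    fderiv ℝ (C.action inversion) ((0, C.one) : J × J) = -ContinuousLinearMap.id ℝ (J × J) := by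
  have hι := C.inversion_mem hC
  have hf : C.factor inversion (0, C.one) = -Complex.I := by
    rw [← C.normC_base, factor]
    rfl
  refine ContinuousLinearMap.ext fun w => ?_
  obtain ⟨d, hd⟩ := C.map_periodDeriv hC hι C.base_mem_domain w
  rw [action_inversion_base, hf] at hd
  set D := fderiv ℝ (C.action inversion) ((0, C.one) : J × J) w
  have h1 := congrArg (fun v => v.1.1) hd
  have h2 := congrArg (fun v => v.2.1) hd
  have h3 := congrArg (fun v => v.1.2.1) hd
  have h4 := congrArg (fun v => v.2.2.1) hd
  simp only [inversion_apply, complexSMul, period, periodDeriv, sharpC, Prod.fst_add, Prod.snd_add,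
    Prod.fst_sub, Prod.snd_sub, Prod.smul_fst, Prod.smul_snd, polar_sharp, C.sharp_one, C.one_cross',
    map_zero, LinearMap.zero_apply, smul_eq_mul, Complex.neg_re,
    Complex.neg_im, Complex.I_re, Complex.I_im, map_sub, LinearMap.sub_apply] at h1 h2 h3 h4
  norm_num at h1 h2 h3 h4
  rw [← h2] at h3
  rw [← h1] at h4
  refine Prod.ext ?_ ?_
  · simp
    linear_combination (norm := module) h4
  · simp
    linear_combination (norm := module) -h3

variable {ι : Type*} [Fintype ι] [DecidableEq ι] (b : Module.Basis ι ℝ J)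

-- The inversion is the symmetry at i·1, and conjugation by k carries it to k(i·1); the
-- differentials of k and k⁻¹ cancel around the central -1.
omit [DecidableEq ι] in
theorem isGeodesicSymmetry_action (hC : C.IsEuclidean) {k : ChargeSpace J ≃ₗ[ℝ] ChargeSpace J}
    (hk : k ∈ C.domainGroup) : C.IsGeodesicSymmetry b (C.action k (0, C.one))
      (C.action (k * inversion * k⁻¹)) := by
  have hι := C.inversion_mem hC
  have hki := C.domainGroup.inv_mem hk
  have hk1 := C.domainGroup.mul_mem hk hι
  have hh := C.domainGroup.mul_mem hk1 hki
  have hmul : ∀ z ∈ C.domain, C.action (k * inversion * k⁻¹) z =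
      C.action k (C.action inversion (C.action k⁻¹ z)) := fun z hz => by
    rw [C.action_mul hk1 hki hz, C.action_mul hk hι (C.action_mem hki hz)]
  have hp := C.action_mem hk C.base_mem_domain
  refine ⟨fun z hz => C.action_mem hh hz, C.contDiffOn_action hh, fun z hz => ?_,
    fun z hz w => C.lengthSq_action b hC hh hz w, ?_, ?_⟩
  · have h1 := C.action_mem hki hz
    rw [hmul _ (C.action_mem hh hz), hmul _ hz, C.action_inv_action hk (C.action_mem hι h1),
      C.action_inversion_inversion hC h1, C.action_action_inv hk hz]
  · rw [hmul _ hp, C.action_inv_action hk C.base_mem_domain, action_inversion_base]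
  · have hA := (C.differentiableAt_action hC hk C.base_mem_domain).hasFDerivAt
    have hB := (C.differentiableAt_action hC hki hp).hasFDerivAt
    have hI := (C.differentiableAt_action hC hι C.base_mem_domain).hasFDerivAt
    rw [C.fderiv_action_inversion_base hC] at hI
    set p := C.action k (0, C.one)
    have e1 : C.action k⁻¹ p = (0, C.one) := C.action_inv_action hk C.base_mem_domain
    have hnhds := (C.isOpen_domain hC).mem_nhds hp
    have hid := HasFDerivAt.comp (g := C.action k) p (by rwa [e1]) hB
    have hid' := hid.unique ((hasFDerivAt_id p).congr_of_eventuallyEq (by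
      filter_upwards [hnhds] with z hz using C.action_action_inv hk hz))
    have h1 := HasFDerivAt.comp (g := C.action inversion) p (by rwa [e1]) hB
    have h2 := HasFDerivAt.comp (g := C.action k) (f := C.action inversion ∘ C.action k⁻¹) p
      (by rwa [Function.comp_apply, e1, action_inversion_base]) h1
    refine (h2.congr_of_eventuallyEq ?_).fderiv.trans ?_
    · filter_upwards [hnhds] with z hz using hmul z hz
    · rw [ContinuousLinearMap.neg_comp, ContinuousLinearMap.comp_neg, ContinuousLinearMap.id_comp,
        hid']

theorem mem_criticalLocus_axis_iff (hC : C.IsEuclidean) {p₀ q₀ : ℝ} (hp : p₀ ≠ 0) (hq : q₀ ≠ 0)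
    {z : J × J} : z ∈ C.criticalLocus b (p₀, 0, 0, q₀) ↔
      z ∈ C.domain ∧ z.1 = 0 ∧ C.norm z.2 = |q₀ / p₀| :=
  ⟨fun h => ⟨h.1, ((C.criticalLocus_axis_tfae b hC hp hq h.1).out 0 1).1 h⟩,
    fun h => ((C.criticalLocus_axis_tfae b hC hp hq h.1).out 0 1).2 h.2⟩

theorem exists_levi_base (hC : C.IsEuclidean) {z : J × J} (hz : z ∈ C.domain) (h0 : z.1 = 0) :
    ∃ w, ∃ hw : C.norm w ≠ 0, C.action (C.levi w hw) (0, C.one) = z ∧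
      C.norm w ^ 2 = C.norm z.2 := by
  obtain ⟨w, hw0, hw⟩ := C.exists_uop_one_eq_of_mem_cone hC hz
  have hN := C.domain_norm_pos hz
  have hn : C.norm w ^ 2 = C.norm z.2 := by
    rw [← hw, C.norm_uop _ _ hw0, C.norm_one, mul_one]
  refine ⟨w, hw0, ?_, hn⟩
  rw [action_levi, map_zero, hw]
  exact Prod.ext h0.symm rfl

theorem exists_axis_form (hC : C.IsEuclidean) {γ : ChargeSpace J} (hγ : C.quartic γ < 0) :
    ∃ g ∈ C.domainGroup, ∃ p₀ q₀ : ℝ, p₀ ≠ 0 ∧ q₀ ≠ 0 ∧ g γ = (p₀, 0, 0, q₀) := by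
  obtain ⟨g, hg, p₀, q₀, hgγ⟩ := C.exists_normal_form hC hγ
  have hneg : C.quartic (p₀, 0, 0, q₀) < 0 := hgγ ▸ C.quartic_neg_of_mem hg.1 hγ
  rw [quartic_axis] at hneg
  refine ⟨g, hg, p₀, q₀, ?_, ?_, hgγ⟩ <;> rintro rfl <;> simp at hneg

/-- After g, the symmetry at p sends the axis charge to (q₀/N(w)², 0, 0, -p⁰N(w)²). Since p lies on
the slice, N(w)² = |q₀/p⁰|, so this is ±(p⁰, 0, 0, -q₀): in general not ±γ in these coordinates, but
a charge with the same value |q₀/p⁰| and therefore the same critical locus. -/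
theorem exists_geodesicSymmetry_mapsTo (hC : C.IsEuclidean) {γ : ChargeSpace J}
    (hγ : C.quartic γ < 0) {p : J × J} (hp : p ∈ C.criticalLocus b γ) :
    ∃ σ, C.IsGeodesicSymmetry b p σ ∧
      Set.MapsTo σ (C.criticalLocus b γ) (C.criticalLocus b γ) := by
  obtain ⟨g, hg, p₀, q₀, hp₀, hq₀, hgγ⟩ := C.exists_axis_form hC hγ
  have hgi := C.domainGroup.inv_mem hg
  have hp' := (C.action_mem_criticalLocus_iff b hC hg hp.1).2 hp
  rw [hgγ, C.mem_criticalLocus_axis_iff b hC hp₀ hq₀] at hp'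
  obtain ⟨hpd, hp1, hp2⟩ := hp'
  obtain ⟨w, hw, hwp, hwn⟩ := C.exists_levi_base hC hpd hp1
  have hl := C.levi_mem hC hw
  have hk := C.domainGroup.mul_mem hgi hl
  have hσ := C.isGeodesicSymmetry_action b hC hk
  rw [C.action_mul hgi hl C.base_mem_domain, hwp, C.action_inv_action hg hp.1] at hσ
  refine ⟨_, hσ, fun z hz => ?_⟩
  have hh := C.domainGroup.mul_mem (C.domainGroup.mul_mem hk (C.inversion_mem hC))
    (C.domainGroup.inv_mem hk)
  have hz' := C.action_mem_criticalLocus b hC hh hz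
  rw [← C.action_mem_criticalLocus_iff b hC hg hz'.1]
  have hz'' := C.action_mem_criticalLocus b hC hg hz'
  have e1 : (g⁻¹ * C.levi w hw)⁻¹ γ = (p₀, 0, 0, q₀ / C.norm w ^ 2) := by
    rw [mul_inv_rev, inv_inv, LinearEquiv.mul_apply, hgγ, ← C.levi_axis hw p₀ q₀]
    exact (C.levi w hw).symm_apply_apply _
  have e2 : g ((g⁻¹ * C.levi w hw * inversion * (g⁻¹ * C.levi w hw)⁻¹ :
      ChargeSpace J ≃ₗ[ℝ] ChargeSpace J) γ) =
      (q₀ / C.norm w ^ 2, 0, 0, -(p₀ * C.norm w ^ 2)) := by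
    rw [LinearEquiv.mul_apply, e1, LinearEquiv.mul_apply, LinearEquiv.mul_apply]
    refine (g.apply_symm_apply _).trans ?_
    rw [inversion_apply]
    simp only [neg_zero]
    rw [show -p₀ = -(p₀ * C.norm w ^ 2) / C.norm w ^ 2 by field_simp, levi_axis]
  rw [e2, C.mem_criticalLocus_axis_iff b hC (by positivity) (by simp [hp₀, hw])] at hz''
  rw [hgγ, C.mem_criticalLocus_axis_iff b hC hp₀ hq₀]
  refine ⟨hz''.1, hz''.2.1, hz''.2.2.trans ?_⟩
  rw [show -(p₀ * C.norm w ^ 2) / (q₀ / C.norm w ^ 2) = -((C.norm w ^ 2) ^ 2 / (q₀ / p₀)) by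
    field_simp, hwn, hp2, sq_abs, abs_neg, pow_two, mul_div_cancel_right₀ _ (by positivity)]

end Symmetry

end CubicNormStructure

/-! ### The slice N(y) = c as a connected closed submanifold. -/

theorem IsEmbeddedSubmanifold.of_chart {E : Type*} [NormedAddCommGroup E] [NormedSpace ℝ E] {d : ℕ}
    {S : Set E} (φ : OpenPartialHomeomorph E E) (W : Submodule ℝ E) (hS : S ⊆ φ.source)
    (hW : Module.finrank ℝ W = d) (h1 : ContDiffOn ℝ ∞ φ φ.source)
    (h2 : ContDiffOn ℝ ∞ φ.symm φ.target) (h : ∀ z ∈ φ.source, z ∈ S ↔ φ z ∈ W) :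
    IsEmbeddedSubmanifold d S :=
  fun _ hp => ⟨φ, W, hS hp, hW, h1, h2, h⟩

namespace CubicNormStructure

section Slice

variable {J : Type*} [NormedAddCommGroup J] [NormedSpace ℝ J] (C : CubicNormStructure J)

/-- The points `i y` of the tube domain with `N(y) = c`. -/
def normSlice (c : ℝ) : Set (J × J) := {z | z ∈ C.domain ∧ z.1 = 0 ∧ C.norm z.2 = c}

variable [FiniteDimensional ℝ J]

theorem trace_one_pos (hC : C.IsEuclidean) {y : J} (hy : y ∈ C.cone) : 0 < C.trace C.one y :=
  ((C.mem_cone_iff hC).1 hy).1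

/-- The slice is the image of the connected cone under the rescaling y ↦ (c/N(y))^{1/3} y. -/
theorem isConnected_normSlice (hC : C.IsEuclidean) {c : ℝ} (hc : 0 < c) :
    IsConnected (C.normSlice c) := by
  let f : J → J × J := fun y => (0, Real.exp ((Real.log c - Real.log (C.norm y)) / 3) • y)
  have hf : ContinuousOn f C.cone := by
    refine continuousOn_const.prodMk (ContinuousOn.smul ?_ continuousOn_id)
    refine Real.continuous_exp.comp_continuousOn ((continuousOn_const.sub
      (ContinuousOn.log (C.contDiff_norm (n := 0)).continuous.continuousOn fun y hy => ?_)).div_const 3)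
    exact (C.cone_subset_norm_pos hy).ne'
  have himg : f '' C.cone = C.normSlice c := by
    ext z
    constructor
    · rintro ⟨y, hy, rfl⟩
      have hN := C.cone_subset_norm_pos hy
      refine ⟨C.smul_mem_cone hC (Real.exp_pos _) hy, rfl, ?_⟩
      simp only [f, norm_smul', ← Real.exp_nat_mul]
      rw [Nat.cast_ofNat, mul_div_cancel₀ _ (three_ne_zero), Real.exp_sub, Real.exp_log hc,
        Real.exp_log hN, div_mul_cancel₀ _ hN.ne']
    · rintro ⟨hz, h0, hN⟩
      refine ⟨z.2, hz, Prod.ext h0.symm ?_⟩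
      simp [f, hN]
  rw [← himg]
  exact ⟨⟨_, C.one, C.one_mem_cone, rfl⟩, C.isPreconnected_cone.image f hf⟩

theorem exists_isClosed_normSlice (c : ℝ) :
    ∃ T : Set (J × J), IsClosed T ∧ C.normSlice c = T ∩ C.domain := by
  refine ⟨{z | z.1 = 0} ∩ {z | C.norm z.2 = c}, ?_, ?_⟩
  · exact (isClosed_eq continuous_fst continuous_const).inter
      (isClosed_eq ((C.contDiff_norm (n := 0)).continuous.comp continuous_snd) continuous_const)
  · ext z
    simp only [normSlice, Set.mem_ofPred_eq, Set.mem_inter_iff]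
    tauto

/-- A global chart of the tube domain in which the slice `x = 0`, `N(y) = c` is linear. -/
noncomputable def normChart (hC : C.IsEuclidean) (c : ℝ) :
    OpenPartialHomeomorph (J × J) (J × J) where
  -- The first summand has trace 1 and records the ray of y; the multiple of 1 records the norm.
  -- Since (1, 1) = 3, the constant 1/3 makes the trace of the image 3(log N(y) - log c).
  toFun z := (z.1, (C.trace C.one z.2)⁻¹ • z.2 +
    (Real.log (C.norm z.2) - Real.log c - 1 / 3) • C.one)
  -- Shifting v along 1 to trace 1 recovers the ray; the exponential restores the norm on it.
  invFun v := (v.1, Real.exp ((Real.log c + C.trace C.one v.2 / 3 -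
    Real.log (C.norm (v.2 + (1 / 3 - C.trace C.one v.2 / 3) • C.one))) / 3) •
      (v.2 + (1 / 3 - C.trace C.one v.2 / 3) • C.one))
  source := C.domain
  target := {v | v.2 + (1 / 3 - C.trace C.one v.2 / 3) • C.one ∈ C.cone}
  map_source' z hz := by
    have hT := C.trace_one_pos hC hz
    have h := C.smul_mem_cone hC (inv_pos.2 hT) hz
    simp only [Set.mem_ofPred_eq, map_add, map_smul, smul_eq_mul, trace_one_one,
      inv_mul_cancel₀ hT.ne']
    convert h using 1
    module
  map_target' v hv := C.smul_mem_cone hC (Real.exp_pos _) hv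
  left_inv' z hz := by
    have hT := C.trace_one_pos hC hz
    have hN := C.domain_norm_pos hz
    refine Prod.ext rfl ?_
    simp only [map_add, map_smul, smul_eq_mul, trace_one_one, inv_mul_cancel₀ hT.ne']
    have e : (C.trace C.one z.2)⁻¹ • z.2 + (Real.log (C.norm z.2) - Real.log c - 1 / 3) • C.one +
        (1 / 3 - (1 + (Real.log (C.norm z.2) - Real.log c - 1 / 3) * 3) / 3 : ℝ) • C.one =
        (C.trace C.one z.2)⁻¹ • z.2 := by module
    rw [e, norm_smul', Real.log_mul (by positivity) hN.ne', Real.log_pow, Real.log_inv, smul_smul]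
    push_cast
    rw [show (Real.log c + (1 + (Real.log (C.norm z.2) - Real.log c - 1 / 3) * 3) / 3 -
      (3 * -Real.log (C.trace C.one z.2) + Real.log (C.norm z.2))) / 3 =
      Real.log (C.trace C.one z.2) by ring, Real.exp_log hT, mul_inv_cancel₀ hT.ne', one_smul]
  right_inv' v hv := by
    refine Prod.ext rfl ?_
    have hN := C.cone_subset_norm_pos hv
    have e : C.trace C.one (v.2 + (1 / 3 - C.trace C.one v.2 / 3) • C.one) = 1 := by
      simp only [map_add, map_smul, smul_eq_mul, trace_one_one]
      ring
    simp only
    set d := v.2 + (1 / 3 - C.trace C.one v.2 / 3) • C.one with hd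
    rw [map_smul, e, norm_smul', Real.log_mul (by positivity) hN.ne', Real.log_pow, Real.log_exp,
      smul_smul, smul_eq_mul, mul_one, inv_mul_cancel₀ (Real.exp_pos _).ne', one_smul]
    push_cast
    rw [hd]
    module
  open_source := C.isOpen_domain hC
  open_target := by
    refine (C.isOpen_cone hC).preimage ?_
    have h : Continuous (C.trace C.one) := LinearMap.continuous_of_finiteDimensional _
    fun_prop
  continuousOn_toFun := by
    have h : Continuous (C.trace C.one) := LinearMap.continuous_of_finiteDimensional _
    have h' : Continuous C.norm := (C.contDiff_norm (n := 0)).continuous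
    refine continuousOn_fst.prodMk (ContinuousOn.add (ContinuousOn.smul (ContinuousOn.inv₀
      (by fun_prop) fun z hz => (C.trace_one_pos hC hz).ne') continuousOn_snd)
      (ContinuousOn.smul (ContinuousOn.sub (ContinuousOn.sub (ContinuousOn.log (by fun_prop)
        fun z hz => (C.domain_norm_pos hz).ne') continuousOn_const) continuousOn_const)
        continuousOn_const))
  continuousOn_invFun := by
    have h : Continuous (C.trace C.one) := LinearMap.continuous_of_finiteDimensional _
    have h' : Continuous C.norm := (C.contDiff_norm (n := 0)).continuous
    have hlog : ContinuousOn (fun v : J × J =>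
        Real.log (C.norm (v.2 + (1 / 3 - C.trace C.one v.2 / 3) • C.one)))
        {v | v.2 + (1 / 3 - C.trace C.one v.2 / 3) • C.one ∈ C.cone} :=
      ContinuousOn.log (by fun_prop) fun v hv => (C.cone_subset_norm_pos hv).ne'
    fun_prop

theorem contDiffOn_normChart (hC : C.IsEuclidean) (c : ℝ) :
    ContDiffOn ℝ ∞ (C.normChart hC c) (C.normChart hC c).source := by
  have h : ContDiff ℝ ∞ fun z : J × J => C.trace C.one z.2 := contDiff_snd.linear _
  have h' : ContDiff ℝ ∞ fun z : J × J => C.norm z.2 := C.contDiff_norm.comp contDiff_snd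
  exact contDiffOn_fst.prodMk (ContDiffOn.add (ContDiffOn.smul (ContDiffOn.inv h.contDiffOn
    fun z hz => (C.trace_one_pos hC hz).ne') contDiffOn_snd) (ContDiffOn.smul (ContDiffOn.sub
      (ContDiffOn.sub (ContDiffOn.log h'.contDiffOn fun z hz => (C.domain_norm_pos hz).ne')
        contDiffOn_const) contDiffOn_const) contDiffOn_const))

theorem contDiffOn_normChart_symm (hC : C.IsEuclidean) (c : ℝ) :
    ContDiffOn ℝ ∞ (C.normChart hC c).symm (C.normChart hC c).target := by
  have h : ContDiff ℝ ∞ fun z : J × J => C.trace C.one z.2 := contDiff_snd.linear _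
  have hd : ContDiff ℝ ∞ fun v : J × J => v.2 + (1 / 3 - C.trace C.one v.2 / 3) • C.one :=
    contDiff_snd.add ((contDiff_const.sub (h.div_const 3)).smul contDiff_const)
  have h' := C.contDiff_norm (n := ∞).comp hd
  exact contDiffOn_fst.prodMk (ContDiffOn.smul (Real.contDiff_exp.comp_contDiffOn
    (ContDiffOn.div_const (ContDiffOn.sub (contDiff_const.add (h.div_const 3)).contDiffOn
      (ContDiffOn.log h'.contDiffOn fun v hv => (C.cone_subset_norm_pos hv).ne')) 3)) hd.contDiffOn)

theorem finrank_traceless : Module.finrank ℝ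
    ((LinearMap.ker (C.trace C.one)).map (LinearMap.inr ℝ J J)) = Module.finrank ℝ J - 1 := by
  have h : (C.trace C.one : Module.Dual ℝ J) ≠ 0 := fun h => by
    have := C.trace_one_one
    rw [h] at this
    norm_num at this
  have h1 := Module.Dual.finrank_ker_add_one_of_ne_zero h
  rw [← (Submodule.equivMapOfInjective _ LinearMap.inr_injective
    (LinearMap.ker (C.trace C.one))).finrank_eq]
  omega

theorem normChart_mem_iff (hC : C.IsEuclidean) {c : ℝ} (hc : 0 < c) {z : J × J}
    (hz : z ∈ C.domain) : C.normChart hC c z ∈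
      (LinearMap.ker (C.trace C.one)).map (LinearMap.inr ℝ J J) ↔ z ∈ C.normSlice c := by
  have hT := C.trace_one_pos hC hz
  have hN := C.domain_norm_pos hz
  have e : C.trace C.one (C.normChart hC c z).2 = 3 * (Real.log (C.norm z.2) - Real.log c) := by
    simp only [normChart, OpenPartialHomeomorph.coe_mk, map_add, map_smul,
      smul_eq_mul, trace_one_one, inv_mul_cancel₀ hT.ne']
    ring
  have e1 : (C.normChart hC c z).1 = z.1 := rfl
  have e2 : Real.log (C.norm z.2) = Real.log c ↔ C.norm z.2 = c :=
    ⟨fun h => Real.log_injOn_pos hN hc h, fun h => by rw [h]⟩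
  rw [Submodule.mem_map]
  simp only [LinearMap.mem_ker, LinearMap.coe_inr, Prod.ext_iff]
  rw [normSlice, Set.mem_ofPred_eq, ← e2]
  constructor
  · rintro ⟨v, hv, h1, h2⟩
    rw [← h2, hv] at e
    exact ⟨hz, h1.symm, by linarith⟩
  · rintro ⟨-, h1, h2⟩
    exact ⟨_, by rw [e, h2, sub_self, mul_zero], h1.symm, rfl⟩

/-- The homeomorphism of the tube domain given by an element of the group preserving it. -/
noncomputable def actionHomeomorph (hC : C.IsEuclidean) {g : ChargeSpace J ≃ₗ[ℝ] ChargeSpace J}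
    (hg : g ∈ C.domainGroup) : OpenPartialHomeomorph (J × J) (J × J) where
  toFun := C.action g
  invFun := C.action g⁻¹
  source := C.domain
  target := C.domain
  map_source' _ hz := C.action_mem hg hz
  map_target' _ hz := C.action_mem (C.domainGroup.inv_mem hg) hz
  left_inv' _ hz := C.action_inv_action hg hz
  right_inv' _ hz := C.action_action_inv hg hz
  open_source := C.isOpen_domain hC
  open_target := C.isOpen_domain hC
  continuousOn_toFun := (C.contDiffOn_action hg (n := 0)).continuousOn
  continuousOn_invFun := (C.contDiffOn_action (C.domainGroup.inv_mem hg) (n := 0)).continuousOn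

variable {ι : Type*} [Fintype ι] [DecidableEq ι] (b : Module.Basis ι ℝ J)

/-- Closedness, connectedness and the submanifold chart are pulled back from the slice of the normal
form along the diffeomorphism g of the domain. -/
theorem isSymmetricSubspace_criticalLocus (hC : C.IsEuclidean) {γ : ChargeSpace J}
    (hγ : C.quartic γ < 0) :
    C.IsSymmetricSubspace b (Module.finrank ℝ J - 1) (C.criticalLocus b γ) := by
  obtain ⟨g, hg, p₀, q₀, hp₀, hq₀, hgγ⟩ := C.exists_axis_form hC hγ
  have hgi := C.domainGroup.inv_mem hg
  have hc : 0 < |q₀ / p₀| := by positivity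
  have hmem : ∀ z ∈ C.domain, z ∈ C.criticalLocus b γ ↔ C.action g z ∈ C.normSlice |q₀ / p₀| :=
    fun z hz => by
      rw [← C.action_mem_criticalLocus_iff b hC hg hz, hgγ,
        C.mem_criticalLocus_axis_iff b hC hp₀ hq₀]
      rfl
  refine ⟨fun z hz => hz.1, ?_, ?_, ?_, fun p hp => C.exists_geodesicSymmetry_mapsTo b hC hγ hp⟩
  · obtain ⟨T, hT, hT'⟩ := C.exists_isClosed_normSlice |q₀ / p₀|
    obtain ⟨T', hT1, hT2⟩ := continuousOn_iff_isClosed.1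
      (C.contDiffOn_action hg (n := 0)).continuousOn T hT
    refine ⟨T', hT1, ?_⟩
    rw [← hT2]
    ext z
    by_cases hz : z ∈ C.domain
    · rw [hmem z hz, hT']
      simp [hz, C.action_mem hg hz]
    · exact ⟨fun h => absurd h.1 hz, fun h => absurd h.2 hz⟩
  · have himg : C.action g⁻¹ '' C.normSlice |q₀ / p₀| = C.criticalLocus b γ := by
      ext z
      constructor
      · rintro ⟨u, hu, rfl⟩
        rwa [hmem _ (C.action_mem hgi hu.1), C.action_action_inv hg hu.1]
      · intro hz
        exact ⟨_, (hmem z hz.1).1 hz, C.action_inv_action hg hz.1⟩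
    rw [← himg]
    exact (C.isConnected_normSlice hC hc).image _
      ((C.contDiffOn_action hgi (n := 0)).continuousOn.mono fun z hz => hz.1)
  · have hsrc : ((C.actionHomeomorph hC hg).trans (C.normChart hC |q₀ / p₀|)).source =
        C.domain := by
      rw [OpenPartialHomeomorph.trans_source]
      exact Set.inter_eq_left.2 fun z hz => C.action_mem hg hz
    refine .of_chart ((C.actionHomeomorph hC hg).trans (C.normChart hC |q₀ / p₀|)) _ ?_
      C.finrank_traceless ?_ ?_ fun z hz => ?_
    · rw [hsrc]
      exact fun z hz => hz.1
    · rw [hsrc]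
      exact (C.contDiffOn_normChart hC _).comp (C.contDiffOn_action hg)
        fun z hz => C.action_mem hg hz
    · refine (C.contDiffOn_action hgi).comp ((C.contDiffOn_normChart_symm hC _).mono ?_) ?_
      · exact Set.inter_subset_left
      · exact fun v hv => (C.normChart hC _).map_target hv.1
    · rw [hsrc] at hz
      rw [hmem z hz, ← C.normChart_mem_iff hC hc (C.action_mem hg hz)]
      rfl

end Slice

end CubicNormStructure

namespace CubicNormStructure

/-! ### The critical locus as an orbit of Stab_±. -/

section Orbit

theorem quartic_neg {J : Type*} [AddCommGroup J] [Module ℝ J] (C : CubicNormStructure J)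
    (v : ChargeSpace J) : C.quartic (-v) = C.quartic v := by
  simp only [quartic, Prod.fst_neg, Prod.snd_neg, norm_neg', sharp_neg, map_neg,
    LinearMap.neg_apply]
  ring

variable {J : Type*} [NormedAddCommGroup J] [NormedSpace ℝ J] (C : CubicNormStructure J)
  [FiniteDimensional ℝ J] {ι : Type*} [Fintype ι] [DecidableEq ι] (b : Module.Basis ι ℝ J)

/-- As I₄(±γ) = I₄(γ) ≠ 0, the multiplier satisfies ν² = 1, and ν > 0 because the move joins two
points of the domain. So ν = 1, and V_eff keeps the value √(-I₄) that characterises critical points.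
-/
theorem mem_criticalLocus_of_moves (hC : C.IsEuclidean) {γ : ChargeSpace J}
    (hγ : C.quartic γ < 0) {g : ChargeSpace J ≃ₗ[ℝ] ChargeSpace J} (hg : g ∈ C.stabPM γ)
    {z w : J × J} (hz : z ∈ C.criticalLocus b γ) (hw : w ∈ C.domain) (hm : C.Moves g z w) :
    w ∈ C.criticalLocus b γ := by
  obtain ⟨hg, hgγ⟩ := hg
  obtain ⟨ν, hν, h1, -, h2⟩ := C.exists_multiplier hg hz.1 hw hm
  have e1 : C.quartic (g γ) = C.quartic γ := by
    rcases hgγ with h | h <;> rw [h]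
    exact C.quartic_neg γ
  have e2 : C.potential (g γ) w = C.potential γ w := by
    rcases hgγ with h | h <;> rw [h]
    exact C.potential_neg γ w
  have hν1 : ν = 1 := by
    have h3 := h1 γ
    rw [e1] at h3
    have h4 : (ν - 1) * ((ν + 1) * C.quartic γ) = 0 := by linear_combination -h3
    rcases mul_eq_zero.1 h4 with h5 | h5
    · linarith
    · exact absurd h5 (mul_ne_zero (by linarith) hγ.ne)
  rw [C.mem_criticalLocus_iff_potential b hC hγ hw, ← e2, h2 γ z w hz.1 hm, hν1, one_mul]
  exact (C.mem_criticalLocus_iff_potential b hC hγ hz.1).1 hz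

/-- In normal form both points are images of i·1 under maps U_x and U_y with N(x)² = N(y)² =
|q₀/p⁰|. The quotient of the two Levi elements fixes (p⁰, 0, 0, q₀), and conjugating it by g gives
an element fixing γ itself. -/
theorem exists_mem_stabPM_moves (hC : C.IsEuclidean) {γ : ChargeSpace J}
    (hγ : C.quartic γ < 0) {z w : J × J} (hz : z ∈ C.criticalLocus b γ)
    (hw : w ∈ C.criticalLocus b γ) : ∃ g ∈ C.stabPM γ, C.PreservesDomain g ∧ C.Moves g z w := by
  obtain ⟨g, hg, p₀, q₀, hp₀, hq₀, hgγ⟩ := C.exists_axis_form hC hγ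
  have hgi := C.domainGroup.inv_mem hg
  have hz' := (C.action_mem_criticalLocus_iff b hC hg hz.1).2 hz
  have hw' := (C.action_mem_criticalLocus_iff b hC hg hw.1).2 hw
  rw [hgγ, C.mem_criticalLocus_axis_iff b hC hp₀ hq₀] at hz' hw'
  obtain ⟨x, hx, hxz, hxn⟩ := C.exists_levi_base hC hz'.1 hz'.2.1
  obtain ⟨y, hy, hyw, hyn⟩ := C.exists_levi_base hC hw'.1 hw'.2.1
  have hlx := C.levi_mem hC hx
  have hly := C.levi_mem hC hy
  have hm1 := C.domainGroup.mul_mem hgi hly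
  have hm2 := C.domainGroup.mul_mem (C.domainGroup.inv_mem hlx) hg
  have hm := C.domainGroup.mul_mem hm1 hm2
  refine ⟨_, ⟨hm.1, Or.inl ?_⟩, hm.2, ?_⟩
  · have e1 : (C.levi x hx)⁻¹ (p₀, 0, 0, q₀) = (p₀, 0, 0, q₀ / C.norm x ^ 2) := by
      conv_lhs => rw [← C.levi_axis hx p₀ q₀]
      exact (C.levi x hx).symm_apply_apply _
    rw [LinearEquiv.mul_apply, LinearEquiv.mul_apply, LinearEquiv.mul_apply, hgγ, e1, hxn,
      hz'.2.2, ← hw'.2.2, ← hyn, levi_axis, ← hgγ]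
    exact g.symm_apply_apply _
  · have h := C.moves_action hm hz.1
    rwa [C.action_mul hm1 hm2 hz.1, C.action_mul (C.domainGroup.inv_mem hlx) hg hz.1, ← hxz,
      C.action_inv_action hlx C.base_mem_domain, C.action_mul hgi hly C.base_mem_domain, hyw,
      C.action_inv_action hg hw.1] at h

end Orbit

end CubicNormStructure

theorem mainTheorem3 {J : Type*} [NormedAddCommGroup J] [NormedSpace ℝ J]
    (C : CubicNormStructure J) (hC : C.IsEuclidean) {n : ℕ} (b : Module.Basis (Fin n) ℝ J) :
    (∀ γ : ChargeSpace J, C.quartic γ < 0 →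
      C.IsSymmetricSubspace b (n - 1) (C.criticalLocus b γ) ∧
      ∀ z₀ ∈ C.criticalLocus b γ,
        C.criticalLocus b γ = {z | z ∈ C.domain ∧ ∃ g ∈ C.stabPM γ, C.Moves g z₀ z} ∧
        C.criticalLocus b γ =
          {z | z ∈ C.domain ∧ ∃ g ∈ C.stabPM γ, C.PreservesDomain g ∧ C.Moves g z₀ z}) ∧
    ∀ p₀ q₀ : ℝ, p₀ ≠ 0 → q₀ ≠ 0 →
      C.quartic (p₀, 0, 0, q₀) < 0 ∧
      C.criticalLocus b (p₀, 0, 0, q₀) =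
        {z | z ∈ C.domain ∧ z.1 = 0 ∧ C.norm z.2 = |q₀ / p₀|} := by
  have : FiniteDimensional ℝ J := Module.Finite.of_basis b
  refine ⟨fun γ hγ => ⟨?_, fun z₀ hz₀ => ⟨?_, ?_⟩⟩, fun p₀ q₀ hp hq => ⟨?_, ?_⟩⟩
  · have h := C.isSymmetricSubspace_criticalLocus b hC hγ
    rwa [Module.finrank_eq_card_basis b, Fintype.card_fin] at h
  · ext z
    constructor
    · intro hz
      obtain ⟨g, hg, -, hm⟩ := C.exists_mem_stabPM_moves b hC hγ hz₀ hz
      exact ⟨hz.1, g, hg, hm⟩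
    · rintro ⟨hz, g, hg, hm⟩
      exact C.mem_criticalLocus_of_moves b hC hγ hg hz₀ hz hm
  · ext z
    constructor
    · exact fun hz => ⟨hz.1, C.exists_mem_stabPM_moves b hC hγ hz₀ hz⟩
    · rintro ⟨hz, g, hg, -, hm⟩
      exact C.mem_criticalLocus_of_moves b hC hγ hg hz₀ hz hm
  · rw [C.quartic_axis]
    have : 0 < (p₀ * q₀) ^ 2 := by positivity
    linarith
  · ext z
    exact C.mem_criticalLocus_axis_iff b hC hp hq
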